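/- Let $d\in\{1,2,3\}$, $\mu>0$, and let $V:\mathbb R^d\to\mathbb R$ be radial with $V\in L^1(\mathbb R^d)$; if $d=2$ assume also $V\in L^{p}(\mathbb R^2)$ for some $p\in(1,\infty)$, and if $d=3$ assume also $V\in L^{3/2}(\mathbb R^3)$. With the Fourier transform $\hat f(p)=(2\pi)^{-d/2}\int_{\mathbb R^d} f(x)e^{-ip\cdot x}\,dx$, assume that $\hat V\le 0$ and $\hat V(0)<0$. For $T>0$ let $K_T$ be the Fourier multiplier with symbol $K_T(p)=\dfrac{p^2-\mu}{\tanh\left((p^2-\mu)/(2T)\right)}$, and for $\lambda>0$ let $$T_c=T_c(\lambda)=\inf\{T>0:\ K_T+\lambda V\ge 0\}$$ (nonnegativity and the operator $K_T+\lambda V$ being understood through quadratic forms on $H^1(\mathbb R^d)$). Let $\mathfrak a_0\in H^1(\mathbb R^d)$ be the $L^2$-normalized ground state of $K_{T_c}+\lambda V$, that is $(K_{T_c}+\lambda V)\mathfrak a_0=0$, with phase chosen so that $\hat{\mathfrak a}_0>0$. Put $$\Delta_0=-2(2\pi)^{-d/2}\lambda\,\hat V\star\hat{\mathfrak a}_0,\qquad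 C_{\rm univ}=\sqrt{\frac{8\pi^2}{7\zeta(3)}},\qquad g_1(z)=\frac{\tanh(z/2)}{z^2}-\frac{1}{2z\cosh^2(z/2)},$$ and consider the Ginzburg–Landau functional $\mathcal E_{\rm GL}:\mathbb C\to\mathbb R$, $$\mathcal E_{\rm GL}(\psi)=|\psi|^4\left[\frac1{T_c^3}\int_{\mathbb R^d}\frac{g_1((p^2-\mu)/T_c)}{(p^2-\mu)/T_c}|K_{T_c}(p)|^4|\hat{\mathfrak a}_0(p)|^4\,dp\right]-|\psi|^2\left[\frac1{2T_c}\int_{\mathbb R^d}\frac{|K_{T_c}(p)|^2|\hat{\mathfrak a}_0(p)|^2}{\cosh^2((p^2-\mu)/(2T_c))}\,dp\right].$$ Then for every $\lambda>0$ the functional $\mathcal E_{\rm GL}$ has a minimizer $\psi_{\rm GL}$, which is unique up to a phase, and $\Delta_0(p)>0$ for $|p|=\sqrt\mu$. Moreover, writing $\Delta_0(\sqrt\mu)$ for the value of $\Delta_0$ at any point $p$ with $|p|=\sqrt\mu$, $$|\psi_{\rm GL}|=C_{\rm univ}\,\frac{T_c}{\Delta_0(\sqrt\mu)}\,\bigl(1+o_{\lambda\to0}(1)\bigr)\qquad\text{as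 }\lambda\to 0^+,$$ where the error is uniform in the choice of that point. (No quantity here depends on the temperature $T$ of the system, so the error is in particular uniform in the parameter $h=\sqrt{1-T/T_c}$, $0\le T<T_c$.) -/

import Mathlib

open MeasureTheory
open scoped FourierTransform ENNReal

noncomputable section

namespace BCS

/-- Position (or momentum) space `ℝ^d`, with the Euclidean norm. -/
abbrev Space (d : ℕ) : Type := EuclideanSpace ℝ (Fin d)

/-- The Hilbert space `L²(ℝ^d; ℂ)`. -/
abbrev L2 (d : ℕ) : Type := Lp (α := Space d) ℂ 2

/-- The real number `(2π)^{-d/2}`. -/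
def fourierConst (d : ℕ) : ℝ := (2 * Real.pi) ^ (-(d : ℝ) / 2)

/-- Fourier transform of the potential:
`V̂(p) = (2π)^{-d/2} ∫ V(x) e^{-i p·x} dx`. -/
def hatV {d : ℕ} (V : Space d → ℝ) (p : Space d) : ℂ :=
  (fourierConst d : ℂ) * ∫ x, (V x : ℂ) * Complex.exp (-(Complex.I * (inner ℝ p x : ℝ)))

/-- The unitary Fourier transform on `L²` in the same convention (kernel `(2π)^{-d/2} e^{-i p·x}`).
Mathlib's `𝓕` on `L²` has kernel `e^{-2π i p·x}`, hence the rescaling of the argument. The value is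
a representative of the `L²` class of `â`. -/
def hat {d : ℕ} (a : L2 d) (p : Space d) : ℂ :=
  (fourierConst d : ℂ) * (𝓕 a : L2 d) ((2 * Real.pi)⁻¹ • p)

/-- Membership in the Sobolev space `H¹(ℝ^d)`: `∫ (1 + p²) |â(p)|² dp < ∞`. -/
def IsH1 {d : ℕ} (a : L2 d) : Prop :=
  Integrable (fun p : Space d => (1 + ‖p‖ ^ 2) * ‖hat a p‖ ^ 2)

/-- Integrability of the interaction: `V ∈ L¹(ℝ^d)` and `V ∈ L^{p_V}(ℝ^d)`, where `p_V = 1` for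
`d = 1`, `p_V` is some number in `(1, ∞)` for `d = 2`, and `p_V = 3/2` for `d = 3`. -/
structure IsAdmissible {d : ℕ} (V : Space d → ℝ) : Prop where
  integrable : Integrable V
  memLp_two : d = 2 → ∃ p : ℝ≥0∞, 1 < p ∧ p < ∞ ∧ MemLp V p
  memLp_three : d = 3 → MemLp V (3 / 2)

/-- `V` is radial and of negative type: `V̂ ≤ 0` and `V̂(0) < 0` (for real radial `V` the function
`V̂` is real valued). -/
structure IsNegativeType {d : ℕ} (V : Space d → ℝ) : Prop where
  radial : ∀ x y : Space d, ‖x‖ = ‖y‖ → V x = V y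
  hat_nonpos : ∀ p : Space d, (hatV V p).re ≤ 0
  hat_zero_neg : (hatV V 0).re < 0

/-- The symbol `K_T(p) = (p² - μ) / tanh((p² - μ) / (2T))` for `T > 0`, extended continuously by
`2T` to the sphere `p² = μ`. -/
def kin {d : ℕ} (μ T : ℝ) (p : Space d) : ℝ :=
  if ‖p‖ ^ 2 = μ then 2 * T else (‖p‖ ^ 2 - μ) / Real.tanh ((‖p‖ ^ 2 - μ) / (2 * T))

/-- The sesquilinear form `⟨φ, (K_T + lam V) a⟩` of the operator `K_T + lam V`, on `H¹(ℝ^d)`. -/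
def form {d : ℕ} (μ T lam : ℝ) (V : Space d → ℝ) (φ a : L2 d) : ℂ :=
  (∫ p : Space d, (kin μ T p : ℂ) * (starRingEnd ℂ (hat φ p) * hat a p)) +
    (lam : ℂ) * ∫ x : Space d, (V x : ℂ) * (starRingEnd ℂ (φ x) * a x)

/-- `K_T + lam V ≥ 0` in the sense of quadratic forms on `H¹(ℝ^d)`. -/
def IsNonneg {d : ℕ} (μ T lam : ℝ) (V : Space d → ℝ) : Prop :=
  ∀ a : L2 d, IsH1 a → 0 ≤ (form μ T lam V a a).re

/-- The critical temperature `T_c = inf {T > 0 : K_T + lam V ≥ 0}` for the interaction `lam V`. -/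
def critTemp {d : ℕ} (μ lam : ℝ) (V : Space d → ℝ) : ℝ :=
  sInf {T : ℝ | 0 < T ∧ IsNonneg μ T lam V}

/-- `a` is the `L²`-normalised ground state of `K_{T_c} + lam V` (an element of the kernel of this
nonnegative form operator), with the phase chosen such that `â > 0`. -/
structure IsGroundState {d : ℕ} (μ lam : ℝ) (V : Space d → ℝ) (a : L2 d) : Prop where
  isH1 : IsH1 a
  norm_eq_one : ‖a‖ = 1
  ker : ∀ φ : L2 d, IsH1 φ → form μ (critTemp μ lam V) lam V φ a = 0
  hat_pos : ∀ᵐ p : Space d, 0 < (hat a p).re ∧ (hat a p).im = 0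

/-- `g₀(z) = tanh(z/2) / z`. -/
def g0 (z : ℝ) : ℝ := Real.tanh (z / 2) / z

/-- `g₁(z) = -g₀'(z) = z⁻¹ g₀(z) - (1/2) z⁻¹ / cosh²(z/2)`, for `z ≠ 0`. -/
def g1 (z : ℝ) : ℝ := z⁻¹ * g0 z - 1 / 2 * z⁻¹ * (1 / Real.cosh (z / 2) ^ 2)

/-- The coefficient of `|ψ|⁴` in the Ginzburg--Landau functional (`T` is the critical
temperature). -/
def quarticCoeff {d : ℕ} (μ T : ℝ) (a : L2 d) : ℝ :=
  1 / T ^ 3 * ∫ p : Space d,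
    g1 ((‖p‖ ^ 2 - μ) / T) / ((‖p‖ ^ 2 - μ) / T) * |kin μ T p| ^ 4 * ‖hat a p‖ ^ 4

/-- Minus the coefficient of `|ψ|²` in the Ginzburg--Landau functional (`T` is the critical
temperature). -/
def quadraticCoeff {d : ℕ} (μ T : ℝ) (a : L2 d) : ℝ :=
  1 / (2 * T) * ∫ p : Space d,
    1 / Real.cosh ((‖p‖ ^ 2 - μ) / (2 * T)) ^ 2 * |kin μ T p| ^ 2 * ‖hat a p‖ ^ 2

/-- The Ginzburg--Landau functional `E_GL : ℂ → ℝ` for the interaction `lam V`, built from the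
ground state `a` of `K_{T_c} + lam V`. -/
def glFunctional {d : ℕ} (μ lam : ℝ) (V : Space d → ℝ) (a : L2 d) (ψ : ℂ) : ℝ :=
  ‖ψ‖ ^ 4 * quarticCoeff μ (critTemp μ lam V) a
    - ‖ψ‖ ^ 2 * quadraticCoeff μ (critTemp μ lam V) a

/-- `ψ` minimises the Ginzburg--Landau functional over `ℂ`. -/
def IsGLMinimizer {d : ℕ} (μ lam : ℝ) (V : Space d → ℝ) (a : L2 d) (ψ : ℂ) : Prop :=
  ∀ χ : ℂ, glFunctional μ lam V a ψ ≤ glFunctional μ lam V a χ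

/-- `Δ₀ = -2 (2π)^{-d/2} lam V̂ ⋆ â`, the convolution being `(V̂ ⋆ â)(p) = ∫ V̂(p - q) â(q) dq`. -/
def delta0 {d : ℕ} (lam : ℝ) (V : Space d → ℝ) (a : L2 d) (p : Space d) : ℂ :=
  -2 * (fourierConst d : ℂ) * (lam : ℂ) * ∫ q : Space d, hatV V (p - q) * hat a q

/-- `C_univ = √(8π² / (7 ζ(3)))`. -/
def Cuniv : ℝ := Real.sqrt (8 * Real.pi ^ 2 / (7 * (riemannZeta 3).re))

end BCS

end

open MeasureTheory
open scoped FourierTransform ENNReal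

noncomputable section

namespace BCS

/-! ### Plancherel and Fourier inversion with kernel (2π)^{-d/2} e^{-ip·x} -/

section

variable {d : ℕ}

/-! The functional is A|ψ|⁴ - B|ψ|² with A > 0 and B ≥ 0, so its minimizers form the circle |ψ|² =
B/(2A) (`isGLMinimizer_iff`). In momentum space the ground state equation reads K_{T_c} â = F, where
F = λ W ⋆ â and W = -(2π)^{-d/2} V̂ ≥ 0; since W(0) > 0 and â > 0, the function Δ₀ = 2F is strictly
positive. Hence A and B depend on the ground state only through F, and |ψ| = (T_c/2)(I₂/I₄)^{1/2},
where z = (p² - μ)/T_c, I₂ = ∫ cosh⁻²(z/2) F² dp and I₄ = ∫ (g₁(z)/z) F⁴ dp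
(`IsGroundState.norm_minimizer_div`). What remains is F(√μ)(I₂/I₄)^{1/2} → C_univ
(`exists_weight_ratio_near`).

As T_c → 0 both weights, divided by T_c, concentrate on the Fermi sphere p² = μ with the same
density of states (`tendsto_integral_radial`). If F/F(√μ) is bounded and tends to 1 near the sphere,
it drops out, and the ratio tends to the quotient of ∫ cosh⁻²(z/2) dz = 4 and ∫ g₁(z)/z dz =
7ζ(3)/(2π²), which is C_univ². The second integral comes from the Matsubara expansion of tanh(z/2)/z
(`g0_eq_tsum`, `g1_div_eq`, `integral_quarticWeight`).

The facts needed about F are T_c = O(λ), F ≤ K F(√μ), and a modulus of continuity inherited from W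
(`exists_weak_coupling_bounds`, `exists_gap_near_const`); no asymptotic formula for T_c enters.
Write f = F/K_T. Positive solutions of the gap equation are unique up to a factor
(`IsGap.eq_mul_of_isGap`), hence radial, so the mass of f is the same in all balls of equal radius
centred on the Fermi sphere; because W is bounded below near 0, the gap equation at one point of the
sphere bounds the mass near the whole sphere by a constant times F(√μ)/λ (`exists_near_bound`). Away
from the sphere K_T ≥ c(1 + p²), and for small λ the interaction energy of the far part is absorbed
by its kinetic energy (`exists_far_bound`).

Two properties of V support this. The dual Sobolev bound ∫ |û|²/(1 + p²) ≤ C for all |u| ≤ |V|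
(`IsAdmissible.exists_sobolev_dual_bound`) makes sense of the potential energy and of V̂ ⋆ â. The
bound of the interaction by the H¹ norm is read off from nonnegativity of K_T + λV at one single
pair (T, λ) (`IsNonneg.formBounded`); such a pair exists as soon as some ground state exists, and
otherwise the asymptotic claim is vacuous. -/

lemma two_pi_inv_ne_zero : ((2 * Real.pi)⁻¹ : ℝ) ≠ 0 := by positivity

lemma fourierConst_pos (d : ℕ) : 0 < fourierConst d := by
  unfold fourierConst; positivity

lemma fourierConst_sq (d : ℕ) : fourierConst d ^ 2 = ((2 * Real.pi) ^ d)⁻¹ := by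
  unfold fourierConst
  rw [← Real.rpow_natCast, ← Real.rpow_mul (by positivity), ← Real.rpow_natCast,
    ← Real.rpow_neg (by positivity)]
  congr 1
  push_cast
  ring

lemma measurable_hat (a : L2 d) : Measurable (hat a) := by
  unfold hat
  exact ((Lp.stronglyMeasurable _).measurable.comp (measurable_const_smul _)).const_mul _

/-- The factor (2π)^{-d} of the squared constant cancels the Jacobian of the rescaling by 2π; the
rest is Plancherel for `𝓕`. -/
lemma integral_norm_hat_sq (a : L2 d) : ∫ p, ‖hat a p‖ ^ 2 = ‖a‖ ^ 2 := by
  have h1 : ∀ p, ‖hat a p‖ ^ 2 = fourierConst d ^ 2 *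
      (fun q => ‖(𝓕 a : L2 d) q‖ ^ 2) ((2 * Real.pi)⁻¹ • p) := by
    intro p
    simp only [hat, norm_mul, Complex.norm_real, mul_pow, Real.norm_eq_abs, sq_abs]
  simp_rw [h1]
  rw [integral_const_mul, Measure.integral_comp_inv_smul_of_nonneg volume
    (fun q => ‖(𝓕 a : L2 d) q‖ ^ 2) (by positivity), fourierConst_sq, finrank_euclideanSpace_fin,
    smul_eq_mul, inv_mul_cancel_left₀ (by positivity),
    ← Lp.norm_fourier_eq a, ← sq_eq_sq₀ (by positivity) (by positivity)]
  congr 1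
  have h := L2.inner_def (𝕜 := ℂ) (𝓕 a : L2 d) (𝓕 a : L2 d)
  rw [inner_self_eq_norm_sq_to_K] at h
  simp_rw [inner_self_eq_norm_sq_to_K] at h
  have h2 : ∫ x, ((‖(𝓕 a : L2 d) x‖ : ℂ)) ^ 2 = ((∫ x, ‖(𝓕 a : L2 d) x‖ ^ 2 : ℝ) : ℂ) := by
    have := integral_ofReal (𝕜 := ℂ) (μ := volume) (f := fun x => ‖(𝓕 a : L2 d) x‖ ^ 2)
    refine Eq.trans ?_ this
    simp
  have h3 : ((‖(𝓕 a : L2 d)‖ ^ 2 : ℝ) : ℂ) = ((∫ x, ‖(𝓕 a : L2 d) x‖ ^ 2 : ℝ) : ℂ) := by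
    rw [← h2]; push_cast; exact h
  exact_mod_cast h3.symm

lemma integrable_norm_hat_sq (a : L2 d) : Integrable (fun p => ‖hat a p‖ ^ 2) := by
  have h1 : (fun p => ‖hat a p‖ ^ 2) = fun p => fourierConst d ^ 2 *
      (fun q => ‖(𝓕 a : L2 d) q‖ ^ 2) ((2 * Real.pi)⁻¹ • p) := by
    ext p
    simp only [hat, norm_mul, Complex.norm_real, mul_pow, Real.norm_eq_abs, sq_abs]
  rw [h1]
  refine Integrable.const_mul ?_ _
  rw [integrable_comp_smul_iff _ (fun q => ‖(𝓕 a : L2 d) q‖ ^ 2) two_pi_inv_ne_zero]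
  have := (memLp_two_iff_integrable_sq_norm (Lp.aestronglyMeasurable _)).1 (Lp.memLp (𝓕 a : L2 d))
  exact this

lemma memLp_hat (a : L2 d) : MemLp (hat a) 2 :=
  (memLp_two_iff_integrable_sq_norm (measurable_hat a).aestronglyMeasurable).2
    (integrable_norm_hat_sq a)

lemma ae_comp_inv_smul {P : Space d → Prop} (h : ∀ᵐ p, P p) :
    ∀ᵐ p, P ((2 * Real.pi)⁻¹ • p) :=
  (Measure.quasiMeasurePreserving_smul volume two_pi_inv_ne_zero).ae h

lemma hat_sub (a b : L2 d) : hat (a - b) =ᵐ[volume] fun p => hat a p - hat b p := by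
  have h1 : (𝓕 (a - b) : L2 d) = 𝓕 a - 𝓕 b := (Lp.fourierTransformₗᵢ _ ℂ).map_sub a b
  have h := ae_comp_inv_smul (Lp.coeFn_sub (𝓕 a : L2 d) (𝓕 b))
  filter_upwards [h] with p hp
  simp only [hat, h1]
  rw [hp, Pi.sub_apply, mul_sub]

lemma exists_hat_eq {g : Space d → ℂ} (hg : MemLp g 2) :
    ∃ b : L2 d, hat b =ᵐ[volume] g := by
  have hm : MemLp (fun q : Space d => ((fourierConst d : ℂ))⁻¹ * g ((2 * Real.pi) • q)) 2 := by
    refine MemLp.const_mul ?_ _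
    have h2 : (2 * Real.pi : ℝ) ≠ 0 := by positivity
    have hq := Measure.quasiMeasurePreserving_smul (volume : Measure (Space d)) h2
    refine (memLp_two_iff_integrable_sq_norm (hg.1.comp_quasiMeasurePreserving hq)).2 ?_
    change Integrable (fun q => ‖g ((2 * Real.pi) • q)‖ ^ 2)
    rw [integrable_comp_smul_iff _ (fun q => ‖g q‖ ^ 2) h2]
    exact (memLp_two_iff_integrable_sq_norm hg.1).1 hg
  refine ⟨𝓕⁻ (hm.toLp _), ?_⟩
  have h := ae_comp_inv_smul hm.coeFn_toLp
  filter_upwards [h] with p hp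
  have hc : (fourierConst d : ℂ) ≠ 0 := by exact_mod_cast (fourierConst_pos d).ne'
  rw [hat, FourierTransform.fourier_fourierInv_eq, hp, smul_smul,
    mul_inv_cancel₀ (by positivity), one_smul, mul_inv_cancel_left₀ hc]

/-- The inverse Fourier integral in the convention of `hat`. -/
def invHat (g : Space d → ℂ) (x : Space d) : ℂ :=
  (fourierConst d : ℂ) * ∫ p, g p * Complex.exp (Complex.I * (inner ℝ p x : ℝ))

/-- The L² transform is defined by extension, not by an integral. Both sides are therefore tested
against smooth compactly supported functions: on the left the transform is moved to the test
function through tempered distributions, on the right by Fubini. -/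
lemma eq_fourierInv_of_integrable (a : L2 d) (h : Integrable (𝓕 a : L2 d)) :
    a =ᵐ[volume] fun x => 𝓕⁻ ((𝓕 a : L2 d) : Space d → ℂ) x := by
  have hcont : Continuous (𝓕⁻ ((𝓕 a : L2 d) : Space d → ℂ)) := by
    have : (𝓕⁻ ((𝓕 a : L2 d) : Space d → ℂ)) = fun x => 𝓕 ((𝓕 a : L2 d) : Space d → ℂ) (-x) := by
      ext x; rw [Real.fourierInv_eq_fourier_neg]
    rw [this]
    exact (VectorFourier.fourierIntegral_continuous Real.continuous_fourierChar
      (by exact continuous_inner) h).comp continuous_neg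
  refine ae_eq_of_integral_contDiff_smul_eq
    ((Lp.memLp a).locallyIntegrable (by norm_num)) hcont.locallyIntegrable ?_
  intro g hg hgs
  have hgs' : HasCompactSupport (fun x => (g x : ℂ)) := hgs.comp_left (g := fun x : ℝ => (x : ℂ)) rfl
  have hg' : ContDiff ℝ (⊤ : ℕ∞) (fun x => (g x : ℂ)) := Complex.ofRealCLM.contDiff.comp hg
  let G : SchwartzMap (Space d) ℂ := hgs'.toSchwartzMap hg'
  have hG : ∀ x, G x = (g x : ℂ) := fun x => rfl
  have h1 : ∀ u : Space d → ℂ, ∫ x, g x • u x = ∫ x, G x • u x := fun u => by simp [hG]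
  have h2 : ∫ x, G x • a x = ∫ p, 𝓕⁻ G p • (𝓕 a : L2 d) p := by
    have ha : (𝓕⁻ (𝓕 a : L2 d) : L2 d) = a := FourierTransform.fourierInv_fourier_eq a
    rw [← Lp.toTemperedDistribution_apply]
    conv_lhs => rw [← ha]
    rw [← Lp.fourierInv_toTemperedDistribution_eq, TemperedDistribution.fourierInv_apply,
      Lp.toTemperedDistribution_apply]
  rw [h1, h1, h2]
  have := VectorFourier.integral_fourierIntegral_smul_eq_flip (L := -innerₗ (Space d))
     (μ := volume) (ν := volume) (f := G) (g := (𝓕 a : L2 d))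
     Real.continuous_fourierChar (by exact (continuous_inner (𝕜 := ℝ) (E := Space d)).neg)
     G.integrable h
  convert! this using 1
  · congr 1; ext x
    congr 1
    rw [SchwartzMap.fourierInv_coe]
    simp [VectorFourier.fourierIntegral, Real.fourierInv_eq]
  · congr 1; ext x
    congr 1
    simp [VectorFourier.fourierIntegral, Real.fourierInv_eq, real_inner_comm]

lemma ae_eq_invHat_of_integrable (a : L2 d) (h : Integrable (hat a)) :
    a =ᵐ[volume] invHat (hat a) := by
  have hc : (fourierConst d : ℂ) ≠ 0 := by exact_mod_cast (fourierConst_pos d).ne'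
  have h1 : Integrable (𝓕 a : L2 d) := by
    unfold hat at h
    have h2 := (h.const_mul (fourierConst d : ℂ)⁻¹)
    simp only [inv_mul_cancel_left₀ hc] at h2
    exact (integrable_comp_smul_iff _ (fun q => (𝓕 a : L2 d) q) two_pi_inv_ne_zero).1 h2
  filter_upwards [eq_fourierInv_of_integrable a h1] with x hx
  rw [hx, invHat, Real.fourierInv_eq']
  simp_rw [hat, mul_assoc]
  rw [integral_const_mul]
  have h3 := Measure.integral_comp_inv_smul_of_nonneg (volume : Measure (Space d))
    (fun q : Space d => (𝓕 a : L2 d) q * Complex.exp (Complex.I * ((2 * Real.pi) * (inner ℝ q x : ℝ))))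
    (R := 2 * Real.pi) (by positivity)
  have h4 : ∀ p : Space d, (2 * Real.pi : ℂ) * ((inner ℝ ((2 * Real.pi)⁻¹ • p) x : ℝ) : ℂ)
      = ((inner ℝ p x : ℝ) : ℂ) := by
    intro p
    rw [real_inner_smul_left]; push_cast
    field_simp
  simp only [h4] at h3
  rw [h3, finrank_euclideanSpace_fin, ← mul_assoc, ← sq, Complex.real_smul, ← mul_assoc,
    ← Complex.ofReal_pow, fourierConst_sq, ← Complex.ofReal_mul,
    inv_mul_cancel₀ (by positivity)]
  simp only [Complex.ofReal_one, one_mul, smul_eq_mul]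
  congr 1; ext q
  rw [mul_comm]
  congr 2
  push_cast; ring

end

/-! ### The dual Sobolev bound for functions dominated by V, by the heat kernel -/

section

variable {d : ℕ}

/-- The Fourier integral `∫ u(x) e^{-i p·x} dx`, without normalisation. -/
def ft (u : Space d → ℂ) (p : Space d) : ℂ :=
  ∫ x, u x * Complex.exp (-(Complex.I * (inner ℝ p x : ℝ)))

lemma norm_phase (r : ℝ) : ‖Complex.exp (-(Complex.I * (r : ℂ)))‖ = 1 := by
  rw [← mul_neg, mul_comm, ← Complex.ofReal_neg, Complex.norm_exp_ofReal_mul_I]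

lemma continuous_phase : Continuous
    (fun z : Space d × Space d => Complex.exp (-(Complex.I * (inner ℝ z.1 z.2 : ℝ)))) := by
  fun_prop

lemma integrable_mul_phase {u : Space d → ℂ} (hu : Integrable u) (p : Space d) :
    Integrable (fun x => u x * Complex.exp (-(Complex.I * (inner ℝ p x : ℝ)))) := by
  refine hu.mul_bdd (c := 1) ?_ ?_
  · exact (continuous_phase.comp (by fun_prop : Continuous fun x : Space d => (p, x))).aestronglyMeasurable
  · exact Filter.Eventually.of_forall fun x => (norm_phase _).le

lemma norm_ft_le (u : Space d → ℂ) (p : Space d) : ‖ft u p‖ ≤ ∫ x, ‖u x‖ := by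
  refine (norm_integral_le_integral_norm _).trans (le_of_eq ?_)
  simp_rw [norm_mul, norm_phase, mul_one]

lemma continuous_ft {u : Space d → ℂ} (hu : Integrable u) : Continuous (ft u) := by
  refine continuous_of_dominated (bound := fun x => ‖u x‖)
    (fun p => (integrable_mul_phase hu p).1) ?_ hu.norm ?_
  · exact fun p => Filter.Eventually.of_forall fun x => by rw [norm_mul, norm_phase, mul_one]
  · refine Filter.Eventually.of_forall fun x => continuous_const.mul ?_
    exact continuous_phase.comp (by fun_prop : Continuous fun p : Space d => (p, x))

/-- The Fourier transform of `e^{-t p²}`. -/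
def heat (t : ℝ) (x : Space d) : ℝ :=
  (Real.pi / t) ^ ((d : ℝ) / 2) * Real.exp (-‖x‖ ^ 2 / (4 * t))

lemma heat_nonneg {t : ℝ} (ht : 0 < t) (x : Space d) : 0 ≤ heat t x := by
  unfold heat; positivity

lemma continuous_heat (t : ℝ) : Continuous (heat t : Space d → ℝ) := by
  unfold heat; fun_prop

lemma heat_le {t : ℝ} (ht : 0 < t) (x : Space d) : heat t x ≤ (Real.pi / t) ^ ((d : ℝ) / 2) := by
  refine mul_le_of_le_one_right (by positivity) (Real.exp_le_one_iff.2 ?_)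
  have : 0 ≤ ‖x‖ ^ 2 / (4 * t) := by positivity
  rw [neg_div]; linarith

lemma integrable_gauss {b : ℝ} (hb : 0 < b) :
    Integrable (fun v : Space d => Real.exp (-b * ‖v‖ ^ 2)) := by
  have h := (GaussianFourier.integrable_cexp_neg_mul_sq_norm_add (V := Space d)
    (b := (b : ℂ)) (by simpa using hb) 0 0).norm
  refine h.congr (Filter.Eventually.of_forall fun v => ?_)
  simp only [Complex.norm_exp]
  congr 1
  simp [← Complex.ofReal_pow]

lemma lintegral_heat {t : ℝ} (ht : 0 < t) :
    ∫⁻ x : Space d, ENNReal.ofReal (heat t x) = ENNReal.ofReal ((2 * Real.pi) ^ d) := by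
  have hb : 0 < (4 * t)⁻¹ := by positivity
  have h1 : (heat t : Space d → ℝ) = fun x => (Real.pi / t) ^ ((d : ℝ) / 2) *
      Real.exp (-(4 * t)⁻¹ * ‖x‖ ^ 2) := by
    ext x; unfold heat; congr 2; field_simp
  have hi : Integrable (heat t : Space d → ℝ) := by
    rw [h1]; exact (integrable_gauss hb).const_mul _
  rw [← ofReal_integral_eq_lintegral_ofReal hi (Filter.Eventually.of_forall (heat_nonneg ht)), h1,
    integral_const_mul, GaussianFourier.integral_rexp_neg_mul_sq_norm hb,
    finrank_euclideanSpace_fin, ← Real.mul_rpow (by positivity) (by positivity)]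
  congr 1
  have : Real.pi / t * (Real.pi / (4 * t)⁻¹) = (2 * Real.pi) ^ (2 : ℝ) := by
    rw [Real.rpow_two]; field_simp; ring
  rw [this, ← Real.rpow_mul (by positivity), mul_div_cancel₀ _ (by norm_num), Real.rpow_natCast]

/-- Expanding |û(p)|² as a double integral over x and y and integrating the Gaussian in p first
produces the heat kernel at x - y. The Gaussian makes Fubini legitimate for merely integrable u. -/
lemma lintegral_norm_ft_sq_gauss_le {u : Space d → ℂ} (hu : Integrable u) {t : ℝ} (ht : 0 < t) :
    ∫⁻ p, ‖ft u p‖ₑ ^ 2 * ENNReal.ofReal (Real.exp (-t * ‖p‖ ^ 2)) ≤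
      ∫⁻ x, ∫⁻ y, ‖u x‖ₑ * ‖u y‖ₑ * ENNReal.ofReal (heat t (x - y)) := by
  set Φ : Space d × Space d → ℂ := fun z => u z.1 * starRingEnd ℂ (u z.2) with hΦ
  have hconj : Integrable (fun y => starRingEnd ℂ (u y)) :=
    (LinearIsometryEquiv.integrable_comp_iff (Complex.conjLIE)).2 hu
  have hΦi : Integrable Φ (volume.prod volume) := hu.mul_prod hconj
  have hsq : ∀ p, ((‖ft u p‖ ^ 2 : ℝ) : ℂ) = ∫ z, Φ z *
      Complex.exp (-(Complex.I * (inner ℝ p (z.1 - z.2) : ℝ))) ∂(volume.prod volume) := by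
    intro p
    have hc : starRingEnd ℂ (ft u p) =
        ∫ y, starRingEnd ℂ (u y * Complex.exp (-(Complex.I * (inner ℝ p y : ℝ)))) :=
      integral_conj.symm
    rw [Complex.ofReal_pow, ← Complex.mul_conj', hc, ft, ← integral_prod_mul]
    congr 1; ext z
    simp only [hΦ, map_mul, ← Complex.exp_conj, inner_sub_right]
    have : Complex.exp (-(Complex.I * ((inner ℝ p z.1 - inner ℝ p z.2 : ℝ) : ℂ))) =
      Complex.exp (-(Complex.I * (inner ℝ p z.1 : ℝ))) *
        Complex.exp ((starRingEnd ℂ) (-(Complex.I * (inner ℝ p z.2 : ℝ)))) := by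
      rw [← Complex.exp_add]; congr 1; push_cast; simp; ring
    rw [this]; ring
  have hg : Integrable (fun p : Space d => Real.exp (-t * ‖p‖ ^ 2)) := integrable_gauss ht
  have hfi : Integrable (fun p => ‖ft u p‖ ^ 2 * Real.exp (-t * ‖p‖ ^ 2)) := by
    refine hg.bdd_mul (c := (∫ x, ‖u x‖) ^ 2) ((continuous_ft hu).norm.pow 2).aestronglyMeasurable
      (Filter.Eventually.of_forall fun p => ?_)
    rw [norm_pow, norm_norm]
    exact pow_le_pow_left₀ (norm_nonneg _) (norm_ft_le u p) 2
  have hkey : ((∫ p, ‖ft u p‖ ^ 2 * Real.exp (-t * ‖p‖ ^ 2) : ℝ) : ℂ) =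
      ∫ z, Φ z * (heat t (z.1 - z.2) : ℝ) ∂(volume.prod volume) := by
    have hbig : Integrable (Function.uncurry fun (p : Space d) (z : Space d × Space d) =>
        ((Real.exp (-t * ‖p‖ ^ 2) : ℝ) : ℂ) * (Φ z *
          Complex.exp (-(Complex.I * (inner ℝ p (z.1 - z.2) : ℝ)))))
        (volume.prod (volume.prod volume)) := by
      have h1 := (hg.ofReal (𝕜 := ℂ)).mul_prod hΦi
      have h2 := h1.mul_bdd (c := 1) (g := fun w : Space d × (Space d × Space d) =>
        Complex.exp (-(Complex.I * (inner ℝ w.1 (w.2.1 - w.2.2) : ℝ))))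
        (continuous_phase.comp (by fun_prop : Continuous fun w : Space d × (Space d × Space d) =>
          (w.1, w.2.1 - w.2.2))).aestronglyMeasurable
        (Filter.Eventually.of_forall fun w => (norm_phase _).le)
      refine h2.congr (Filter.Eventually.of_forall fun w => ?_)
      simp only [Function.uncurry]
      rw [mul_assoc]; rfl
    calc ((∫ p, ‖ft u p‖ ^ 2 * Real.exp (-t * ‖p‖ ^ 2) : ℝ) : ℂ)
        = ∫ p, ((‖ft u p‖ ^ 2 * Real.exp (-t * ‖p‖ ^ 2) : ℝ) : ℂ) := integral_ofReal.symm
      _ = ∫ p, ∫ z, ((Real.exp (-t * ‖p‖ ^ 2) : ℝ) : ℂ) * (Φ z *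
          Complex.exp (-(Complex.I * (inner ℝ p (z.1 - z.2) : ℝ)))) ∂(volume.prod volume) := by
          congr 1; ext p
          rw [integral_const_mul, ← hsq]; push_cast; ring
      _ = ∫ z : Space d × Space d, (∫ p : Space d, ((Real.exp (-t * ‖p‖ ^ 2) : ℝ) : ℂ) * (Φ z *
          Complex.exp (-(Complex.I * (inner ℝ p (z.1 - z.2) : ℝ))))) ∂(volume.prod volume) :=
          integral_integral_swap hbig
      _ = _ := by
          congr 1; ext z
          have h3 := GaussianFourier.integral_cexp_neg_mul_sq_norm_add (V := Space d) (b := (t : ℂ))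
            (by simpa using ht) (-Complex.I) (z.1 - z.2)
          have h4 : ∀ p : Space d, ((Real.exp (-t * ‖p‖ ^ 2) : ℝ) : ℂ) * (Φ z *
              Complex.exp (-(Complex.I * (inner ℝ p (z.1 - z.2) : ℝ)))) =
              Φ z * Complex.exp (-(t : ℂ) * ‖p‖ ^ 2 + -Complex.I * (inner ℝ (z.1 - z.2) p : ℝ)) := by
            intro p
            rw [Complex.exp_add, Complex.ofReal_exp, real_inner_comm]
            push_cast
            ring_nf
          simp_rw [h4]
          rw [integral_const_mul, h3, finrank_euclideanSpace_fin]
          congr 1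
          unfold heat
          push_cast
          rw [Complex.ofReal_cpow (by positivity)]
          push_cast
          congr 2
          rw [neg_sq, Complex.I_sq]; ring
  calc ∫⁻ p, ‖ft u p‖ₑ ^ 2 * ENNReal.ofReal (Real.exp (-t * ‖p‖ ^ 2))
      = ENNReal.ofReal (∫ p, ‖ft u p‖ ^ 2 * Real.exp (-t * ‖p‖ ^ 2)) := by
        rw [ofReal_integral_eq_lintegral_ofReal hfi
          (Filter.Eventually.of_forall fun p => by positivity)]
        congr 1; ext p
        rw [ENNReal.ofReal_mul (by positivity), ENNReal.ofReal_pow (norm_nonneg _), ofReal_norm]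
    _ = ‖∫ z, Φ z * (heat t (z.1 - z.2) : ℝ) ∂(volume.prod volume)‖ₑ := by
        rw [← hkey, ← ofReal_norm, Complex.norm_real, Real.norm_of_nonneg]
        exact integral_nonneg fun p => by positivity
    _ ≤ ∫⁻ z, ‖Φ z * (heat t (z.1 - z.2) : ℝ)‖ₑ ∂(volume.prod volume) :=
        enorm_integral_le_lintegral_enorm _
    _ = ∫⁻ x, ∫⁻ y, ‖Φ (x, y) * (heat t (x - y) : ℝ)‖ₑ := by
        refine lintegral_prod _ ?_
        refine (hΦi.1.mul ?_).enorm
        exact (Complex.continuous_ofReal.comp ((continuous_heat t).comp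
          (by fun_prop))).aestronglyMeasurable
    _ = _ := by
        congr 1; ext x; congr 1; ext y
        have e1 : ‖starRingEnd ℂ (u y)‖ₑ = ‖u y‖ₑ := by
          rw [← ofReal_norm, RCLike.norm_conj, ofReal_norm]
        have e2 : ‖((heat t (x - y) : ℝ) : ℂ)‖ₑ = ENNReal.ofReal (heat t (x - y)) := by
          rw [← ofReal_norm, Complex.norm_real, Real.norm_of_nonneg (heat_nonneg ht _)]
        rw [hΦ, enorm_mul, enorm_mul, e1, e2]

end

section

variable {d : ℕ}

/-- Truncation at height m: if one of a, b is at most m it is replaced by m; if both exceed m then a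
≤ m^{1-p} a^p and likewise for b, and the kernel is replaced by its supremum. -/
lemma mul_mul_heat_le {p m a b k K : ℝ} (hp : 1 ≤ p) (hm : 0 < m) (ha : 0 ≤ a) (hb : 0 ≤ b)
    (hk : 0 ≤ k) (hkK : k ≤ K) :
    a * b * k ≤ K * m ^ (2 - 2 * p) * (a ^ p * b ^ p) + m * (a * k) + m * (b * k) := by
  have hK : 0 ≤ K := hk.trans hkK
  have h0 : 0 ≤ K * m ^ (2 - 2 * p) * (a ^ p * b ^ p) := by positivity
  have aux : ∀ x : ℝ, m < x → x ≤ m ^ (1 - p) * x ^ p := by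
    intro x hx
    have hx0 : 0 < x := hm.trans hx
    have h1 : m ^ (p - 1) ≤ x ^ (p - 1) := Real.rpow_le_rpow hm.le hx.le (by linarith)
    have h2 : x ^ p = x ^ (p - 1) * x := by
      rw [← Real.rpow_add_one hx0.ne']; ring_nf
    have h3 : m ^ (1 - p) * m ^ (p - 1) = 1 := by
      rw [← Real.rpow_add hm]; simp
    calc x = m ^ (1 - p) * m ^ (p - 1) * x := by rw [h3, one_mul]
      _ ≤ m ^ (1 - p) * x ^ (p - 1) * x := by gcongr
      _ = _ := by rw [h2]; ring
  rcases le_or_gt a m with h | h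
  · have : a * b * k ≤ m * (b * k) := by rw [mul_assoc]; gcongr
    have : 0 ≤ m * (a * k) := by positivity
    linarith
  rcases le_or_gt b m with h' | h'
  · have : a * b * k ≤ m * (a * k) := by
      rw [mul_comm a b, mul_assoc]; gcongr
    have : 0 ≤ m * (b * k) := by positivity
    linarith
  · have h1 := aux a h
    have h2 := aux b h'
    have h3 : m ^ (2 - 2 * p) = m ^ (1 - p) * m ^ (1 - p) := by
      rw [← Real.rpow_add hm]; ring_nf
    have : a * b * k ≤ K * m ^ (2 - 2 * p) * (a ^ p * b ^ p) := by
      calc a * b * k ≤ (m ^ (1 - p) * a ^ p) * (m ^ (1 - p) * b ^ p) * K := by gcongr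
        _ = _ := by rw [h3]; ring
    have : 0 ≤ m * (a * k) := by positivity
    have : 0 ≤ m * (b * k) := by positivity
    linarith

lemma lintegral_lintegral_heat_le {V : Space d → ℝ} (hV : Integrable V) {p : ℝ} (hp : 1 ≤ p)
    (hVp : Integrable fun x => |V x| ^ p) {t m : ℝ} (ht : 0 < t) (hm : 0 < m) :
    ∫⁻ x, ∫⁻ y, ‖V x‖ₑ * ‖V y‖ₑ * ENNReal.ofReal (heat t (x - y)) ≤
      ENNReal.ofReal ((Real.pi / t) ^ ((d : ℝ) / 2) * m ^ (2 - 2 * p) * (∫ x, |V x| ^ p) ^ 2 +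
        2 * m * (2 * Real.pi) ^ d * ∫ x, |V x|) := by
  set K := (Real.pi / t) ^ ((d : ℝ) / 2) * m ^ (2 - 2 * p) with hK
  have hK0 : 0 ≤ K := by positivity
  have hheat : Measurable (heat t : Space d → ℝ) := (continuous_heat t).measurable
  have hVm : AEMeasurable (fun x => ENNReal.ofReal |V x|) := hV.1.aemeasurable.abs.ennreal_ofReal
  have hVpm : AEMeasurable (fun x => ENNReal.ofReal (|V x| ^ p)) := hVp.1.aemeasurable.ennreal_ofReal
  have hpt : ∀ x y, ‖V x‖ₑ * ‖V y‖ₑ * ENNReal.ofReal (heat t (x - y)) ≤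
      ENNReal.ofReal K * (ENNReal.ofReal (|V x| ^ p) * ENNReal.ofReal (|V y| ^ p)) +
      ENNReal.ofReal m * (ENNReal.ofReal |V x| * ENNReal.ofReal (heat t (x - y))) +
      ENNReal.ofReal m * (ENNReal.ofReal |V y| * ENNReal.ofReal (heat t (x - y))) := by
    intro x y
    have h0 := heat_nonneg ht (x - y)
    have := mul_mul_heat_le hp hm (abs_nonneg (V x)) (abs_nonneg (V y)) h0 (heat_le ht (x - y))
    rw [← ofReal_norm, ← ofReal_norm, Real.norm_eq_abs, Real.norm_eq_abs,
      ← ENNReal.ofReal_mul (by positivity), ← ENNReal.ofReal_mul (by positivity),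
      ← ENNReal.ofReal_mul (by positivity), ← ENNReal.ofReal_mul (by positivity),
      ← ENNReal.ofReal_mul (by positivity), ← ENNReal.ofReal_mul (by positivity),
      ← ENNReal.ofReal_mul (by positivity), ← ENNReal.ofReal_mul (by positivity),
      ← ENNReal.ofReal_add (by positivity) (by positivity),
      ← ENNReal.ofReal_add (by positivity) (by positivity)]
    exact ENNReal.ofReal_le_ofReal this
  have hN : ∫⁻ x, ENNReal.ofReal |V x| = ENNReal.ofReal (∫ x, |V x|) :=
    (ofReal_integral_eq_lintegral_ofReal hV.abs (Filter.Eventually.of_forall fun _ => abs_nonneg _)).symm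
  have hP : ∫⁻ x, ENNReal.ofReal (|V x| ^ p) = ENNReal.ofReal (∫ x, |V x| ^ p) :=
    (ofReal_integral_eq_lintegral_ofReal hVp
      (Filter.Eventually.of_forall fun _ => by positivity)).symm
  have hadd : ∀ (f g h : Space d → ℝ≥0∞) (a b c : ℝ), AEMeasurable f → AEMeasurable g →
      AEMeasurable h → ∫⁻ x, (ENNReal.ofReal a * f x + ENNReal.ofReal b * g x +
        ENNReal.ofReal c * h x) = ENNReal.ofReal a * (∫⁻ x, f x) + ENNReal.ofReal b * (∫⁻ x, g x) +
        ENNReal.ofReal c * (∫⁻ x, h x) := by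
    intro f g h a b c hf hg hh
    have h1 : AEMeasurable fun x => ENNReal.ofReal a * f x := hf.const_mul _
    have h2 : AEMeasurable fun x => ENNReal.ofReal a * f x + ENNReal.ofReal b * g x :=
      h1.add (hg.const_mul _)
    rw [lintegral_add_left' h2, lintegral_add_left' h1, lintegral_const_mul'' _ hf,
      lintegral_const_mul'' _ hg, lintegral_const_mul'' _ hh]
  have hin : ∀ x, ∫⁻ y, ‖V x‖ₑ * ‖V y‖ₑ * ENNReal.ofReal (heat t (x - y)) ≤
      ENNReal.ofReal K * (ENNReal.ofReal (|V x| ^ p) * ENNReal.ofReal (∫ x, |V x| ^ p)) +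
      ENNReal.ofReal m * (ENNReal.ofReal |V x| * ENNReal.ofReal ((2 * Real.pi) ^ d)) +
      ENNReal.ofReal m * ∫⁻ y, (ENNReal.ofReal |V y| * ENNReal.ofReal (heat t (x - y))) := by
    intro x
    have hsub : Measurable fun y => ENNReal.ofReal (heat t (x - y)) :=
      (hheat.comp (measurable_const.sub measurable_id)).ennreal_ofReal
    refine (lintegral_mono (hpt x)).trans (le_of_eq ?_)
    have hVs : AEMeasurable fun y => ENNReal.ofReal |V y| * ENNReal.ofReal (heat t (x - y)) :=
      hVm.mul hsub.aemeasurable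
    rw [hadd _ _ _ _ _ _ (hVpm.const_mul _) (hsub.const_mul _).aemeasurable hVs,
      lintegral_const_mul'' _ hVpm, lintegral_const_mul _ hsub, hP,
      lintegral_sub_left_eq_self (fun z => ENNReal.ofReal (heat t z)) x, lintegral_heat ht]
  refine (lintegral_mono hin).trans (le_of_eq ?_)
  have hprod : AEMeasurable (fun z : Space d × Space d =>
      ENNReal.ofReal |V z.2| * ENNReal.ofReal (heat t (z.1 - z.2))) (volume.prod volume) := by
    have h1 : AEMeasurable (fun z : Space d × Space d => ENNReal.ofReal |V z.2|)
        (volume.prod volume) :=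
      hVm.comp_quasiMeasurePreserving Measure.quasiMeasurePreserving_snd
    have h2 : Measurable (fun z : Space d × Space d => ENNReal.ofReal (heat t (z.1 - z.2))) :=
      (hheat.comp (measurable_fst.sub measurable_snd)).ennreal_ofReal
    exact h1.mul h2.aemeasurable
  have hswap : ∫⁻ x, ∫⁻ y, (ENNReal.ofReal |V y| * ENNReal.ofReal (heat t (x - y))) =
      ENNReal.ofReal (∫ x, |V x|) * ENNReal.ofReal ((2 * Real.pi) ^ d) := by
    rw [lintegral_lintegral_swap]
    · have : ∀ y, ∫⁻ x, ENNReal.ofReal |V y| * ENNReal.ofReal (heat t (x - y)) =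
          ENNReal.ofReal |V y| * ENNReal.ofReal ((2 * Real.pi) ^ d) := by
        intro y
        have hsub : Measurable fun x => ENNReal.ofReal (heat t (x - y)) :=
          (hheat.comp (measurable_id.sub measurable_const)).ennreal_ofReal
        rw [lintegral_const_mul _ hsub,
          lintegral_sub_right_eq_self (fun z => ENNReal.ofReal (heat t z)) y, lintegral_heat ht]
      simp_rw [this]
      rw [lintegral_mul_const'' _ hVm, hN]
    · exact hprod
  have hinner : AEMeasurable fun x =>
      ∫⁻ y, (ENNReal.ofReal |V y| * ENNReal.ofReal (heat t (x - y))) := by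
    exact hprod.lintegral_prod_right'
  rw [hadd _ _ _ _ _ _ (hVpm.mul_const _) (hVm.mul_const _) hinner, lintegral_mul_const'' _ hVpm,
    hP, lintegral_mul_const'' _ hVm, hN, hswap,
    ← ENNReal.ofReal_mul (by positivity), ← ENNReal.ofReal_mul (by positivity),
    ← ENNReal.ofReal_mul (by positivity), ← ENNReal.ofReal_mul (by positivity),
    ← ENNReal.ofReal_add (by positivity) (by positivity),
    ← ENNReal.ofReal_add (by positivity) (by positivity)]
  congr 1; ring

/-- The exponents for which the bound above is integrable in `t`. -/
lemma IsAdmissible.exists_exponents {V : Space d → ℝ} (hV : IsAdmissible V)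
    (hd : d = 1 ∨ d = 2 ∨ d = 3) :
    ∃ p α : ℝ, 1 ≤ p ∧ (Integrable fun x => |V x| ^ p) ∧ α < 1 ∧
      (d : ℝ) / 2 - α * (2 * p - 2) < 1 := by
  rcases hd with rfl | rfl | rfl
  -- With truncation height t^{-α}, the two contributions near t = 0 are t^{-β}, β = d/2 - α(2p -
  -- 2), and t^{-α}. In d = 1 no truncation is needed, since t^{-1/2} is already integrable.
  · refine ⟨1, 0, le_rfl, ?_, by norm_num, by norm_num⟩
    simpa using hV.integrable.abs
  · obtain ⟨p, hp1, hp2, hp⟩ := hV.memLp_two rfl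
    have h1 : 1 < p.toReal := by
      rw [← ENNReal.toReal_one]; exact (ENNReal.toReal_lt_toReal (by simp) hp2.ne).2 hp1
    refine ⟨p.toReal, 1 / 2, h1.le, ?_, by norm_num, by push_cast; linarith⟩
    simpa using hp.integrable_norm_rpow (by positivity) hp2.ne
  · have hp := hV.memLp_three rfl
    -- For p = 3/2 this choice balances the two singularities: both are t^{-3/4}.
    refine ⟨3 / 2, 3 / 4, by norm_num, ?_, by norm_num, by norm_num⟩
    have := hp.integrable_norm_rpow (by simp) (ENNReal.div_ne_top (by simp) (by simp))
    simpa using this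

lemma lintegral_exp_neg_mul_Ioi {s : ℝ} (hs : 0 < s) :
    ∫⁻ t in Set.Ioi (0 : ℝ), ENNReal.ofReal (Real.exp (-t) * Real.exp (-t * (s - 1))) =
      ENNReal.ofReal s⁻¹ := by
  have h1 : ∀ t : ℝ, Real.exp (-t) * Real.exp (-t * (s - 1)) = Real.exp (-s * t) := by
    intro t; rw [← Real.exp_add]; ring_nf
  simp_rw [h1]
  have hi : IntegrableOn (fun t => Real.exp (-s * t)) (Set.Ioi 0) :=
    integrableOn_exp_mul_Ioi (by linarith) 0
  rw [← ofReal_integral_eq_lintegral_ofReal hi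
    (Filter.Eventually.of_forall fun _ => (Real.exp_pos _).le),
    integral_exp_mul_Ioi (by linarith)]
  congr 1
  simp [neg_div_neg_eq]

/-- Writing 1/(1 + p²) = ∫₀^∞ e^{-t(1+p²)} dt turns the claim into an integral over t of heat kernel
energies, which the truncation estimate bounds by a Gamma-type integrand. Uniformity over |u| ≤ |V|
is essential: it is later used for V times a plane wave and for |V| times a phase. -/
lemma IsAdmissible.exists_sobolev_dual_bound {V : Space d → ℝ} (hV : IsAdmissible V)
    (hd : d = 1 ∨ d = 2 ∨ d = 3) :
    ∃ C : ℝ, 0 ≤ C ∧ ∀ u : Space d → ℂ, Integrable u → (∀ x, ‖u x‖ ≤ |V x|) →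
      ∫⁻ p, ‖ft u p‖ₑ ^ 2 * ENNReal.ofReal ((1 + ‖p‖ ^ 2)⁻¹) ≤ ENNReal.ofReal C := by
  obtain ⟨p, α, hp, hVp, hα, hβ⟩ := hV.exists_exponents hd
  set P := ∫ x, |V x| ^ p
  set N := ∫ x, |V x|
  have hN0 : 0 ≤ N := integral_nonneg fun _ => abs_nonneg _
  set A := Real.pi ^ ((d : ℝ) / 2) * P ^ 2
  set B := 2 * (2 * Real.pi) ^ d * N
  set β := (d : ℝ) / 2 - α * (2 * p - 2) with hβdef
  set G : ℝ → ℝ := fun t => A * (Real.exp (-t) * t ^ ((1 - β) - 1)) +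
    B * (Real.exp (-t) * t ^ ((1 - α) - 1)) with hG
  have hGi : IntegrableOn G (Set.Ioi 0) :=
    ((Real.GammaIntegral_convergent (by linarith)).const_mul _).add
      ((Real.GammaIntegral_convergent (by linarith)).const_mul _)
  have hG0 : ∀ t ∈ Set.Ioi (0 : ℝ), 0 ≤ G t := by
    intro t ht
    have : (0 : ℝ) < t := ht
    positivity
  refine ⟨∫ t in Set.Ioi 0, G t, setIntegral_nonneg measurableSet_Ioi hG0, fun u hu huV => ?_⟩
  have hbound : ∀ t ∈ Set.Ioi (0 : ℝ),
      ENNReal.ofReal (Real.exp (-t)) *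
        ∫⁻ p, ‖ft u p‖ₑ ^ 2 * ENNReal.ofReal (Real.exp (-t * ‖p‖ ^ 2)) ≤ ENNReal.ofReal (G t) := by
    intro t ht
    have ht0 : (0 : ℝ) < t := ht
    have h1 : ∫⁻ x, ∫⁻ y, ‖u x‖ₑ * ‖u y‖ₑ * ENNReal.ofReal (heat t (x - y)) ≤
        ∫⁻ x, ∫⁻ y, ‖V x‖ₑ * ‖V y‖ₑ * ENNReal.ofReal (heat t (x - y)) := by
      refine lintegral_mono fun x => lintegral_mono fun y => ?_
      have : ∀ x, ‖u x‖ₑ ≤ ‖V x‖ₑ := fun x => by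
        rw [← ofReal_norm, ← ofReal_norm]; exact ENNReal.ofReal_le_ofReal (huV x)
      dsimp only
      gcongr <;> exact this _
    have h2 := lintegral_lintegral_heat_le hV.integrable hp hVp ht0 (m := t ^ (-α)) (by positivity)
    refine (mul_le_mul_right ((lintegral_norm_ft_sq_gauss_le hu ht0).trans (h1.trans h2)) _).trans
      (le_of_eq ?_)
    rw [← ENNReal.ofReal_mul (Real.exp_pos _).le]
    congr 1
    have e1 : (Real.pi / t) ^ ((d : ℝ) / 2) * (t ^ (-α)) ^ (2 - 2 * p) =
        Real.pi ^ ((d : ℝ) / 2) * t ^ ((1 - β) - 1) := by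
      rw [Real.div_rpow Real.pi_pos.le ht0.le, ← Real.rpow_mul ht0.le, div_eq_mul_inv,
        ← Real.rpow_neg ht0.le, mul_assoc, ← Real.rpow_add ht0]
      congr 2
      rw [hβdef]; ring
    have e2 : (1 - α) - 1 = -α := by ring
    simp only [hG]
    rw [e1, e2]
    simp only [A, B]
    ring
  have hm : Measurable fun p => ‖ft u p‖ₑ ^ 2 := (continuous_ft hu).measurable.enorm.pow_const 2
  have hgm : Measurable fun z : Space d × ℝ => ENNReal.ofReal (Real.exp (-z.2 * ‖z.1‖ ^ 2)) :=
    (by fun_prop : Measurable fun z : Space d × ℝ => Real.exp (-z.2 * ‖z.1‖ ^ 2)).ennreal_ofReal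
  have hem : Measurable fun t : ℝ => ENNReal.ofReal (Real.exp (-t)) :=
    (by fun_prop : Measurable fun t : ℝ => Real.exp (-t)).ennreal_ofReal
  calc ∫⁻ p, ‖ft u p‖ₑ ^ 2 * ENNReal.ofReal ((1 + ‖p‖ ^ 2)⁻¹)
      = ∫⁻ p, ∫⁻ t in Set.Ioi (0 : ℝ), ENNReal.ofReal (Real.exp (-t)) *
          (‖ft u p‖ₑ ^ 2 * ENNReal.ofReal (Real.exp (-t * ‖p‖ ^ 2))) := by
        congr 1; ext p
        rw [← lintegral_exp_neg_mul_Ioi (by positivity : (0 : ℝ) < 1 + ‖p‖ ^ 2),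
          ← lintegral_const_mul _ (by fun_prop)]
        congr 1; ext t
        rw [ENNReal.ofReal_mul (Real.exp_pos _).le, add_sub_cancel_left]
        ring
    _ = ∫⁻ t in Set.Ioi (0 : ℝ), ∫⁻ p, ENNReal.ofReal (Real.exp (-t)) *
          (‖ft u p‖ₑ ^ 2 * ENNReal.ofReal (Real.exp (-t * ‖p‖ ^ 2))) := by
        refine lintegral_lintegral_swap (Measurable.aemeasurable ?_)
        exact (hem.comp measurable_snd).mul ((hm.comp measurable_fst).mul hgm)
    _ ≤ ∫⁻ t in Set.Ioi (0 : ℝ), ENNReal.ofReal (G t) := by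
        refine setLIntegral_mono' measurableSet_Ioi fun t ht => ?_
        have hgt : Measurable fun p : Space d =>
            ‖ft u p‖ₑ ^ 2 * ENNReal.ofReal (Real.exp (-t * ‖p‖ ^ 2)) :=
          hm.mul (hgm.comp (by fun_prop : Measurable fun p : Space d => (p, t)))
        rw [lintegral_const_mul _ hgt]
        exact hbound t ht
    _ = ENNReal.ofReal (∫ t in Set.Ioi 0, G t) := by
        rw [ofReal_integral_eq_lintegral_ofReal hGi]
        exact (ae_restrict_iff' measurableSet_Ioi).2 (Filter.Eventually.of_forall hG0)

end

/-! ### The H¹ norm, duality pairing and momentum cutoffs -/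

section

variable {d : ℕ}

/-- The squared `H¹` norm `∫ (1 + p²) |b̂(p)|² dp`, as an extended nonnegative number. -/
def h1Norm (b : L2 d) : ℝ≥0∞ := ∫⁻ p, ‖hat b p‖ₑ ^ 2 * ENNReal.ofReal (1 + ‖p‖ ^ 2)

/-- Cauchy–Schwarz after inserting (1 + p²)^{1/2}(1 + p²)^{-1/2}. -/
lemma lintegral_weighted_mul_sq_le {G H : Space d → ℝ≥0∞} (hG : AEMeasurable G)
    (hH : AEMeasurable H) :
    (∫⁻ p, G p * H p) ^ 2 ≤ (∫⁻ p, G p ^ 2 * ENNReal.ofReal (1 + ‖p‖ ^ 2)) *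
      ∫⁻ p, H p ^ 2 * ENNReal.ofReal ((1 + ‖p‖ ^ 2)⁻¹) := by
  set w : Space d → ℝ≥0∞ := fun p => ENNReal.ofReal (Real.sqrt (1 + ‖p‖ ^ 2)) with hw
  set w' : Space d → ℝ≥0∞ := fun p => ENNReal.ofReal (Real.sqrt (1 + ‖p‖ ^ 2))⁻¹ with hw'
  have hwm : Measurable w := by fun_prop
  have hwm' : Measurable w' := by fun_prop
  have hww : ∀ p, w p * w' p = 1 := by
    intro p
    have : 0 < Real.sqrt (1 + ‖p‖ ^ 2) := by positivity
    rw [hw, hw', ← ENNReal.ofReal_mul this.le, mul_inv_cancel₀ this.ne', ENNReal.ofReal_one]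
  have hw2 : ∀ p, w p ^ 2 = ENNReal.ofReal (1 + ‖p‖ ^ 2) := by
    intro p
    rw [hw, ← ENNReal.ofReal_pow (by positivity), Real.sq_sqrt (by positivity)]
  have hw2' : ∀ p, w' p ^ 2 = ENNReal.ofReal ((1 + ‖p‖ ^ 2)⁻¹) := by
    intro p
    rw [hw', ← ENNReal.ofReal_pow (by positivity), inv_pow, Real.sq_sqrt (by positivity)]
  have h := ENNReal.lintegral_mul_le_Lp_mul_Lq volume Real.HolderConjugate.two_two
    (hG.mul hwm.aemeasurable) (hH.mul hwm'.aemeasurable)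
  have e1 : ∫⁻ p, ((G * w) * (H * w')) p = ∫⁻ p, G p * H p := by
    congr 1; ext p
    simp only [Pi.mul_apply]
    rw [mul_mul_mul_comm, hww, mul_one]
  have e2 : ∀ p, (G * w) p ^ (2 : ℝ) = G p ^ 2 * ENNReal.ofReal (1 + ‖p‖ ^ 2) := by
    intro p; rw [ENNReal.rpow_two, Pi.mul_apply, mul_pow, hw2]
  have e3 : ∀ p, (H * w') p ^ (2 : ℝ) = H p ^ 2 * ENNReal.ofReal ((1 + ‖p‖ ^ 2)⁻¹) := by
    intro p; rw [ENNReal.rpow_two, Pi.mul_apply, mul_pow, hw2']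
  simp only [e2, e3] at h
  rw [e1] at h
  calc (∫⁻ p, G p * H p) ^ 2 ≤ _ := pow_le_pow_left' h 2
    _ = _ := by
      rw [mul_pow, ← ENNReal.rpow_two, ← ENNReal.rpow_two, ← ENNReal.rpow_mul, ← ENNReal.rpow_mul]
      norm_num

lemma norm_phase' (r : ℝ) : ‖Complex.exp (Complex.I * (r : ℂ))‖ = 1 := by
  rw [mul_comm, Complex.norm_exp_ofReal_mul_I]

lemma integral_mul_invHat {u g : Space d → ℂ} (hu : Integrable u) (hg : Integrable g) :
    Integrable (fun x => u x * invHat g x) ∧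
      ∫ x, u x * invHat g x = fourierConst d * ∫ p, g p * ft u (-p) := by
  have hbig : Integrable (Function.uncurry fun (x p : Space d) =>
      u x * (g p * Complex.exp (Complex.I * (inner ℝ p x : ℝ)))) (volume.prod volume) := by
    have h2 := (hu.mul_prod hg).mul_bdd (c := 1) (g := fun w : Space d × Space d =>
        Complex.exp (Complex.I * (inner ℝ w.2 w.1 : ℝ)))
        (by fun_prop : Continuous _).aestronglyMeasurable
        (Filter.Eventually.of_forall fun w => (norm_phase' _).le)
    refine h2.congr (Filter.Eventually.of_forall fun w => ?_)
    simp only [Function.uncurry]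
    ring
  constructor
  · have h := hbig.integral_prod_left.const_mul (fourierConst d : ℂ)
    refine h.congr (Filter.Eventually.of_forall fun x => ?_)
    simp only [Function.uncurry, invHat]
    rw [integral_const_mul]; ring
  · have h := integral_integral_swap hbig
    simp only [invHat]
    calc ∫ x, u x * (fourierConst d * ∫ p, g p * Complex.exp (Complex.I * (inner ℝ p x : ℝ)))
        = ∫ x, (fourierConst d : ℂ) *
            ∫ p, u x * (g p * Complex.exp (Complex.I * (inner ℝ p x : ℝ))) := by
          congr 1; ext x; rw [integral_const_mul]; ring
      _ = _ := by
          rw [integral_const_mul, h]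
          congr 2; ext p
          rw [ft, ← integral_const_mul]
          congr 1; ext x
          rw [inner_neg_left]
          push_cast
          rw [mul_neg, neg_neg]
          ring

/-- The bound `∫ |û(p)|² / (1 + p²) dp ≤ C` for all `|u| ≤ |V|`. -/
def SobolevDual (V : Space d → ℝ) (C : ℝ) : Prop :=
  ∀ u : Space d → ℂ, Integrable u → (∀ x, ‖u x‖ ≤ |V x|) →
    ∫⁻ p, ‖ft u p‖ₑ ^ 2 * ENNReal.ofReal ((1 + ‖p‖ ^ 2)⁻¹) ≤ ENNReal.ofReal C

lemma SobolevDual.neg {V : Space d → ℝ} {C : ℝ} (h : SobolevDual V C) {u : Space d → ℂ}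
    (hu : Integrable u) (huV : ∀ x, ‖u x‖ ≤ |V x|) :
    ∫⁻ p, ‖ft u (-p)‖ₑ ^ 2 * ENNReal.ofReal ((1 + ‖p‖ ^ 2)⁻¹) ≤ ENNReal.ofReal C := by
  refine le_trans (le_of_eq ?_) (h u hu huV)
  rw [← lintegral_neg_eq_self]
  simp

lemma SobolevDual.lintegral_hat_mul_ft_sq_le {V : Space d → ℝ} {C : ℝ} (h : SobolevDual V C)
    {u : Space d → ℂ} (hu : Integrable u) (huV : ∀ x, ‖u x‖ ≤ |V x|) (b : L2 d) :
    (∫⁻ p, ‖hat b p‖ₑ * ‖ft u (-p)‖ₑ) ^ 2 ≤ h1Norm b * ENNReal.ofReal C := by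
  refine (lintegral_weighted_mul_sq_le (measurable_hat b).enorm.aemeasurable
    ((continuous_ft hu).comp continuous_neg).measurable.enorm.aemeasurable).trans ?_
  exact mul_le_mul_right (h.neg hu huV) _

lemma h1Norm_ne_top {b : L2 d} (hb : IsH1 b) : h1Norm b ≠ ∞ := by
  have := hb.lintegral_lt_top
  refine (lt_of_le_of_lt (le_of_eq ?_) this).ne
  unfold h1Norm
  congr 1; ext p
  rw [mul_comm, ENNReal.ofReal_mul (by positivity), ENNReal.ofReal_pow (norm_nonneg _), ofReal_norm]

/-- A cutoff in momentum space. -/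
lemma exists_cutoff (b : L2 d) (n : ℕ) :
    ∃ b' : L2 d, hat b' =ᵐ[volume] (Metric.ball (0 : Space d) n).indicator (hat b) :=
  exists_hat_eq ((memLp_hat b).indicator measurableSet_ball)

/-- The function whose transform is that of `b` cut off to the ball of radius `n`. -/
def cutoff (b : L2 d) (n : ℕ) : L2 d := (exists_cutoff b n).choose

lemma hat_cutoff (b : L2 d) (n : ℕ) :
    hat (cutoff b n) =ᵐ[volume] (Metric.ball (0 : Space d) n).indicator (hat b) :=
  (exists_cutoff b n).choose_spec

lemma integrable_hat_cutoff (b : L2 d) (n : ℕ) : Integrable (hat (cutoff b n)) := by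
  refine Integrable.congr ?_ (hat_cutoff b n).symm
  rw [integrable_indicator_iff measurableSet_ball]
  have : IsFiniteMeasure (volume.restrict (Metric.ball (0 : Space d) n)) :=
    ⟨by simpa using measure_ball_lt_top⟩
  exact ((memLp_hat b).restrict _).integrable (by norm_num)

lemma hat_sub_cutoff (b : L2 d) (n : ℕ) :
    hat (b - cutoff b n) =ᵐ[volume] (Metric.ball (0 : Space d) n)ᶜ.indicator (hat b) := by
  filter_upwards [hat_sub b (cutoff b n), hat_cutoff b n] with p h1 h2
  rw [h1, h2, Set.indicator_compl, Pi.sub_apply]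

lemma h1Norm_cutoff_le (b : L2 d) (n : ℕ) : h1Norm (cutoff b n) ≤ h1Norm b := by
  refine lintegral_mono_ae ?_
  filter_upwards [hat_cutoff b n] with p hp
  rw [hp]
  gcongr
  exact enorm_indicator_le_enorm_self _ _

lemma tendsto_lintegral_compl_ball {f : Space d → ℝ≥0∞} (hf : Measurable f)
    (hfi : ∫⁻ p, f p ≠ ∞) :
    Filter.Tendsto (fun n : ℕ => ∫⁻ p, (Metric.ball (0 : Space d) n)ᶜ.indicator f p)
      Filter.atTop (nhds 0) := by
  have := tendsto_lintegral_of_dominated_convergence (μ := volume)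
    (F := fun (n : ℕ) p => (Metric.ball (0 : Space d) n)ᶜ.indicator f p) (f := fun _ => 0) f
    (fun n => hf.indicator measurableSet_ball.compl)
    (fun n => Filter.Eventually.of_forall fun p => Set.indicator_le_self _ _ p) hfi ?_
  · simpa using this
  · refine Filter.Eventually.of_forall fun p => ?_
    obtain ⟨N, hN⟩ := exists_nat_gt ‖p‖
    refine tendsto_const_nhds.congr' ?_
    filter_upwards [Filter.eventually_ge_atTop N] with n hn
    rw [Set.indicator_of_notMem]
    have : (N : ℝ) ≤ n := by exact_mod_cast hn
    simp only [Set.mem_compl_iff, Metric.mem_ball, dist_zero_right, not_not]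
    linarith

lemma tendsto_h1Norm_sub_cutoff {b : L2 d} (hb : IsH1 b) :
    Filter.Tendsto (fun n => h1Norm (b - cutoff b n)) Filter.atTop (nhds 0) := by
  have hm : Measurable fun p => ‖hat b p‖ₑ ^ 2 * ENNReal.ofReal (1 + ‖p‖ ^ 2) :=
    ((measurable_hat b).enorm.pow_const 2).mul (by fun_prop)
  refine (tendsto_lintegral_compl_ball hm (h1Norm_ne_top hb)).congr fun n => ?_
  refine lintegral_congr_ae ?_
  filter_upwards [hat_sub_cutoff b n] with p hp
  rw [hp]
  by_cases h : p ∈ (Metric.ball (0 : Space d) n)ᶜ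
  · rw [Set.indicator_of_mem h, Set.indicator_of_mem h]
  · rw [Set.indicator_of_notMem h, Set.indicator_of_notMem h]; simp

lemma norm_sq_le_h1Norm (b : L2 d) : ENNReal.ofReal (‖b‖ ^ 2) ≤ h1Norm b := by
  rw [← integral_norm_hat_sq, ofReal_integral_eq_lintegral_ofReal (integrable_norm_hat_sq b)
    (Filter.Eventually.of_forall fun _ => by positivity)]
  refine lintegral_mono fun p => ?_
  rw [ENNReal.ofReal_pow (norm_nonneg _), ofReal_norm]
  refine le_mul_of_one_le_right (zero_le) ?_
  rw [ENNReal.one_le_ofReal]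
  have : 0 ≤ ‖p‖ ^ 2 := by positivity
  linarith

lemma tendsto_cutoff {b : L2 d} (hb : IsH1 b) :
    Filter.Tendsto (fun n => cutoff b n) Filter.atTop (nhds b) := by
  rw [tendsto_iff_norm_sub_tendsto_zero]
  have h1 : Filter.Tendsto (fun n => ENNReal.ofReal (‖b - cutoff b n‖ ^ 2)) Filter.atTop (nhds 0) :=
    tendsto_of_tendsto_of_tendsto_of_le_of_le tendsto_const_nhds (tendsto_h1Norm_sub_cutoff hb)
      (fun _ => zero_le) (fun n => norm_sq_le_h1Norm _)
  have h2 := (ENNReal.tendsto_toReal ENNReal.zero_ne_top).comp h1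
  have h3 := h2.sqrt
  simp only [ENNReal.toReal_zero, Real.sqrt_zero] at h3
  refine h3.congr fun n => ?_
  simp only [Function.comp]
  rw [ENNReal.toReal_ofReal (by positivity), Real.sqrt_sq (norm_nonneg _), norm_sub_rev]

end

/-! ### Potential energy and convolution with V̂ for H¹ functions -/

section

variable {d : ℕ} {V : Space d → ℝ} {C : ℝ}

lemma enorm_fourierConst (d : ℕ) : ‖(fourierConst d : ℂ)‖ₑ = ENNReal.ofReal (fourierConst d) := by
  rw [← ofReal_norm, Complex.norm_real, Real.norm_of_nonneg (fourierConst_pos d).le]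

/-- Take u = |V| b̄/|b|, so that u b = |V||b|; Parseval and the dual bound for this u give the
estimate. Where b = 0 the convention 0/0 = 0 does no harm. -/
lemma SobolevDual.lintegral_mul_sq_le_of_integrable (h : SobolevDual V C) (hV : Integrable V)
    {b : L2 d} (hb : Integrable (hat b)) :
    (∫⁻ x, ‖V x‖ₑ * ‖b x‖ₑ) ^ 2 ≤
      ENNReal.ofReal (fourierConst d) ^ 2 * (h1Norm b * ENNReal.ofReal C) := by
  set u : Space d → ℂ := fun x => ((|V x| : ℝ) : ℂ) * (starRingEnd ℂ (b x) / ((‖b x‖ : ℝ) : ℂ))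
  have hphase : ∀ z : ℂ, ‖starRingEnd ℂ z / ((‖z‖ : ℝ) : ℂ)‖ ≤ 1 := by
    intro z
    rw [norm_div, RCLike.norm_conj, Complex.norm_real, norm_norm]
    exact div_self_le_one _
  have hbm : Measurable (b : Space d → ℂ) := (Lp.stronglyMeasurable b).measurable
  have hpm : Measurable fun x => starRingEnd ℂ (b x) / ((‖b x‖ : ℝ) : ℂ) :=
    (Complex.continuous_conj.measurable.comp hbm).div
      (Complex.continuous_ofReal.measurable.comp hbm.norm)
  have hu : Integrable u :=
    hV.abs.ofReal.mul_bdd (c := 1) hpm.aestronglyMeasurable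
      (Filter.Eventually.of_forall fun x => hphase _)
  have huV : ∀ x, ‖u x‖ ≤ |V x| := by
    intro x
    rw [norm_mul, Complex.norm_real, Real.norm_eq_abs, abs_abs]
    exact mul_le_of_le_one_right (abs_nonneg _) (hphase _)
  have hub : ∀ x, u x * b x = ((|V x| * ‖b x‖ : ℝ) : ℂ) := by
    intro x
    simp only [u]
    by_cases hx : b x = 0
    · simp [hx]
    · have : ((‖b x‖ : ℝ) : ℂ) ≠ 0 := by simpa using hx
      have h2 := Complex.conj_mul' (b x)
      push_cast
      rw [mul_assoc, div_mul_eq_mul_div, h2]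
      field_simp
  obtain ⟨h1, h2⟩ := integral_mul_invHat hu hb
  have hae := ae_eq_invHat_of_integrable b hb
  have h3 : ∫ x, u x * b x = fourierConst d * ∫ p, hat b p * ft u (-p) := by
    rw [← h2]; refine integral_congr_ae ?_
    filter_upwards [hae] with x hx
    rw [hx]
  have h4 : Integrable fun x => u x * b x := by
    refine h1.congr ?_
    filter_upwards [hae] with x hx
    rw [hx]
  simp_rw [hub] at h3 h4
  have h5 : Integrable fun x => |V x| * ‖b x‖ := by simpa using h4.re
  have h6 : ∫⁻ x, ‖V x‖ₑ * ‖b x‖ₑ = ‖(fourierConst d : ℂ) * ∫ p, hat b p * ft u (-p)‖ₑ := by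
    rw [← h3, integral_complex_ofReal, ← ofReal_norm, Complex.norm_real, Real.norm_of_nonneg
      (integral_nonneg fun x => by positivity), ofReal_integral_eq_lintegral_ofReal h5
      (Filter.Eventually.of_forall fun x => by positivity)]
    congr 1; ext x
    rw [ENNReal.ofReal_mul (abs_nonneg _), ofReal_norm, ← Real.norm_eq_abs, ofReal_norm]
  rw [h6, enorm_mul, enorm_fourierConst, mul_pow]
  refine mul_le_mul_right (le_trans ?_ (h.lintegral_hat_mul_ft_sq_le hu huV b)) _
  refine pow_le_pow_left' ((enorm_integral_le_lintegral_enorm _).trans (le_of_eq ?_)) 2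
  simp_rw [enorm_mul]

/-- The bound passes from momentum cutoffs to b by Fatou along an almost everywhere convergent
subsequence. -/
lemma SobolevDual.lintegral_mul_sq_le (h : SobolevDual V C) (hV : Integrable V)
    {b : L2 d} (hb : IsH1 b) :
    (∫⁻ x, ‖V x‖ₑ * ‖b x‖ₑ) ^ 2 ≤
      ENNReal.ofReal (fourierConst d) ^ 2 * (h1Norm b * ENNReal.ofReal C) := by
  set M := ENNReal.ofReal (fourierConst d) ^ 2 * (h1Norm b * ENNReal.ofReal C)
  have hsq : ∀ x : ℝ≥0∞, x ^ 2 ≤ M ↔ x ≤ M ^ (2 : ℝ)⁻¹ := by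
    intro x
    rw [ENNReal.le_rpow_inv_iff (by norm_num), ENNReal.rpow_two]
  obtain ⟨ns, hns, hlim⟩ := (tendstoInMeasure_of_tendsto_Lp (tendsto_cutoff hb)).exists_seq_tendsto_ae
  rw [hsq]
  have hbn : ∀ n, ∫⁻ x, ‖V x‖ₑ * ‖cutoff b (ns n) x‖ₑ ≤ M ^ (2 : ℝ)⁻¹ := by
    intro n
    rw [← hsq]
    refine (h.lintegral_mul_sq_le_of_integrable hV (integrable_hat_cutoff b _)).trans ?_
    exact mul_le_mul_right (mul_le_mul_left (h1Norm_cutoff_le b _) _) _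
  calc ∫⁻ x, ‖V x‖ₑ * ‖b x‖ₑ
      ≤ ∫⁻ x, Filter.liminf (fun n => ‖V x‖ₑ * ‖cutoff b (ns n) x‖ₑ) Filter.atTop := by
        refine lintegral_mono_ae ?_
        filter_upwards [hlim] with x hx
        have : Filter.Tendsto (fun n => ‖V x‖ₑ * ‖cutoff b (ns n) x‖ₑ) Filter.atTop
            (nhds (‖V x‖ₑ * ‖b x‖ₑ)) :=
          ENNReal.Tendsto.const_mul ((continuous_enorm.tendsto _).comp hx) (Or.inr enorm_ne_top)
        exact this.liminf_eq.ge
    _ ≤ Filter.liminf (fun n => ∫⁻ x, ‖V x‖ₑ * ‖cutoff b (ns n) x‖ₑ) Filter.atTop := by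
        refine lintegral_liminf_le' fun n => ?_
        exact hV.1.aemeasurable.enorm.mul (Lp.aestronglyMeasurable _).aemeasurable.enorm
    _ ≤ _ := Filter.liminf_le_of_le (by isBoundedDefault) fun y hy => by
        obtain ⟨n, hn⟩ := hy.exists
        exact hn.trans (hbn n)

lemma SobolevDual.integrable_mul (h : SobolevDual V C) (hV : Integrable V)
    {u : Space d → ℂ} (hu : Integrable u) (huV : ∀ x, ‖u x‖ ≤ |V x|) {b : L2 d} (hb : IsH1 b) :
    Integrable fun x => u x * b x := by
  refine ⟨hu.1.mul (Lp.aestronglyMeasurable b), ?_⟩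
  have h1 := h.lintegral_mul_sq_le hV hb
  have h2 : ∫⁻ x, ‖V x‖ₑ * ‖b x‖ₑ < ∞ := by
    refine lt_top_iff_ne_top.2 fun h3 => ?_
    rw [h3] at h1
    refine absurd (lt_of_le_of_lt (c := ∞) h1 ?_) (by simp)
    exact ENNReal.mul_lt_top (by simp)
      (ENNReal.mul_lt_top (lt_top_iff_ne_top.2 (h1Norm_ne_top hb)) (by simp))
  refine lt_of_le_of_lt (lintegral_mono fun x => ?_) h2
  rw [enorm_mul]
  gcongr
  rw [← ofReal_norm, ← ofReal_norm]
  exact ENNReal.ofReal_le_ofReal (huV x)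

lemma SobolevDual.integrable_hat_mul_ft (h : SobolevDual V C)
    {u : Space d → ℂ} (hu : Integrable u) (huV : ∀ x, ‖u x‖ ≤ |V x|) {b : L2 d} (hb : IsH1 b) :
    Integrable fun p => hat b p * ft u (-p) := by
  have h1 := h.lintegral_hat_mul_ft_sq_le hu huV b
  refine ⟨(measurable_hat b).aestronglyMeasurable.mul
    ((continuous_ft hu).comp continuous_neg).aestronglyMeasurable, lt_top_iff_ne_top.2 fun h3 => ?_⟩
  simp_rw [enorm_mul] at h3
  rw [h3] at h1
  refine absurd (lt_of_le_of_lt (c := ∞) h1 ?_) (by simp)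
  exact ENNReal.mul_lt_top (lt_top_iff_ne_top.2 (h1Norm_ne_top hb)) (by simp)

lemma isH1_of_h1Norm_ne_top {b : L2 d} (hb : h1Norm b ≠ ∞) : IsH1 b := by
  refine ⟨(Measurable.aestronglyMeasurable ?_), ?_⟩
  · exact (by fun_prop : Measurable fun p : Space d => 1 + ‖p‖ ^ 2).mul
      ((measurable_hat b).norm.pow_const 2)
  · refine lt_of_le_of_lt (le_of_eq ?_) (lt_top_iff_ne_top.2 hb)
    unfold h1Norm
    congr 1; ext p
    rw [Real.enorm_of_nonneg (by positivity), mul_comm, ENNReal.ofReal_mul (by positivity),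
      ENNReal.ofReal_pow (norm_nonneg _), ofReal_norm, mul_comm]

/-- Parseval's identity for an `H¹` function against a function dominated by `|V|`. -/
lemma SobolevDual.integral_mul_eq (h : SobolevDual V C) (hV : Integrable V)
    {u : Space d → ℂ} (hu : Integrable u) (huV : ∀ x, ‖u x‖ ≤ |V x|) {b : L2 d} (hb : IsH1 b) :
    ∫ x, u x * b x = fourierConst d * ∫ p, hat b p * ft u (-p) := by
  have hbn : ∀ n, IsH1 (cutoff b n) := fun n =>
    isH1_of_h1Norm_ne_top (ne_top_of_le_ne_top (h1Norm_ne_top hb) (h1Norm_cutoff_le b n))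
  have heq : ∀ n, ∫ x, u x * cutoff b n x =
      fourierConst d * ∫ p, hat (cutoff b n) p * ft u (-p) := by
    intro n
    rw [← (integral_mul_invHat hu (integrable_hat_cutoff b n)).2]
    refine integral_congr_ae ?_
    filter_upwards [ae_eq_invHat_of_integrable _ (integrable_hat_cutoff b n)] with x hx
    rw [hx]
  -- The weighted L¹ bound applied to the difference b - `cutoff b n`, whose H¹ norm tends to 0,
  -- gives convergence of the position space side; the momentum side converges by domination.
  have hL : Filter.Tendsto (fun n => ∫ x, u x * cutoff b n x) Filter.atTop
      (nhds (∫ x, u x * b x)) := by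
    refine tendsto_integral_of_L1 _ (h.integrable_mul hV hu huV hb).1
      (Filter.Eventually.of_forall fun n => h.integrable_mul hV hu huV (hbn n)) ?_
    have hD : ∀ n, IsH1 (b - cutoff b n) := fun n => by
      refine isH1_of_h1Norm_ne_top (ne_top_of_le_ne_top (h1Norm_ne_top hb) ?_)
      refine lintegral_mono_ae ?_
      filter_upwards [hat_sub_cutoff b n] with p hp
      rw [hp]
      gcongr
      exact enorm_indicator_le_enorm_self _ _
    have hsq : Filter.Tendsto (fun n => (∫⁻ x, ‖V x‖ₑ * ‖(b - cutoff b n : L2 d) x‖ₑ) ^ 2)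
        Filter.atTop (nhds 0) := by
      refine tendsto_of_tendsto_of_tendsto_of_le_of_le tendsto_const_nhds
        (h := fun n => ENNReal.ofReal (fourierConst d) ^ 2 *
          (h1Norm (b - cutoff b n) * ENNReal.ofReal C)) ?_
        (fun _ => zero_le) (fun n => h.lintegral_mul_sq_le hV (hD n))
      have := ENNReal.Tendsto.const_mul (a := ENNReal.ofReal (fourierConst d) ^ 2)
        (ENNReal.Tendsto.mul_const (b := ENNReal.ofReal C) (tendsto_h1Norm_sub_cutoff hb)
          (Or.inr ENNReal.ofReal_ne_top)) (Or.inr (by simp))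
      simpa using this
    have h1 : Filter.Tendsto (fun n => ∫⁻ x, ‖V x‖ₑ * ‖(b - cutoff b n : L2 d) x‖ₑ)
        Filter.atTop (nhds 0) := by
      have := (ENNReal.continuous_rpow_const (y := 1 / 2)).tendsto 0 |>.comp hsq
      rw [ENNReal.zero_rpow_of_pos (by norm_num)] at this
      refine this.congr fun n => ?_
      simp only [Function.comp]
      rw [← ENNReal.rpow_two, ← ENNReal.rpow_mul]
      norm_num
    refine tendsto_of_tendsto_of_tendsto_of_le_of_le tendsto_const_nhds h1
      (fun _ => zero_le) (fun n => lintegral_mono_ae ?_)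
    filter_upwards [Lp.coeFn_sub b (cutoff b n)] with x hx
    rw [hx, Pi.sub_apply, ← mul_sub, enorm_mul, ← enorm_neg (b x - _), neg_sub]
    gcongr
    rw [← ofReal_norm, ← ofReal_norm]
    exact ENNReal.ofReal_le_ofReal (huV x)
  have hR : Filter.Tendsto (fun n => ∫ p, hat (cutoff b n) p * ft u (-p)) Filter.atTop
      (nhds (∫ p, hat b p * ft u (-p))) := by
    have hm : AEStronglyMeasurable (fun p => ft u (-p)) :=
      ((continuous_ft hu).comp continuous_neg).aestronglyMeasurable
    refine tendsto_integral_of_dominated_convergence (fun p => ‖hat b p * ft u (-p)‖)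
      (fun n => (measurable_hat _).aestronglyMeasurable.mul hm)
      (h.integrable_hat_mul_ft hu huV hb).norm (fun n => ?_) ?_
    · filter_upwards [hat_cutoff b n] with p hp
      rw [hp, norm_mul, norm_mul]
      gcongr
      exact norm_indicator_le_norm_self _ _
    · have : ∀ᵐ p, ∀ n, hat (cutoff b n) p = (Metric.ball (0 : Space d) n).indicator (hat b) p :=
        ae_all_iff.2 fun n => hat_cutoff b n
      filter_upwards [this] with p hp
      obtain ⟨N, hN⟩ := exists_nat_gt ‖p‖
      refine tendsto_const_nhds.congr' ?_
      filter_upwards [Filter.eventually_ge_atTop N] with n hn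
      have : (N : ℝ) ≤ n := by exact_mod_cast hn
      rw [hp, Set.indicator_of_mem]
      simp only [Metric.mem_ball, dist_zero_right]
      linarith
  refine tendsto_nhds_unique hL ?_
  simp_rw [heq]
  exact hR.const_mul _

/-- The convolution `(V̂ ⋆ b̂)(p)`. -/
def convHat (V : Space d → ℝ) (b : L2 d) (p : Space d) : ℂ := ∫ q, hatV V (p - q) * hat b q

lemma hatV_eq (V : Space d → ℝ) (p : Space d) :
    hatV V p = fourierConst d * ft (fun x => (V x : ℂ)) p := rfl

lemma ft_mul_phase (u : Space d → ℂ) (p q : Space d) :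
    ft (fun x => u x * Complex.exp (-(Complex.I * (inner ℝ p x : ℝ)))) q = ft u (p + q) := by
  simp only [ft]
  congr 1; ext x
  rw [mul_assoc, ← Complex.exp_add, inner_add_left]
  congr 2
  push_cast; ring

lemma norm_mul_phase_le (V : Space d → ℝ) (p x : Space d) :
    ‖(V x : ℂ) * Complex.exp (-(Complex.I * (inner ℝ p x : ℝ)))‖ ≤ |V x| := by
  rw [norm_mul, norm_phase, mul_one, Complex.norm_real, Real.norm_eq_abs]

lemma SobolevDual.integrable_convHat (h : SobolevDual V C) (hV : Integrable V) {b : L2 d}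
    (hb : IsH1 b) (p : Space d) : Integrable fun q => hatV V (p - q) * hat b q := by
  have hu := integrable_mul_phase (u := fun x => (V x : ℂ)) hV.ofReal p
  have := (h.integrable_hat_mul_ft hu (norm_mul_phase_le V p) hb).const_mul (fourierConst d : ℂ)
  refine this.congr (Filter.Eventually.of_forall fun q => ?_)
  dsimp only
  rw [ft_mul_phase, hatV_eq, ← sub_eq_add_neg]; ring

/-- This is Parseval for the modulated potential V(x) e^{-ip·x}, which is still dominated by |V|. -/
lemma SobolevDual.ft_mul_eq (h : SobolevDual V C) (hV : Integrable V) {b : L2 d}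
    (hb : IsH1 b) (p : Space d) : ft (fun x => (V x : ℂ) * b x) p = convHat V b p := by
  have hu := integrable_mul_phase (u := fun x => (V x : ℂ)) hV.ofReal p
  have := h.integral_mul_eq hV hu (norm_mul_phase_le V p) hb
  rw [ft]
  calc ∫ x, (V x : ℂ) * b x * Complex.exp (-(Complex.I * (inner ℝ p x : ℝ)))
      = ∫ x, (V x : ℂ) * Complex.exp (-(Complex.I * (inner ℝ p x : ℝ))) * b x := by
        congr 1; ext x; ring
    _ = _ := by
      rw [this, convHat, ← integral_const_mul]
      congr 1; ext q
      rw [ft_mul_phase, hatV_eq, ← sub_eq_add_neg]; ring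

lemma SobolevDual.integrable_potential_mul (h : SobolevDual V C) (hV : Integrable V) {b : L2 d}
    (hb : IsH1 b) : Integrable fun x => (V x : ℂ) * b x :=
  h.integrable_mul hV hV.ofReal (fun x => by simp) hb

lemma SobolevDual.continuous_convHat (h : SobolevDual V C) (hV : Integrable V) {b : L2 d}
    (hb : IsH1 b) : Continuous (convHat V b) := by
  rw [← funext (h.ft_mul_eq hV hb)]
  exact continuous_ft (h.integrable_potential_mul hV hb)

lemma SobolevDual.exists_norm_convHat_le (h : SobolevDual V C) (hV : Integrable V) {b : L2 d}
    (hb : IsH1 b) : ∃ M, ∀ p, ‖convHat V b p‖ ≤ M :=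
  ⟨_, fun p => by rw [← h.ft_mul_eq hV hb]; exact norm_ft_le _ p⟩

lemma conj_invHat (g : Space d → ℂ) (x : Space d) :
    starRingEnd ℂ (invHat g x) =
      fourierConst d * ∫ p, starRingEnd ℂ (g p) * Complex.exp (-(Complex.I * (inner ℝ p x : ℝ))) := by
  rw [invHat, map_mul, Complex.conj_ofReal, ← integral_conj]
  congr 2; ext p
  rw [map_mul, ← Complex.exp_conj, map_mul, Complex.conj_I, Complex.conj_ofReal, neg_mul]

/-- The potential energy in momentum space. -/
lemma SobolevDual.integral_potential_eq (h : SobolevDual V C) (hV : Integrable V) {φ b : L2 d}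
    (hφ : Integrable (hat φ)) (hb : IsH1 b) :
    ∫ x, (V x : ℂ) * (starRingEnd ℂ (φ x) * b x) =
      fourierConst d * ∫ p, starRingEnd ℂ (hat φ p) * convHat V b p := by
  have hv := h.integrable_potential_mul hV hb
  have hc : Integrable fun p => starRingEnd ℂ (hat φ (p)) :=
    (LinearIsometryEquiv.integrable_comp_iff (Complex.conjLIE)).2 hφ
  have h1 := (integral_mul_invHat hv hc.comp_neg).2
  calc ∫ x, (V x : ℂ) * (starRingEnd ℂ (φ x) * b x)
      = ∫ x, (V x : ℂ) * b x * invHat (fun p => starRingEnd ℂ (hat φ (-p))) x := by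
        refine integral_congr_ae ?_
        filter_upwards [ae_eq_invHat_of_integrable φ hφ] with x hx
        rw [hx, conj_invHat, invHat, ← integral_neg_eq_self]
        simp only [inner_neg_left]
        push_cast
        simp only [mul_neg, neg_neg]
        ring
    _ = _ := by
        rw [h1, ← integral_neg_eq_self]
        simp only [neg_neg]
        congr 2; ext p
        rw [h.ft_mul_eq hV hb]

end

/-! ### The kinetic symbol and the attractive kernel W = -(2π)^{-d/2} V̂ -/

section

variable {d : ℕ}

lemma sinh_le_self_mul_cosh {y : ℝ} (hy : 0 ≤ y) : Real.sinh y ≤ y * Real.cosh y := by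
  have hd : ∀ x : ℝ, HasDerivAt (fun x => x * Real.cosh x - Real.sinh x) (x * Real.sinh x) x := by
    intro x
    have := ((hasDerivAt_id x).mul (Real.hasDerivAt_cosh x)).sub (Real.hasDerivAt_sinh x)
    refine this.congr_deriv ?_
    simp
  have hmono : MonotoneOn (fun x => x * Real.cosh x - Real.sinh x) (Set.Ici (0 : ℝ)) := by
    refine monotoneOn_of_deriv_nonneg (convex_Ici 0)
      (fun x _ => (hd x).continuousAt.continuousWithinAt)
      (fun x _ => (hd x).differentiableAt.differentiableWithinAt) fun x hx => ?_
    rw [interior_Ici] at hx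
    rw [(hd x).deriv]
    exact mul_nonneg (le_of_lt hx) (Real.sinh_nonneg_iff.2 (le_of_lt hx))
  have := hmono (Set.mem_Ici.2 le_rfl) (Set.mem_Ici.2 hy) hy
  simp only [Real.sinh_zero, zero_mul, sub_zero] at this
  linarith

lemma tanh_pos {y : ℝ} (hy : 0 < y) : 0 < Real.tanh y := by
  rw [Real.tanh_eq_sinh_div_cosh]
  exact div_pos (Real.sinh_pos_iff.2 hy) (Real.cosh_pos y)

lemma tanh_le_self {y : ℝ} (hy : 0 ≤ y) : Real.tanh y ≤ y := by
  rw [Real.tanh_eq_sinh_div_cosh, div_le_iff₀ (Real.cosh_pos y)]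
  exact sinh_le_self_mul_cosh hy

/-- From cosh y - sinh y = e^{-y} ≤ 1 and y ≤ sinh y one gets y cosh y ≤ y sinh y + y ≤ (1 + y) sinh
y. -/
lemma self_le_mul_tanh {y : ℝ} (hy : 0 ≤ y) : y ≤ (1 + y) * Real.tanh y := by
  rw [Real.tanh_eq_sinh_div_cosh, ← mul_div_assoc, le_div_iff₀ (Real.cosh_pos y)]
  have h1 : y ≤ Real.sinh y := Real.self_le_sinh_iff.2 hy
  have h2 : Real.cosh y - Real.sinh y ≤ 1 := by
    rw [Real.cosh_sub_sinh]; exact Real.exp_le_one_iff.2 (by linarith)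
  nlinarith

/-- Division by 0 makes the symbol vanish identically at T = 0. This is what later rules out the
value `critTemp` = 0 when a ground state exists. -/
lemma kin_zero_temp (μ : ℝ) (p : Space d) : kin μ 0 p = 0 := by
  simp [kin]

/-- The symbol is an even function of `p² - μ`. -/
lemma kin_eq_abs (μ T : ℝ) {p : Space d} (h : ‖p‖ ^ 2 ≠ μ) :
    kin μ T p = |‖p‖ ^ 2 - μ| / Real.tanh (|‖p‖ ^ 2 - μ| / (2 * T)) := by
  rw [kin, if_neg h]
  rcases abs_choice (‖p‖ ^ 2 - μ) with h1 | h1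
  · rw [h1]
  · rw [h1]; simp only [neg_div, Real.tanh_neg, div_neg, neg_neg]

lemma abs_le_kin {μ T : ℝ} (hT : 0 < T) (p : Space d) : |‖p‖ ^ 2 - μ| ≤ kin μ T p := by
  by_cases h : ‖p‖ ^ 2 = μ
  · rw [kin, if_pos h, h, sub_self, abs_zero]; positivity
  · have hx : 0 < |‖p‖ ^ 2 - μ| := abs_pos.2 (sub_ne_zero.2 h)
    rw [kin_eq_abs _ _ h, le_div_iff₀ (tanh_pos (by positivity))]
    exact mul_le_of_le_one_right hx.le (Real.tanh_lt_one _).le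

lemma two_mul_le_kin {μ T : ℝ} (hT : 0 < T) (p : Space d) : 2 * T ≤ kin μ T p := by
  by_cases h : ‖p‖ ^ 2 = μ
  · rw [kin, if_pos h]
  · have hx : 0 < |‖p‖ ^ 2 - μ| := abs_pos.2 (sub_ne_zero.2 h)
    rw [kin_eq_abs _ _ h, le_div_iff₀ (tanh_pos (by positivity))]
    have := tanh_le_self (y := |‖p‖ ^ 2 - μ| / (2 * T)) (by positivity)
    rw [le_div_iff₀ (by positivity)] at this
    linarith

lemma kin_le {μ T : ℝ} (hT : 0 < T) (p : Space d) : kin μ T p ≤ |‖p‖ ^ 2 - μ| + 2 * T := by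
  by_cases h : ‖p‖ ^ 2 = μ
  · rw [kin, if_pos h]; linarith [abs_nonneg (‖p‖ ^ 2 - μ)]
  · have hx : 0 < |‖p‖ ^ 2 - μ| := abs_pos.2 (sub_ne_zero.2 h)
    rw [kin_eq_abs _ _ h, div_le_iff₀ (tanh_pos (by positivity))]
    have := self_le_mul_tanh (y := |‖p‖ ^ 2 - μ| / (2 * T)) (by positivity)
    have h2 : |‖p‖ ^ 2 - μ| + 2 * T = 2 * T * (1 + |‖p‖ ^ 2 - μ| / (2 * T)) := by field_simp; ring
    rw [h2, mul_assoc]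
    calc |‖p‖ ^ 2 - μ| = 2 * T * (|‖p‖ ^ 2 - μ| / (2 * T)) := by field_simp
      _ ≤ _ := by gcongr

lemma kin_pos {μ T : ℝ} (hT : 0 < T) (p : Space d) : 0 < kin μ T p :=
  lt_of_lt_of_le (by positivity) (two_mul_le_kin hT p)

lemma measurable_tanh : Measurable Real.tanh := by
  have : Real.tanh = fun x => Real.sinh x / Real.cosh x := by
    ext x; exact Real.tanh_eq_sinh_div_cosh x
  rw [this]
  exact Real.measurable_sinh.div Real.measurable_cosh

lemma measurable_kin (μ T : ℝ) : Measurable (kin μ T : Space d → ℝ) := by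
  unfold kin
  refine Measurable.ite ?_ measurable_const ?_
  · exact (by fun_prop : Measurable fun p : Space d => ‖p‖ ^ 2) (measurableSet_singleton μ)
  · exact (by fun_prop : Measurable fun p : Space d => ‖p‖ ^ 2 - μ).div
      (measurable_tanh.comp (by fun_prop))

lemma kin_congr (μ T : ℝ) {p q : Space d} (h : ‖p‖ = ‖q‖) : kin μ T p = kin μ T q := by
  simp only [kin, h]

lemma exists_kin_le (μ : ℝ) {T : ℝ} (hT : 0 ≤ T) :
    ∃ C, 0 ≤ C ∧ ∀ p : Space d, kin μ T p ≤ C * (1 + ‖p‖ ^ 2) := by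
  rcases hT.eq_or_lt with rfl | hT
  · exact ⟨0, le_rfl, fun p => by simp [kin_zero_temp]⟩
  refine ⟨1 + |μ| + 2 * T, by positivity, fun p => (kin_le hT p).trans ?_⟩
  have h1 : |‖p‖ ^ 2 - μ| ≤ ‖p‖ ^ 2 + |μ| :=
    (abs_sub _ _).trans (by rw [abs_of_nonneg (sq_nonneg ‖p‖)])
  have h2 : 0 ≤ ‖p‖ ^ 2 := sq_nonneg _
  have h3 := abs_nonneg μ
  nlinarith

lemma kin_nonneg {μ T : ℝ} (hT : 0 ≤ T) (p : Space d) : 0 ≤ kin μ T p := by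
  rcases hT.eq_or_lt with rfl | hT
  · rw [kin_zero_temp]
  · exact (kin_pos hT p).le

lemma critTemp_nonneg (μ lam : ℝ) (V : Space d → ℝ) : 0 ≤ critTemp μ lam V :=
  Real.sInf_nonneg fun _ h => h.1.le

/-- Minus the (rescaled) Fourier transform of the potential, the kernel of the attraction. -/
def attr (V : Space d → ℝ) (p : Space d) : ℝ := -fourierConst d * (hatV V p).re

lemma exists_isometry {p q : Space d} (h : ‖p‖ = ‖q‖) : ∃ R : Space d ≃ₗᵢ[ℝ] Space d, R p = q :=
  ⟨_, Submodule.reflection_sub h⟩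

lemma hatV_isometry {V : Space d → ℝ} (hV : ∀ x y : Space d, ‖x‖ = ‖y‖ → V x = V y)
    (R : Space d ≃ₗᵢ[ℝ] Space d) (p : Space d) : hatV V (R p) = hatV V p := by
  unfold hatV
  congr 1
  rw [← R.measurePreserving.integral_comp R.toHomeomorph.measurableEmbedding]
  congr 1; ext x
  rw [hV (R x) x (R.norm_map x), R.inner_map_map]

lemma hatV_congr {V : Space d → ℝ} (hV : ∀ x y : Space d, ‖x‖ = ‖y‖ → V x = V y)
    {p q : Space d} (h : ‖p‖ = ‖q‖) : hatV V p = hatV V q := by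
  obtain ⟨R, rfl⟩ := exists_isometry h
  exact (hatV_isometry hV R p).symm

/-- Complex conjugation turns p into -p, and V̂ is radial. -/
lemma hatV_im {V : Space d → ℝ} (hV : ∀ x y : Space d, ‖x‖ = ‖y‖ → V x = V y) (p : Space d) :
    (hatV V p).im = 0 := by
  rw [← Complex.conj_eq_iff_im]
  refine Eq.trans ?_ (hatV_congr hV (norm_neg p))
  unfold hatV
  rw [map_mul, Complex.conj_ofReal, ← integral_conj]
  congr 2; ext x
  rw [map_mul, Complex.conj_ofReal, ← Complex.exp_conj, map_neg, map_mul, Complex.conj_I,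
    Complex.conj_ofReal, inner_neg_left]
  push_cast
  congr 2
  ring

lemma fourierConst_mul_hatV {V : Space d → ℝ} (hV : ∀ x y : Space d, ‖x‖ = ‖y‖ → V x = V y)
    (p : Space d) : (fourierConst d : ℂ) * hatV V p = -((attr V p : ℝ) : ℂ) := by
  apply Complex.ext <;> simp [attr, hatV_im hV]

/-- The properties of the interaction kernel that are used in momentum space. -/
structure IsAttractive (W : Space d → ℝ) : Prop where
  unif : UniformContinuous W
  nonneg : ∀ p, 0 ≤ W p
  zero_pos : 0 < W 0
  radial : ∀ p q, ‖p‖ = ‖q‖ → W p = W q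
  bdd : ∃ M, ∀ p, W p ≤ M
  dual : ∃ C, 0 ≤ C ∧ ∀ p, ∫⁻ q, ENNReal.ofReal (W (p - q)) ^ 2 * ENNReal.ofReal ((1 + ‖q‖ ^ 2)⁻¹) ≤
    ENNReal.ofReal C

lemma IsAttractive.cont {W : Space d → ℝ} (hW : IsAttractive W) : Continuous W :=
  hW.unif.continuous

/-- A continuous function vanishing at infinity (Riemann–Lebesgue) is uniformly continuous. The
modulus of continuity of the gap function will come from here. -/
lemma uniformContinuous_hatV {V : Space d → ℝ} (hV : Integrable V) :
    UniformContinuous (hatV V) := by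
  have hcont : Continuous (hatV V) := by
    rw [funext (hatV_eq V)]; exact continuous_const.mul (continuous_ft hV.ofReal)
  refine hcont.uniformContinuous_of_tendsto_cocompact (x := 0) ?_
  have h1 := tendsto_integral_exp_inner_smul_cocompact (V := Space d) fun x => (V x : ℂ)
  have h2 : Filter.Tendsto (fun p : Space d => (2 * Real.pi)⁻¹ • p) (Filter.cocompact _)
      (Filter.cocompact _) :=
    (Homeomorph.smulOfNeZero _ two_pi_inv_ne_zero).isClosedEmbedding.tendsto_cocompact
  have h3 := (h1.comp h2).const_mul (fourierConst d : ℂ)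
  rw [mul_zero] at h3
  refine h3.congr fun p => ?_
  simp only [Function.comp, hatV]
  congr 2; ext x
  rw [Circle.smul_def, Real.fourierChar_apply, smul_eq_mul, mul_comm, real_inner_smul_right,
    real_inner_comm]
  congr 2
  push_cast
  field_simp

lemma IsAttractive.comm {W : Space d → ℝ} (hW : IsAttractive W) (p q : Space d) :
    W (p - q) = W (q - p) := hW.radial _ _ (norm_sub_rev p q)

lemma isAttractive_attr {V : Space d → ℝ} {C : ℝ} (h : SobolevDual V C) (hC : 0 ≤ C)
    (hV : Integrable V) (hn : IsNegativeType V) : IsAttractive (attr V) := by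
  have hc := fourierConst_pos d
  refine ⟨?_, fun p => ?_, ?_, fun p q hpq => ?_, ?_, ?_⟩
  · have h1 : UniformContinuous fun p => (hatV V p).re :=
      Complex.uniformContinuous_re.comp (uniformContinuous_hatV hV)
    exact (h1.const_smul (-fourierConst d))
  · have := hn.hat_nonpos p
    unfold attr; nlinarith
  · have := hn.hat_zero_neg
    unfold attr; nlinarith
  · simp only [attr, hatV_congr hn.radial hpq]
  · refine ⟨fourierConst d * (fourierConst d * ∫ x, ‖(V x : ℂ)‖), fun p => ?_⟩
    unfold attr
    rw [neg_mul, ← mul_neg]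
    refine mul_le_mul_of_nonneg_left ?_ hc.le
    refine (neg_le_abs _).trans ((Complex.abs_re_le_norm _).trans ?_)
    rw [hatV_eq, norm_mul, Complex.norm_real, Real.norm_of_nonneg hc.le]
    exact mul_le_mul_of_nonneg_left (norm_ft_le _ p) hc.le
  -- The translate q ↦ W(p - q) is dominated by the reflected transform of V e^{-ip·x}, so the dual
  -- bound holds with one constant for all p.
  · refine ⟨(fourierConst d ^ 2) ^ 2 * C, by positivity, fun p => ?_⟩
    have hu := integrable_mul_phase (u := fun x => (V x : ℂ)) hV.ofReal p
    have h1 := h.neg hu (norm_mul_phase_le V p)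
    rw [ENNReal.ofReal_mul (by positivity)]
    refine le_trans ?_ (mul_le_mul_right h1 _)
    rw [← lintegral_const_mul _ (by
      exact (((continuous_ft hu).comp continuous_neg).measurable.enorm.pow_const 2).mul
        (by fun_prop))]
    refine lintegral_mono fun q => ?_
    rw [ft_mul_phase, ← sub_eq_add_neg, ← mul_assoc]
    gcongr
    rw [ENNReal.ofReal_pow (by positivity), ← mul_pow]
    gcongr
    rw [← ofReal_norm, ← ENNReal.ofReal_mul (by positivity)]
    refine ENNReal.ofReal_le_ofReal ?_
    unfold attr
    rw [neg_mul, ← mul_neg, sq, mul_assoc]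
    refine mul_le_mul_of_nonneg_left ?_ hc.le
    refine (neg_le_abs _).trans ((Complex.abs_re_le_norm _).trans ?_)
    rw [hatV_eq, norm_mul, Complex.norm_real, Real.norm_of_nonneg hc.le]

end

/-! ### From the ground state to the gap equation; nonnegativity in momentum space -/

section

variable {d : ℕ} {V : Space d → ℝ} {C : ℝ}

/-- The gap function `lam ∫ W(p - q) f(q) dq`, half of `Δ₀`. -/
def gap (lam : ℝ) (W f : Space d → ℝ) (p : Space d) : ℝ := lam * ∫ q, W (p - q) * f q

/-- Positive finite-energy solutions of the linear gap equation `K_T f = lam W ⋆ f`. -/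
structure IsGapSol (μ lam T : ℝ) (W f : Space d → ℝ) : Prop where
  lam_pos : 0 < lam
  temp_pos : 0 < T
  meas : Measurable f
  pos : ∀ᵐ p, 0 < f p
  energy : Integrable fun p => (1 + ‖p‖ ^ 2) * f p ^ 2
  int : ∀ p, Integrable fun q => W (p - q) * f q
  eq : ∀ᵐ p, kin μ T p * f p = gap lam W f p
  cont : Continuous (gap lam W f)
  bdd : ∃ M, ∀ p, gap lam W f p ≤ M

/-- The integrand is nonnegative, and since W(0) > 0 it is positive almost everywhere on a
neighbourhood of q = p. -/
lemma gap_pos {W f : Space d → ℝ} (hW : IsAttractive W) {lam : ℝ} (hlam : 0 < lam)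
    (hf : ∀ᵐ p, 0 < f p) (hint : ∀ p, Integrable fun q => W (p - q) * f q) (p : Space d) :
    0 < gap lam W f p := by
  refine mul_pos hlam ?_
  rw [integral_pos_iff_support_of_nonneg_ae _ (hint p)]
  · have hU : IsOpen {q : Space d | 0 < W (p - q)} :=
      isOpen_lt continuous_const (hW.cont.comp (by fun_prop))
    have hne : {q : Space d | 0 < W (p - q)}.Nonempty := ⟨p, by simpa using hW.zero_pos⟩
    refine lt_of_lt_of_le (hU.measure_pos volume hne) (measure_mono_ae ?_)
    filter_upwards [hf] with q hq hq2
    exact (mul_pos hq2 hq).ne'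
  · filter_upwards [hf] with q hq
    exact mul_nonneg (hW.nonneg _) hq.le

lemma IsGapSol.gap_pos {μ lam T : ℝ} {W f : Space d → ℝ} (hW : IsAttractive W)
    (h : IsGapSol μ lam T W f) (p : Space d) : 0 < gap lam W f p :=
  BCS.gap_pos hW h.lam_pos h.pos h.int p

section GroundState

variable {μ lam : ℝ} {a : L2 d}

lemma IsGroundState.hat_eq (ha : IsGroundState μ lam V a) :
    ∀ᵐ p, hat a p = (((hat a p).re : ℝ) : ℂ) := by
  filter_upwards [ha.hat_pos] with p hp
  apply Complex.ext <;> simp [hp.2]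

lemma IsGroundState.attr_mul_ae (hn : IsNegativeType V) (ha : IsGroundState μ lam V a)
    (p : Space d) : ∀ᵐ q, (fourierConst d : ℂ) * (hatV V (p - q) * hat a q) =
      -((attr V (p - q) * (hat a q).re : ℝ) : ℂ) := by
  filter_upwards [ha.hat_eq] with q hq
  rw [← mul_assoc, fourierConst_mul_hatV hn.radial]
  conv_lhs => rw [hq]
  push_cast; ring

lemma IsGroundState.convHat_eq (hn : IsNegativeType V) (ha : IsGroundState μ lam V a)
    (p : Space d) : (fourierConst d : ℂ) * convHat V a p =
      -((∫ q, attr V (p - q) * (hat a q).re : ℝ) : ℂ) := by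
  rw [convHat, ← integral_const_mul, integral_congr_ae (ha.attr_mul_ae hn p), integral_neg,
    integral_complex_ofReal]

lemma IsGroundState.mul_convHat_eq (hn : IsNegativeType V) (ha : IsGroundState μ lam V a)
    (p : Space d) : (fourierConst d : ℂ) * lam * convHat V a p =
      -((gap lam (attr V) (fun q => (hat a q).re) p : ℝ) : ℂ) := by
  rw [mul_right_comm, ha.convHat_eq hn, gap]
  push_cast; ring

lemma IsGroundState.delta0_eq (hn : IsNegativeType V) (ha : IsGroundState μ lam V a)
    (p : Space d) : delta0 lam V a p =
      ((2 * gap lam (attr V) (fun q => (hat a q).re) p : ℝ) : ℂ) := by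
  have h1 := ha.mul_convHat_eq hn p
  have h2 : delta0 lam V a p = -2 * (fourierConst d * lam * convHat V a p) := by
    simp only [delta0, convHat]; ring
  rw [h2, h1]; push_cast; ring

lemma IsGroundState.integrable_attr (h : SobolevDual V C) (hV : Integrable V)
    (hn : IsNegativeType V) (ha : IsGroundState μ lam V a) (p : Space d) :
    Integrable fun q => attr V (p - q) * (hat a q).re := by
  have h1 := ((h.integrable_convHat hV ha.isH1 p).const_mul (fourierConst d : ℂ)).congr
    (ha.attr_mul_ae hn p)
  have h2 := h1.neg.re
  refine h2.congr (Filter.Eventually.of_forall fun q => ?_)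
  simp

lemma locallyIntegrable_kin_mul_hat {μ T : ℝ} (hT : 0 ≤ T) (a : L2 d) :
    LocallyIntegrable fun p => (kin μ T p : ℂ) * hat a p := by
  obtain ⟨K, hK0, hK⟩ := exists_kin_le (d := d) μ hT
  have h1 : LocallyIntegrable (hat a) := (memLp_hat a).locallyIntegrable (by norm_num)
  have h2 : LocallyIntegrable fun p : Space d => (K * (1 + ‖p‖ ^ 2) : ℝ) • hat a p := by
    refine (locallyIntegrableOn_univ.1 ?_)
    exact (locallyIntegrableOn_univ.2 h1).continuousOn_smul isOpen_univ.isLocallyClosed (by fun_prop)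
  refine h2.mono ?_ (Filter.Eventually.of_forall fun p => ?_)
  · exact ((Complex.measurable_ofReal.comp (measurable_kin μ T)).mul
      (measurable_hat a)).aestronglyMeasurable
  · rw [norm_mul, norm_smul, Complex.norm_real, Real.norm_of_nonneg (kin_nonneg hT p),
      Real.norm_of_nonneg (by positivity)]
    gcongr
    exact hK p

/-- The weak equation is tested with those φ whose transform is a smooth compactly supported real
function; they are in H¹ with integrable transform, so the momentum space formula for the potential
energy applies. -/
lemma IsGroundState.eq_ae (h : SobolevDual V C) (hV : Integrable V)
    (hn : IsNegativeType V) (ha : IsGroundState μ lam V a) :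
    ∀ᵐ p, kin μ (critTemp μ lam V) p * (hat a p).re =
      gap lam (attr V) (fun q => (hat a q).re) p := by
  set T := critTemp μ lam V
  have hT : 0 ≤ T := critTemp_nonneg μ lam V
  set X : Space d → ℂ := fun p => kin μ T p * hat a p
  set Y : Space d → ℂ := fun p => -(fourierConst d * lam * convHat V a p)
  have hYc : Continuous Y :=
    (continuous_const.mul (h.continuous_convHat hV ha.isH1)).neg
  have hXY : ∀ᵐ p, X p = Y p := by
    refine ae_eq_of_integral_contDiff_smul_eq (locallyIntegrable_kin_mul_hat hT a)
      hYc.locallyIntegrable ?_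
    intro g hg hgs
    have hgc : Continuous g := hg.continuous
    have hgi : Integrable fun p => ((g p : ℝ) : ℂ) :=
      (hgc.integrable_of_hasCompactSupport hgs).ofReal
    have hgs' : HasCompactSupport fun p => ((g p : ℝ) : ℂ) :=
      hgs.comp_left (g := fun x : ℝ => (x : ℂ)) rfl
    have hgL2 : MemLp (fun p => ((g p : ℝ) : ℂ)) 2 :=
      (Complex.continuous_ofReal.comp hgc).memLp_of_hasCompactSupport hgs'
    obtain ⟨φ, hφ⟩ := exists_hat_eq hgL2
    have hφi : Integrable (hat φ) := hgi.congr hφ.symm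
    have hφ1 : IsH1 φ := by
      have : Integrable fun p : Space d => (1 + ‖p‖ ^ 2) * ‖((g p : ℝ) : ℂ)‖ ^ 2 := by
        refine Continuous.integrable_of_hasCompactSupport (by fun_prop) ?_
        refine HasCompactSupport.mul_left ?_
        exact hgs'.comp_left (g := fun z : ℂ => ‖z‖ ^ 2) (by simp)
      refine this.congr ?_
      filter_upwards [hφ] with p hp
      rw [hp]
    have hker := ha.ker φ hφ1
    have h1 : ∫ p : Space d, (kin μ T p : ℂ) * (starRingEnd ℂ (hat φ p) * hat a p) =
        ∫ p, g p • X p := by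
      refine integral_congr_ae ?_
      filter_upwards [hφ] with p hp
      rw [hp, Complex.conj_ofReal, Complex.real_smul]
      simp only [X]; ring
    have h2 : (lam : ℂ) * ∫ x : Space d, (V x : ℂ) * (starRingEnd ℂ (φ x) * a x) =
        -∫ p, g p • Y p := by
      rw [h.integral_potential_eq hV hφi ha.isH1, ← mul_assoc, ← integral_const_mul, ← integral_neg]
      refine integral_congr_ae ?_
      filter_upwards [hφ] with p hp
      rw [hp, Complex.conj_ofReal, Complex.real_smul]
      simp only [Y]; ring
    unfold form at hker
    rw [h1, h2] at hker
    exact add_neg_eq_zero.1 hker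
  filter_upwards [hXY, ha.hat_eq] with p hp h2
  simp only [X, Y] at hp
  rw [ha.mul_convHat_eq hn, neg_neg, h2] at hp
  exact_mod_cast hp

lemma IsGroundState.isGapSol (h : SobolevDual V C) (hC : 0 ≤ C) (hV : Integrable V)
    (hn : IsNegativeType V) (hlam : 0 < lam) (ha : IsGroundState μ lam V a) :
    IsGapSol μ lam (critTemp μ lam V) (attr V) fun q => (hat a q).re := by
  have hW := isAttractive_attr h hC hV hn
  have hpos : ∀ᵐ p, 0 < (hat a p).re := ha.hat_pos.mono fun _ h => h.1
  have hgeq : ∀ p, gap lam (attr V) (fun q => (hat a q).re) p =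
      -(fourierConst d * lam * convHat V a p).re := by
    intro p; rw [ha.mul_convHat_eq hn]; simp
  refine ⟨hlam, ?_, Complex.measurable_re.comp (measurable_hat a), hpos, ?_,
    ha.integrable_attr h hV hn, ha.eq_ae h hV hn, ?_, ?_⟩
  -- If the critical temperature were 0, the symbol would vanish and the gap equation would say 0 =
  -- F almost everywhere, against F > 0.
  · refine lt_of_le_of_ne (critTemp_nonneg μ lam V) fun h0 => ?_
    have h1 := ha.eq_ae h hV hn
    have : ∀ᵐ p : Space d, False := by
      filter_upwards [h1] with p hp
      rw [← h0, kin_zero_temp, zero_mul] at hp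
      exact (gap_pos hW hlam hpos (ha.integrable_attr h hV hn) p).ne hp
    exact (this.exists).elim fun _ h => h
  · refine ha.isH1.congr ?_
    filter_upwards [ha.hat_eq] with p hp
    conv_lhs => rw [hp, Complex.norm_real, Real.norm_eq_abs, sq_abs]
  · rw [funext hgeq]
    exact (Complex.continuous_re.comp (continuous_const.mul (h.continuous_convHat hV ha.isH1))).neg
  · obtain ⟨M, hM⟩ := h.exists_norm_convHat_le hV ha.isH1
    refine ⟨‖(fourierConst d * lam : ℂ)‖ * M, fun p => ?_⟩
    rw [hgeq]
    refine (neg_le_abs _).trans ((Complex.abs_re_le_norm _).trans ?_)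
    rw [norm_mul]
    gcongr
    exact hM p

end GroundState

/-- Nonnegativity of `K_T + lam V` bounds the interaction by the kinetic energy. -/
lemma IsNonneg.lintegral_attr_le (h : SobolevDual V C) (hC : 0 ≤ C) (hV : Integrable V)
    (hn : IsNegativeType V) {μ T lam : ℝ} (hT : 0 < T) (hlam : 0 < lam)
    (hnn : IsNonneg μ T lam V) {g : Space d → ℝ}
    (hgm : Measurable g) (hg0 : ∀ p, 0 ≤ g p) (hg : Integrable fun p => (1 + ‖p‖ ^ 2) * g p ^ 2) :
    ENNReal.ofReal lam * ∫⁻ p, ENNReal.ofReal (g p) *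
      ∫⁻ q, ENNReal.ofReal (attr V (p - q)) * ENNReal.ofReal (g q) ≤
      ∫⁻ p, ENNReal.ofReal (kin μ T p * g p ^ 2) := by
  have hW := isAttractive_attr h hC hV hn
  have hWm : Measurable fun p : Space d => ENNReal.ofReal (attr V p) :=
    hW.cont.measurable.ennreal_ofReal
  have hgL2 : MemLp (fun p => ((g p : ℝ) : ℂ)) 2 := by
    refine (memLp_two_iff_integrable_sq_norm
      (Complex.measurable_ofReal.comp hgm).aestronglyMeasurable).2 ?_
    refine hg.mono (((Complex.measurable_ofReal.comp hgm).norm.pow_const 2).aestronglyMeasurable)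
      (Filter.Eventually.of_forall fun p => ?_)
    rw [Function.comp_apply, Complex.norm_real, Real.norm_eq_abs (g p), sq_abs, norm_mul, Real.norm_of_nonneg (by positivity : 0 ≤ 1 + ‖p‖^2)]
    refine le_mul_of_one_le_left (norm_nonneg _) ?_
    nlinarith [sq_nonneg ‖p‖]
  obtain ⟨b, hb⟩ := exists_hat_eq hgL2
  have hb1 : IsH1 b := by
    refine hg.congr ?_
    filter_upwards [hb] with p hp
    rw [hp, Complex.norm_real, Real.norm_eq_abs, sq_abs]
  -- Cutting g to balls makes the transform integrable, so the form can be rewritten in momentum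
  -- space; both sides are then recovered by monotone convergence, as g and W are nonnegative.
  set B : ℕ → Set (Space d) := fun n => Metric.ball 0 n
  set gn : ℕ → Space d → ℝ := fun n => (B n).indicator g
  have hgn0 : ∀ n p, 0 ≤ gn n p := fun n p => Set.indicator_nonneg (fun p _ => hg0 p) p
  have hcut : ∀ n, ∀ᵐ p, hat (cutoff b n) p = ((gn n p : ℝ) : ℂ) := by
    intro n
    filter_upwards [hat_cutoff b n, hb] with p h1 h2
    rw [h1]
    by_cases hp : p ∈ Metric.ball (0 : Space d) n
    · rw [Set.indicator_of_mem hp, h2]; simp only [gn, B]; rw [Set.indicator_of_mem hp]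
    · rw [Set.indicator_of_notMem hp]; simp only [gn, B]; rw [Set.indicator_of_notMem hp]; simp
  have hbn : ∀ n, IsH1 (cutoff b n) := fun n =>
    isH1_of_h1Norm_ne_top (ne_top_of_le_ne_top (h1Norm_ne_top hb1) (h1Norm_cutoff_le b n))
  have hgnm : ∀ n, Measurable (gn n) := fun n => hgm.indicator measurableSet_ball
  have hn_le : ∀ n, ENNReal.ofReal lam * ∫⁻ p, ENNReal.ofReal (gn n p) *
      ∫⁻ q, ENNReal.ofReal (attr V (p - q)) * ENNReal.ofReal (gn n q) ≤
      ∫⁻ p, ENNReal.ofReal (kin μ T p * gn n p ^ 2) := by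
    intro n
    have hae : ∀ p, ∀ᵐ q, (fourierConst d : ℂ) * (hatV V (p - q) * hat (cutoff b n) q) =
        -((attr V (p - q) * gn n q : ℝ) : ℂ) := by
      intro p
      filter_upwards [hcut n] with q hq
      rw [hq, ← mul_assoc, fourierConst_mul_hatV hn.radial]; push_cast; ring
    have hint : ∀ p, Integrable fun q => attr V (p - q) * gn n q := by
      intro p
      have h1 := ((h.integrable_convHat hV (hbn n) p).const_mul (fourierConst d : ℂ)).congr (hae p)
      refine h1.neg.re.congr (Filter.Eventually.of_forall fun q => ?_)
      simp
    have hconv : ∀ p, (fourierConst d : ℂ) * convHat V (cutoff b n) p =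
        -((∫ q, attr V (p - q) * gn n q : ℝ) : ℂ) := by
      intro p
      rw [convHat, ← integral_const_mul, integral_congr_ae (hae p), integral_neg,
        integral_complex_ofReal]
    have hinner0 : ∀ p, 0 ≤ ∫ q, attr V (p - q) * gn n q := fun p =>
      integral_nonneg fun q => mul_nonneg (hW.nonneg _) (hgn0 n q)
    have hpos := hnn _ (hbn n)
    have h1 : ∫ p : Space d, (kin μ T p : ℂ) *
        (starRingEnd ℂ (hat (cutoff b n) p) * hat (cutoff b n) p) =
        ((∫ p, kin μ T p * gn n p ^ 2 : ℝ) : ℂ) := by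
      rw [← integral_complex_ofReal]
      refine integral_congr_ae ?_
      filter_upwards [hcut n] with p hp
      rw [hp, Complex.conj_ofReal]; push_cast; ring
    have h2 : ∫ x : Space d, (V x : ℂ) * (starRingEnd ℂ (cutoff b n x) * cutoff b n x) =
        -((∫ p, gn n p * ∫ q, attr V (p - q) * gn n q : ℝ) : ℂ) := by
      rw [h.integral_potential_eq hV (integrable_hat_cutoff b n) (hbn n), ← integral_const_mul,
        ← integral_complex_ofReal, ← integral_neg]
      refine integral_congr_ae ?_
      filter_upwards [hcut n] with p hp
      rw [hp, Complex.conj_ofReal, mul_left_comm, hconv]; push_cast; ring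
    unfold form at hpos
    rw [h1, h2] at hpos
    -- This is the nonnegativity hypothesis for the cut-off function; it is then transcribed into
    -- extended nonnegative integrals.
    have h3 : lam * ∫ p, gn n p * ∫ q, attr V (p - q) * gn n q ≤ ∫ p, kin μ T p * gn n p ^ 2 := by
      simp only [Complex.add_re, Complex.ofReal_re, Complex.mul_re, Complex.neg_re,
        Complex.ofReal_im, Complex.neg_im, neg_zero, mul_zero, sub_zero] at hpos
      linarith
    have hki : Integrable fun p => kin μ T p * gn n p ^ 2 := by
      obtain ⟨K, hK0, hK⟩ := exists_kin_le (d := d) μ hT.le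
      refine (hg.const_mul K).mono ((measurable_kin μ T).mul
        ((hgnm n).pow_const 2)).aestronglyMeasurable (Filter.Eventually.of_forall fun p => ?_)
      rw [Real.norm_of_nonneg (by have := kin_nonneg (μ := μ) hT.le p; positivity),
        Real.norm_of_nonneg (by positivity), ← mul_assoc]
      have : gn n p ≤ g p := Set.indicator_le_self' (fun p _ => hg0 p) p
      exact mul_le_mul (hK p) (pow_le_pow_left₀ (hgn0 n p) this 2) (by positivity) (by positivity)
    have hgni : Integrable (gn n) := by
      have := (integrable_hat_cutoff b n).re
      refine this.congr ?_
      filter_upwards [hcut n] with p hp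
      rw [hp]; simp
    obtain ⟨M, hM⟩ := h.exists_norm_convHat_le hV (hbn n)
    have hIp : ∀ p, ((∫ q, attr V (p - q) * gn n q : ℝ)) =
        -((fourierConst d : ℂ) * convHat V (cutoff b n) p).re := by
      intro p; rw [hconv]; simp
    have hIc : Continuous fun p => (∫ q, attr V (p - q) * gn n q : ℝ) := by
      rw [funext hIp]
      exact (Complex.continuous_re.comp
        (continuous_const.mul (h.continuous_convHat hV (hbn n)))).neg
    have hgi : Integrable fun p => gn n p * ∫ q, attr V (p - q) * gn n q := by
      refine hgni.mul_bdd (c := ‖(fourierConst d : ℂ)‖ * M) hIc.aestronglyMeasurable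
        (Filter.Eventually.of_forall fun p => ?_)
      rw [hIp, norm_neg, Real.norm_eq_abs]
      refine (Complex.abs_re_le_norm _).trans ?_
      rw [norm_mul]; gcongr; exact hM p
    have h4 : ∀ p, ∫⁻ q, ENNReal.ofReal (attr V (p - q)) * ENNReal.ofReal (gn n q) =
        ENNReal.ofReal (∫ q, attr V (p - q) * gn n q) := by
      intro p
      rw [ofReal_integral_eq_lintegral_ofReal (hint p)
        (Filter.Eventually.of_forall fun q => mul_nonneg (hW.nonneg _) (hgn0 n q))]
      congr 1; ext q
      rw [ENNReal.ofReal_mul (hW.nonneg _)]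
    simp_rw [h4, ← ENNReal.ofReal_mul (hgn0 n _)]
    rw [← ofReal_integral_eq_lintegral_ofReal hgi (Filter.Eventually.of_forall fun p =>
        mul_nonneg (hgn0 n p) (hinner0 p)),
      ← ofReal_integral_eq_lintegral_ofReal hki (Filter.Eventually.of_forall fun p => by
        have := kin_nonneg (μ := μ) hT.le p; positivity), ← ENNReal.ofReal_mul hlam.le]
    exact ENNReal.ofReal_le_ofReal h3
  have hmono : ∀ p, Monotone fun n => gn n p := by
    intro p m n hmn
    refine Set.indicator_le_indicator_of_subset (Metric.ball_subset_ball (by exact_mod_cast hmn))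
      (fun p => hg0 p) p
  have hev : ∀ p, ∀ᶠ n in Filter.atTop, gn n p = g p := by
    intro p
    obtain ⟨N, hN⟩ := exists_nat_gt ‖p‖
    filter_upwards [Filter.eventually_ge_atTop N] with n hn
    have : (N : ℝ) ≤ n := by exact_mod_cast hn
    simp only [gn, B]
    rw [Set.indicator_of_mem]
    simp only [Metric.mem_ball, dist_zero_right]
    linarith
  have hlim1 : ∀ p, Filter.Tendsto (fun n => ∫⁻ q, ENNReal.ofReal (attr V (p - q)) *
      ENNReal.ofReal (gn n q)) Filter.atTop
      (nhds (∫⁻ q, ENNReal.ofReal (attr V (p - q)) * ENNReal.ofReal (g q))) := by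
    intro p
    refine lintegral_tendsto_of_tendsto_of_monotone (fun n => ?_) ?_ ?_
    · exact ((hWm.comp (by fun_prop : Measurable fun q : Space d => p - q)).mul
        (hgnm n).ennreal_ofReal).aemeasurable
    · refine Filter.Eventually.of_forall fun q m n hmn => ?_
      exact mul_le_mul_right (ENNReal.ofReal_le_ofReal (hmono q hmn)) _
    · refine Filter.Eventually.of_forall fun q => tendsto_const_nhds.congr' ?_
      filter_upwards [hev q] with n hn
      rw [hn]
  have hlim2 : Filter.Tendsto (fun n => ∫⁻ p, ENNReal.ofReal (gn n p) *
      ∫⁻ q, ENNReal.ofReal (attr V (p - q)) * ENNReal.ofReal (gn n q)) Filter.atTop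
      (nhds (∫⁻ p, ENNReal.ofReal (g p) *
        ∫⁻ q, ENNReal.ofReal (attr V (p - q)) * ENNReal.ofReal (g q))) := by
    refine lintegral_tendsto_of_tendsto_of_monotone (fun n => ?_) ?_ ?_
    · refine Measurable.aemeasurable ((hgnm n).ennreal_ofReal.mul ?_)
      exact Measurable.lintegral_prod_right' (f := fun z : Space d × Space d =>
        ENNReal.ofReal (attr V (z.1 - z.2)) * ENNReal.ofReal (gn n z.2))
        ((hWm.comp (measurable_fst.sub measurable_snd)).mul
          ((hgnm n).comp measurable_snd).ennreal_ofReal)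
    · refine Filter.Eventually.of_forall fun p m n hmn => ?_
      refine mul_le_mul' (ENNReal.ofReal_le_ofReal (hmono p hmn)) (lintegral_mono fun q => ?_)
      exact mul_le_mul_right (ENNReal.ofReal_le_ofReal (hmono q hmn)) _
    · refine Filter.Eventually.of_forall fun p => ?_
      by_cases hp : g p = 0
      · have : ∀ n, gn n p = 0 := fun n => Set.indicator_apply_eq_zero.2 fun _ => hp
        simp [hp, this]
      · refine (ENNReal.Tendsto.const_mul (hlim1 p) (Or.inr ENNReal.ofReal_ne_top)).congr' ?_
        filter_upwards [hev p] with n hn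
        rw [hn]
  refine le_of_tendsto' (ENNReal.Tendsto.const_mul hlim2 (Or.inr ENNReal.ofReal_ne_top))
    fun n => (hn_le n).trans (lintegral_mono fun p => ENNReal.ofReal_le_ofReal ?_)
  have : gn n p ≤ g p := Set.indicator_le_self' (fun p _ => hg0 p) p
  exact mul_le_mul_of_nonneg_left (pow_le_pow_left₀ (hgn0 n p) this 2) (kin_nonneg hT.le p)

end

/-! ### Uniqueness and radial symmetry of positive gap functions -/

section

variable {d : ℕ}

/-- Positive bounded gap functions `F = lam W ⋆ (F / K_T)` of finite energy. -/
structure IsGap (μ lam T : ℝ) (W F : Space d → ℝ) : Prop where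
  lam_pos : 0 < lam
  temp_pos : 0 < T
  cont : Continuous F
  pos : ∀ p, 0 < F p
  bdd : ∃ M, ∀ p, F p ≤ M
  energy : Integrable fun p => (1 + ‖p‖ ^ 2) * (F p / kin μ T p) ^ 2
  int : ∀ p, Integrable fun q => W (p - q) * (F q / kin μ T q)
  eq : ∀ p, F p = lam * ∫ q, W (p - q) * (F q / kin μ T q)

lemma IsGapSol.ae_eq_div {μ lam T : ℝ} {W f : Space d → ℝ} (h : IsGapSol μ lam T W f) :
    ∀ᵐ p, f p = gap lam W f p / kin μ T p := by
  filter_upwards [h.eq] with p hp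
  rw [← hp, mul_div_cancel_left₀ _ (kin_pos h.temp_pos p).ne']

lemma IsGapSol.isGap {μ lam T : ℝ} {W f : Space d → ℝ} (hW : IsAttractive W)
    (h : IsGapSol μ lam T W f) : IsGap μ lam T W (gap lam W f) := by
  have hae : ∀ p, (fun q => W (p - q) * f q) =ᵐ[volume]
      fun q => W (p - q) * (gap lam W f q / kin μ T q) := fun p => by
    filter_upwards [h.ae_eq_div] with q hq
    rw [← hq]
  refine ⟨h.lam_pos, h.temp_pos, h.cont, h.gap_pos hW, h.bdd, ?_, fun p => (h.int p).congr (hae p),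
    fun p => ?_⟩
  · refine h.energy.congr ?_
    filter_upwards [h.ae_eq_div] with q hq
    rw [← hq]
  · rw [← integral_congr_ae (hae p)]; rfl

variable {μ lam T : ℝ} {W F : Space d → ℝ}

lemma IsGap.profile_pos (h : IsGap μ lam T W F) (p : Space d) : 0 < F p / kin μ T p :=
  div_pos (h.pos p) (kin_pos h.temp_pos p)

lemma IsGap.measurable_profile (h : IsGap μ lam T W F) : Measurable fun p => F p / kin μ T p :=
  h.cont.measurable.div (measurable_kin μ T)

lemma IsGap.lintegral_eq (h : IsGap μ lam T W F) (hW : IsAttractive W) (p : Space d) :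
    ∫⁻ q, ENNReal.ofReal (W (p - q)) * ENNReal.ofReal (F q / kin μ T q) =
      ENNReal.ofReal (F p / lam) := by
  have : F p / lam = ∫ q, W (p - q) * (F q / kin μ T q) := by
    rw [h.eq p, mul_div_cancel_left₀ _ h.lam_pos.ne']
  rw [this, ofReal_integral_eq_lintegral_ofReal (h.int p) (Filter.Eventually.of_forall fun q =>
    mul_nonneg (hW.nonneg _) (h.profile_pos q).le)]
  congr 1; ext q
  rw [ENNReal.ofReal_mul (hW.nonneg _)]

lemma IsGap.comp_isometry (h : IsGap μ lam T W F) (hW : IsAttractive W)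
    (R : Space d ≃ₗᵢ[ℝ] Space d) : IsGap μ lam T W (F ∘ R) := by
  have hR := R.measurePreserving
  have hRe := R.toHomeomorph.measurableEmbedding
  have hk : ∀ p, kin μ T p = kin μ T (R p) := fun p => kin_congr _ _ (R.norm_map p).symm
  have hw : ∀ p q, W (p - q) * ((F ∘ R) q / kin μ T q) =
      (fun q => W (R p - q) * (F q / kin μ T q)) (R q) := by
    intro p q
    simp only [Function.comp]
    rw [hk q, ← map_sub, hW.radial (R (p - q)) (p - q) (R.norm_map _)]
  refine ⟨h.lam_pos, h.temp_pos, h.cont.comp R.continuous, fun p => h.pos _, ?_, ?_, fun p => ?_,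
    fun p => ?_⟩
  · obtain ⟨M, hM⟩ := h.bdd
    exact ⟨M, fun p => hM _⟩
  · have := (hR.integrable_comp_emb hRe).2 h.energy
    refine this.congr (Filter.Eventually.of_forall fun p => ?_)
    simp only [Function.comp]
    rw [hk p, R.norm_map]
  · simp_rw [hw]
    exact (hR.integrable_comp_emb hRe).2 (h.int (R p))
  · simp_rw [hw]
    have := hR.integral_comp hRe fun q => W (R p - q) * (F q / kin μ T q)
    exact (h.eq (R p)).trans (congrArg (lam * ·) this.symm)

/-- Ground state representation: with f = F/K, g = G/K and r = G/F, the two gap equations and the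
symmetry of W give ∬ W(p - q) f(p) f(q) (r(p) - r(q))² = 0. Hence r(p) = r(q) whenever W(p - q) > 0,
which holds for p near q, so r is locally constant on a connected space. -/
lemma IsGap.eq_mul_of_isGap (h : IsGap μ lam T W F) (hW : IsAttractive W) {G : Space d → ℝ}
    (h' : IsGap μ lam T W G) (p q : Space d) : G p / F p = G q / F q := by
  set r : Space d → ℝ := fun p => G p / F p
  have hr : Continuous r := h'.cont.div h.cont fun p => (h.pos p).ne'
  have hr0 : ∀ p, 0 < r p := fun p => div_pos (h'.pos p) (h.pos p)
  set f : Space d → ℝ := fun p => F p / kin μ T p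
  set g : Space d → ℝ := fun p => G p / kin μ T p
  have hf0 : ∀ p, 0 < f p := h.profile_pos
  have hg0 : ∀ p, 0 < g p := h'.profile_pos
  have hgf : ∀ p, g p = r p * f p := fun p => by
    simp only [g, r, f]
    have := (h.pos p).ne'
    field_simp
  have hLf : ∀ p, ∫⁻ q, ENNReal.ofReal (W (p - q)) * ENNReal.ofReal (f q) =
    ENNReal.ofReal (F p / lam) := h.lintegral_eq hW
  have hLg : ∀ p, ∫⁻ q, ENNReal.ofReal (W (p - q)) * ENNReal.ofReal (g q) =
    ENNReal.ofReal (G p / lam) := h'.lintegral_eq hW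
  have hfm : Measurable f := h.measurable_profile
  have hgm : Measurable g := h'.measurable_profile
  have hWm : Measurable fun z : Space d × Space d => ENNReal.ofReal (W (z.1 - z.2)) :=
    (hW.cont.measurable.comp (measurable_fst.sub measurable_snd)).ennreal_ofReal
  set A : Space d × Space d → ℝ≥0∞ := fun z => ENNReal.ofReal (W (z.1 - z.2)) *
    (ENNReal.ofReal (r z.1 * g z.1) * ENNReal.ofReal (f z.2))
  set A' : Space d × Space d → ℝ≥0∞ := fun z => ENNReal.ofReal (W (z.1 - z.2)) *
    (ENNReal.ofReal (r z.2 * g z.2) * ENNReal.ofReal (f z.1))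
  set B : Space d × Space d → ℝ≥0∞ := fun z => ENNReal.ofReal (W (z.1 - z.2)) *
    (ENNReal.ofReal (g z.1) * ENNReal.ofReal (g z.2))
  set D : Space d × Space d → ℝ≥0∞ := fun z =>
    ENNReal.ofReal (W (z.1 - z.2) * (f z.1 * f z.2 * (r z.1 - r z.2) ^ 2))
  have hrm : Measurable r := hr.measurable
  have hAm : Measurable A := hWm.mul (by fun_prop)
  have hA'm : Measurable A' := hWm.mul (by fun_prop)
  have hBm : Measurable B := hWm.mul (by fun_prop)
  have hDm : Measurable D := by
    refine Measurable.ennreal_ofReal ?_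
    exact (hW.cont.measurable.comp (measurable_fst.sub measurable_snd)).mul (by fun_prop)
  -- Expansion of the square r(p)² + r(q)² = (r(p) - r(q))² + 2 r(p) r(q), multiplied by W f(p)
  -- f(q). By the gap equations A, A' and B all integrate to the same finite E, which leaves nothing
  -- for D.
  have hpt : ∀ z, A z + A' z = D z + (B z + B z) := by
    intro z
    have h1 := hW.nonneg (z.1 - z.2)
    have := (hf0 z.1).le; have := (hf0 z.2).le; have := (hg0 z.1).le; have := (hg0 z.2).le
    have := (hr0 z.1).le; have := (hr0 z.2).le
    simp only [A, A', B, D]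
    rw [← ENNReal.ofReal_mul (by positivity), ← ENNReal.ofReal_mul (by positivity),
      ← ENNReal.ofReal_mul (by positivity), ← ENNReal.ofReal_mul (by positivity),
      ← ENNReal.ofReal_mul (by positivity), ← ENNReal.ofReal_mul (by positivity),
      ← ENNReal.ofReal_add (by positivity) (by positivity),
      ← ENNReal.ofReal_add (by positivity) (by positivity),
      ← ENNReal.ofReal_add (by positivity) (by positivity)]
    congr 1
    rw [hgf, hgf]; ring
  set E : ℝ≥0∞ := ∫⁻ p, ENNReal.ofReal (g p) * ENNReal.ofReal (G p / lam)
  -- Finite energy is needed here, to cancel E from both sides below.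
  have hEfin : E ≠ ∞ := by
    obtain ⟨K, hK0, hK⟩ := exists_kin_le (d := d) μ h.temp_pos.le
    have hi := (h'.energy.const_mul (K / lam)).lintegral_lt_top
    refine (lt_of_le_of_lt (lintegral_mono fun p => ?_) hi).ne
    rw [← ENNReal.ofReal_mul (hg0 p).le]
    refine ENNReal.ofReal_le_ofReal ?_
    have e : G p = kin μ T p * g p := by
      simp only [g]; rw [mul_div_cancel₀ _ (kin_pos h.temp_pos p).ne']
    have h3 := h.lam_pos
    calc g p * (G p / lam) = kin μ T p * (g p ^ 2 / lam) := by rw [e]; ring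
      _ ≤ K * (1 + ‖p‖ ^ 2) * (g p ^ 2 / lam) := by
        gcongr
        exact hK p
      _ = _ := by simp only [g]; ring
  have hA : ∫⁻ z, A z ∂(volume.prod volume) = E := by
    rw [lintegral_prod _ hAm.aemeasurable]
    congr 1; ext p
    simp only [A]
    simp_rw [mul_left_comm (ENNReal.ofReal (W _))]
    rw [lintegral_const_mul' _ _ ENNReal.ofReal_ne_top, hLf, ← ENNReal.ofReal_mul (mul_pos (hr0 p) (hg0 p)).le,
      ← ENNReal.ofReal_mul (hg0 p).le]
    congr 1
    simp only [r]
    have := (h.pos p).ne'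
    field_simp
  have hA' : ∫⁻ z, A' z ∂(volume.prod volume) = E := by
    rw [← hA, ← lintegral_prod_swap]
    congr 1; ext z
    simp only [A, A', Prod.fst_swap, Prod.snd_swap]
    rw [hW.comm]
  have hB : ∫⁻ z, B z ∂(volume.prod volume) = E := by
    rw [lintegral_prod _ hBm.aemeasurable]
    congr 1; ext p
    simp only [B]
    simp_rw [mul_left_comm (ENNReal.ofReal (W _))]
    rw [lintegral_const_mul' _ _ ENNReal.ofReal_ne_top, hLg]
  have hD : ∫⁻ z, D z ∂(volume.prod volume) = 0 := by
    have h1 : ∫⁻ z, (A z + A' z) ∂(volume.prod volume) =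
        ∫⁻ z, (D z + (B z + B z)) ∂(volume.prod volume) := by simp_rw [hpt]
    rw [lintegral_add_left hAm, lintegral_add_left hDm, lintegral_add_left hBm, hA, hA', hB] at h1
    have h2 : E + E ≠ ∞ := ENNReal.add_ne_top.2 ⟨hEfin, hEfin⟩
    have h3 : 0 + (E + E) = (∫⁻ z, D z ∂(volume.prod volume)) + (E + E) := by rw [zero_add]; exact h1
    exact ((ENNReal.add_left_inj h2).1 h3).symm
  rw [lintegral_eq_zero_iff hDm] at hD
  have hc : Continuous fun z : Space d × Space d => W (z.1 - z.2) * (r z.1 - r z.2) ^ 2 := by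
    have := hW.cont
    fun_prop
  have hzero : (fun z : Space d × Space d => W (z.1 - z.2) * (r z.1 - r z.2) ^ 2) = fun _ => 0 := by
    refine (Continuous.ae_eq_iff_eq (volume.prod volume) hc continuous_const).1 ?_
    filter_upwards [hD] with z hz
    have h1 : W (z.1 - z.2) * (f z.1 * f z.2 * (r z.1 - r z.2) ^ 2) ≤ 0 :=
      ENNReal.ofReal_eq_zero.1 hz
    have h2 := mul_pos (hf0 z.1) (hf0 z.2)
    have h3 : 0 ≤ W (z.1 - z.2) * (r z.1 - r z.2) ^ 2 := mul_nonneg (hW.nonneg _) (sq_nonneg _)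
    have h4 : (f z.1 * f z.2) * (W (z.1 - z.2) * (r z.1 - r z.2) ^ 2) ≤ 0 := by linarith
    exact le_antisymm (nonpos_of_mul_nonpos_right h4 h2) h3
  have hloc : IsLocallyConstant r := by
    rw [IsLocallyConstant.iff_eventually_eq]
    intro x
    have hopen : IsOpen {y : Space d | 0 < W (y - x)} :=
      isOpen_lt continuous_const (hW.cont.comp (by fun_prop))
    filter_upwards [hopen.mem_nhds (by simpa using hW.zero_pos)] with y hy
    have := congrFun hzero (y, x)
    simp only [mul_eq_zero] at this
    rcases this with h1 | h1
    · exact absurd h1 (ne_of_gt hy)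
    · exact sub_eq_zero.1 (pow_eq_zero_iff (two_ne_zero) |>.1 h1)
  exact hloc.apply_eq_of_preconnectedSpace p q

/-- A rotated gap function is again one, so it is a constant multiple of F, and the constant is 1
because the origin is fixed. -/
lemma IsGap.radial (h : IsGap μ lam T W F) (hW : IsAttractive W) {p q : Space d}
    (hpq : ‖p‖ = ‖q‖) : F p = F q := by
  obtain ⟨R, rfl⟩ := exists_isometry hpq
  have := h.eq_mul_of_isGap hW (h.comp_isometry hW R) p 0
  simp only [Function.comp, map_zero] at this
  rw [div_self (h.pos 0).ne', div_eq_one_iff_eq (h.pos p).ne'] at this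
  exact this.symm

end

/-! ### Control of the profile near and away from the Fermi sphere -/

section

variable {d : ℕ}

/-- The shell `|q² - μ| < η` around the Fermi sphere. -/
def shell (d : ℕ) (μ η : ℝ) : Set (Space d) := {q | |‖q‖ ^ 2 - μ| < η}

lemma isOpen_shell (μ η : ℝ) : IsOpen (shell d μ η) :=
  isOpen_lt (by fun_prop) continuous_const

lemma measure_shell_lt_top {μ η : ℝ} : volume (shell d μ η) < ∞ := by
  refine lt_of_le_of_lt (measure_mono (t := Metric.closedBall 0 (Real.sqrt (μ + η))) fun q hq => ?_)
    (measure_closedBall_lt_top)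
  simp only [Metric.mem_closedBall, dist_zero_right]
  have : |‖q‖ ^ 2 - μ| < η := hq
  exact Real.le_sqrt_of_sq_le (by linarith [(abs_lt.1 this).2])

/-- The interaction is bounded by the `H¹` norm. -/
def FormBounded (W : Space d → ℝ) (B : ℝ) : Prop :=
  ∀ g : Space d → ℝ, Measurable g → (∀ p, 0 ≤ g p) →
    Integrable (fun p => (1 + ‖p‖ ^ 2) * g p ^ 2) →
    ∫⁻ p, ENNReal.ofReal (g p) * ∫⁻ q, ENNReal.ofReal (W (p - q)) * ENNReal.ofReal (g q) ≤
      ENNReal.ofReal B * ∫⁻ p, ENNReal.ofReal ((1 + ‖p‖ ^ 2) * g p ^ 2)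

/-- The bound depends only on V, so one coupling and one temperature with K_T + λV ≥ 0 serve for all
couplings afterwards. -/
lemma IsNonneg.formBounded {V : Space d → ℝ} {C : ℝ} (h : SobolevDual V C) (hC : 0 ≤ C)
    (hV : Integrable V) (hn : IsNegativeType V) {μ T lam : ℝ} (hT : 0 < T) (hlam : 0 < lam)
    (hnn : IsNonneg μ T lam V) : ∃ B, 0 ≤ B ∧ FormBounded (attr V) B := by
  obtain ⟨K, hK0, hK⟩ := exists_kin_le (d := d) μ hT.le
  refine ⟨lam⁻¹ * K, by positivity, fun g hgm hg0 hg => ?_⟩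
  have h1 := hnn.lintegral_attr_le h hC hV hn hT hlam hgm hg0 hg
  have h2 : ∫⁻ p, ENNReal.ofReal (kin μ T p * g p ^ 2) ≤
      ENNReal.ofReal K * ∫⁻ p, ENNReal.ofReal ((1 + ‖p‖ ^ 2) * g p ^ 2) := by
    rw [← lintegral_const_mul' _ _ ENNReal.ofReal_ne_top]
    refine lintegral_mono fun p => ?_
    rw [← ENNReal.ofReal_mul hK0, ← mul_assoc]
    exact ENNReal.ofReal_le_ofReal (mul_le_mul_of_nonneg_right (hK p) (sq_nonneg _))
  have h3 := mul_le_mul_right (h1.trans h2) (ENNReal.ofReal lam⁻¹)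
  rw [← mul_assoc, ← mul_assoc, ← ENNReal.ofReal_mul (by positivity), inv_mul_cancel₀ hlam.ne',
    ENNReal.ofReal_one, one_mul, ← ENNReal.ofReal_mul (by positivity)] at h3
  exact h3

/-- A thin shell is covered by finitely many small balls centred on the sphere. -/
lemma exists_shell_cover {μ : ℝ} (hμ : 0 < μ) {ρ : ℝ} (hρ : 0 < ρ) :
    ∃ η : ℝ, 0 < η ∧ ∃ S : Finset (Space d), (∀ x ∈ S, ‖x‖ = Real.sqrt μ) ∧
      shell d μ η ⊆ ⋃ x : S, Metric.ball (x : Space d) ρ := by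
  obtain ⟨t, ht, htf, hcov⟩ := (isCompact_sphere (0 : Space d) (Real.sqrt μ)).finite_cover_balls
    (half_pos hρ)
  have hs : 0 < Real.sqrt μ := Real.sqrt_pos.2 hμ
  -- The bound by μ keeps q away from 0, so that q can be projected radially to the sphere; the
  -- bound by √μ ρ/2 puts that projection within ρ/2, since |‖q‖ - √μ| √μ ≤ |‖q‖² - μ|.
  refine ⟨min μ (Real.sqrt μ * (ρ / 2)), by positivity, htf.toFinset, fun x hx => ?_, fun q hq => ?_⟩
  · simpa using ht ((Set.Finite.mem_toFinset htf).1 hx)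
  have hq1 : |‖q‖ ^ 2 - μ| < min μ (Real.sqrt μ * (ρ / 2)) := hq
  have hq2 := hq1.trans_le (min_le_left _ _)
  have hq3 := hq1.trans_le (min_le_right _ _)
  have hq0 : 0 < ‖q‖ := by
    rcases (norm_nonneg q).eq_or_lt with h0 | h0
    · rw [← h0] at hq2
      rw [abs_lt] at hq2
      norm_num at hq2
    · exact h0
  set q' : Space d := (Real.sqrt μ / ‖q‖) • q
  have hq' : ‖q'‖ = Real.sqrt μ := by
    rw [norm_smul, Real.norm_of_nonneg (by positivity), div_mul_cancel₀ _ hq0.ne']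
  have hdist : dist q q' < ρ / 2 := by
    have e1 : q - q' = (1 - Real.sqrt μ / ‖q‖) • q := by rw [sub_smul, one_smul]
    have e2 : dist q q' = |‖q‖ - Real.sqrt μ| := by
      rw [dist_eq_norm, e1, norm_smul, Real.norm_eq_abs]
      conv_lhs => rw [← abs_of_pos hq0, ← abs_mul, abs_of_pos hq0]
      rw [sub_mul, one_mul, div_mul_cancel₀ _ hq0.ne']
    rw [e2]
    have e3 : ‖q‖ ^ 2 - μ = (‖q‖ - Real.sqrt μ) * (‖q‖ + Real.sqrt μ) := by
      have := Real.sq_sqrt hμ.le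
      linear_combination this
    rw [e3, abs_mul, abs_of_pos (by positivity : 0 < ‖q‖ + Real.sqrt μ)] at hq3
    have e4 : |‖q‖ - Real.sqrt μ| * Real.sqrt μ ≤ |‖q‖ - Real.sqrt μ| * (‖q‖ + Real.sqrt μ) :=
      mul_le_mul_of_nonneg_left (by linarith) (abs_nonneg _)
    have e5 : |‖q‖ - Real.sqrt μ| * Real.sqrt μ < (ρ / 2) * Real.sqrt μ := by linarith
    exact lt_of_mul_lt_mul_right e5 hs.le
  have := hcov (by simpa using hq' : q' ∈ Metric.sphere (0 : Space d) (Real.sqrt μ))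
  simp only [Set.mem_iUnion, Metric.mem_ball, exists_prop] at this ⊢
  obtain ⟨x, hx, hxq⟩ := this
  refine ⟨⟨x, (Set.Finite.mem_toFinset htf).2 hx⟩, ?_⟩
  calc dist q x ≤ dist q q' + dist q' x := dist_triangle _ _ _
    _ < ρ / 2 + ρ / 2 := add_lt_add hdist hxq
    _ = ρ := add_halves ρ

/-- The near-shell mass of the profile is controlled by the gap on the Fermi sphere. -/
lemma exists_near_bound {μ : ℝ} (hμ : 0 < μ) {W : Space d → ℝ} (hW : IsAttractive W) :
    ∃ η : ℝ, 0 < η ∧ ∃ κ : ℝ, 0 ≤ κ ∧ ∀ (lam T : ℝ) (F : Space d → ℝ), IsGap μ lam T W F →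
      ∀ p₀ : Space d, ‖p₀‖ = Real.sqrt μ →
      ∫⁻ q in shell d μ η, ENNReal.ofReal (F q / kin μ T q) ≤ ENNReal.ofReal (κ * F p₀ / lam) := by
  have hw0 : W 0 / 2 < W 0 := by linarith [hW.zero_pos]
  obtain ⟨ρ, hρ, hball⟩ := Metric.mem_nhds_iff.1
    ((isOpen_lt continuous_const hW.cont).mem_nhds (show (0 : Space d) ∈ {q | W 0 / 2 < W q} from hw0))
  obtain ⟨η, hη, S, hS, hcov⟩ := exists_shell_cover (d := d) hμ hρ
  have hw2 : 0 < W 0 / 2 := by linarith [hW.zero_pos]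
  -- The constant is the number of covering balls of radius ρ times 2/W(0): on each ball centred at
  -- p₀ the kernel exceeds W(0)/2, so the ball's mass is at most (2/W(0)) F(p₀)/λ by the gap
  -- equation at p₀, and by radiality all balls have this mass.
  refine ⟨η, hη, S.card * (W 0 / 2)⁻¹, by positivity, fun lam T F h p₀ hp₀ => ?_⟩
  set φ : Space d → ℝ≥0∞ := fun q => ENNReal.ofReal (F q / kin μ T q)
  have hrot : ∀ x : S, ∫⁻ q in Metric.ball (x : Space d) ρ, φ q = ∫⁻ q in Metric.ball p₀ ρ, φ q := by
    intro x
    obtain ⟨R, hR⟩ := exists_isometry (p := p₀) (q := (x : Space d)) (by rw [hp₀, hS x x.2])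
    have h1 := R.measurePreserving.setLIntegral_comp_preimage_emb
      R.toHomeomorph.measurableEmbedding φ (Metric.ball (x : Space d) ρ)
    have h2 : R ⁻¹' Metric.ball (x : Space d) ρ = Metric.ball p₀ ρ := by
      rw [← hR]; ext q; simp
    rw [h2] at h1
    rw [← h1]
    congr 1; ext q
    simp only [φ]
    rw [h.radial hW (R.norm_map q), kin_congr μ T (R.norm_map q)]
  have hB : ∫⁻ q in Metric.ball p₀ ρ, φ q ≤
      ENNReal.ofReal (W 0 / 2)⁻¹ * ENNReal.ofReal (F p₀ / lam) := by
    rw [← h.lintegral_eq hW p₀, ← lintegral_const_mul' _ _ ENNReal.ofReal_ne_top]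
    refine le_trans ?_ (setLIntegral_le_lintegral (Metric.ball p₀ ρ) _)
    refine setLIntegral_mono' measurableSet_ball fun q hq => ?_
    rw [← mul_assoc, ← ENNReal.ofReal_mul (by positivity)]
    refine le_mul_of_one_le_left zero_le ?_
    rw [ENNReal.one_le_ofReal]
    have : W 0 / 2 < W (p₀ - q) := hball (by
      rw [Metric.mem_ball, dist_zero_right, ← dist_eq_norm, dist_comm]; exact hq)
    rw [inv_mul_eq_div, one_le_div hw2]
    exact this.le
  calc ∫⁻ q in shell d μ η, φ q ≤ ∫⁻ q in ⋃ x : S, Metric.ball (x : Space d) ρ, φ q :=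
        lintegral_mono_set hcov
    _ ≤ ∑' x : S, ∫⁻ q in Metric.ball (x : Space d) ρ, φ q := lintegral_iUnion_le _ _
    _ = S.card * ∫⁻ q in Metric.ball p₀ ρ, φ q := by
        simp_rw [hrot]
        rw [tsum_fintype]
        simp
    _ ≤ S.card * (ENNReal.ofReal (W 0 / 2)⁻¹ * ENNReal.ofReal (F p₀ / lam)) := by gcongr
    _ = _ := by
        rw [← ENNReal.ofReal_mul (by positivity), ← ENNReal.ofReal_natCast,
          ← ENNReal.ofReal_mul (by positivity)]
        congr 1; ring

lemma mul_one_add_sq_le {μ η : ℝ} (hμ : 0 < μ) (hη : 0 < η) {q : Space d} (hq : q ∉ shell d μ η) :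
    η / (1 + μ + η) * (1 + ‖q‖ ^ 2) ≤ |‖q‖ ^ 2 - μ| := by
  have h1 : η ≤ |‖q‖ ^ 2 - μ| := not_lt.1 hq
  have h2 : ‖q‖ ^ 2 ≤ μ + |‖q‖ ^ 2 - μ| := by linarith [le_abs_self (‖q‖ ^ 2 - μ)]
  rw [div_mul_eq_mul_div, div_le_iff₀ (by positivity)]
  nlinarith

/-- The energy of the profile away from the Fermi sphere is controlled at weak coupling. -/
lemma exists_far_bound {μ : ℝ} (hμ : 0 < μ) {W : Space d → ℝ} (hW : IsAttractive W) {B : ℝ}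
    (hB0 : 0 ≤ B) (hB : FormBounded W B) {η κ : ℝ} (hη : 0 < η) (hκ : 0 ≤ κ) :
    ∃ Λ : ℝ, 0 < Λ ∧ ∃ κ' : ℝ, 0 ≤ κ' ∧ ∀ (lam T : ℝ) (F : Space d → ℝ), IsGap μ lam T W F →
      lam < Λ → ∀ p₀ : Space d,
      ∫⁻ q in shell d μ η, ENNReal.ofReal (F q / kin μ T q) ≤ ENNReal.ofReal (κ * F p₀ / lam) →
      ∫⁻ q in (shell d μ η)ᶜ, ENNReal.ofReal (F q / kin μ T q) ^ 2 * ENNReal.ofReal (1 + ‖q‖ ^ 2) ≤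
        ENNReal.ofReal ((κ' * F p₀) ^ 2) := by
  obtain ⟨C, hC0, hC⟩ := hW.dual
  set c₀ := η / (1 + μ + η)
  have hc₀ : 0 < c₀ := by positivity
  -- The threshold makes λB ≤ c₀/2, so half of the far kinetic energy absorbs the far interaction; B
  -- + 1 avoids dividing by 0.
  refine ⟨c₀ / (2 * (B + 1)), by positivity, 2 * κ / c₀ * Real.sqrt C, by positivity,
    fun lam T F h hlam p₀ hnear => ?_⟩
  have hlam0 := h.lam_pos
  set N := shell d μ η
  have hNm : MeasurableSet N := (isOpen_shell μ η).measurableSet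
  set f : Space d → ℝ := fun q => F q / kin μ T q
  have hfm : Measurable f := h.measurable_profile
  have hf0 : ∀ q, 0 < f q := h.profile_pos
  set g : Space d → ℝ := Nᶜ.indicator f
  have hgm : Measurable g := hfm.indicator hNm.compl
  have hg0 : ∀ q, 0 ≤ g q := fun q => Set.indicator_nonneg (fun q _ => (hf0 q).le) q
  have hgf : ∀ q, g q ≤ f q := fun q => Set.indicator_le_self' (fun q _ => (hf0 q).le) q
  have hge : Integrable fun p => (1 + ‖p‖ ^ 2) * g p ^ 2 := by
    refine h.energy.mono (by fun_prop) (Filter.Eventually.of_forall fun p => ?_)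
    rw [Real.norm_of_nonneg (by positivity), Real.norm_of_nonneg (by positivity)]
    exact mul_le_mul_of_nonneg_left (pow_le_pow_left₀ (hg0 p) (hgf p) 2) (by positivity)
  set X : ℝ≥0∞ := ∫⁻ p, ENNReal.ofReal ((1 + ‖p‖ ^ 2) * g p ^ 2)
  have hXfin : X ≠ ∞ := hge.lintegral_lt_top.ne
  have hXeq : ∫⁻ q in Nᶜ, ENNReal.ofReal (f q) ^ 2 * ENNReal.ofReal (1 + ‖q‖ ^ 2) = X := by
    rw [← lintegral_indicator hNm.compl]
    congr 1; ext q
    by_cases hq : q ∈ Nᶜ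
    · simp only [g]
      rw [Set.indicator_of_mem hq, Set.indicator_of_mem hq, mul_comm,
        ENNReal.ofReal_mul (by positivity), ENNReal.ofReal_pow (hf0 q).le]
    · simp only [g]
      rw [Set.indicator_of_notMem hq, Set.indicator_of_notMem hq]; simp
  rw [hXeq]
  set J : ℝ≥0∞ := ∫⁻ q in N, ENNReal.ofReal (f q)
  have hWm : Measurable fun z : Space d × Space d => ENNReal.ofReal (W (z.1 - z.2)) :=
    (hW.cont.measurable.comp (measurable_fst.sub measurable_snd)).ennreal_ofReal
  have hWm' : ∀ p, Measurable fun q => ENNReal.ofReal (W (p - q)) := fun p =>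
    hWm.comp (by fun_prop : Measurable fun q : Space d => (p, q))
  have hsplit : ∀ p, ENNReal.ofReal (F p / lam) =
      (∫⁻ q in N, ENNReal.ofReal (W (p - q)) * ENNReal.ofReal (f q)) +
        ∫⁻ q, ENNReal.ofReal (W (p - q)) * ENNReal.ofReal (g q) := by
    intro p
    rw [← h.lintegral_eq hW p, ← lintegral_add_compl _ hNm]
    congr 1
    rw [← lintegral_indicator hNm.compl]
    congr 1; ext q
    by_cases hq : q ∈ Nᶜ
    · simp only [g]; rw [Set.indicator_of_mem hq, Set.indicator_of_mem hq]
    · simp only [g]; rw [Set.indicator_of_notMem hq, Set.indicator_of_notMem hq]; simp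
  have hGq : ∀ q, ∫⁻ p, ENNReal.ofReal (g p) * ENNReal.ofReal (W (p - q)) ≤
      ENNReal.ofReal (Real.sqrt (X.toReal * C)) := by
    intro q
    have h1 := lintegral_weighted_mul_sq_le (G := fun p => ENNReal.ofReal (g p))
      (H := fun p => ENNReal.ofReal (W (q - p))) hgm.ennreal_ofReal.aemeasurable
      (hWm' q).aemeasurable
    have h2 : ∫⁻ p, ENNReal.ofReal (g p) ^ 2 * ENNReal.ofReal (1 + ‖p‖ ^ 2) = X := by
      congr 1; ext p
      rw [mul_comm, ENNReal.ofReal_mul (by positivity), ENNReal.ofReal_pow (hg0 p)]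
    rw [h2] at h1
    have h3 := h1.trans (mul_le_mul_right (hC q) X)
    rw [← ENNReal.ofReal_toReal hXfin, ← ENNReal.ofReal_mul ENNReal.toReal_nonneg,
      ← Real.sq_sqrt (by positivity : 0 ≤ X.toReal * C), ENNReal.ofReal_pow (Real.sqrt_nonneg _)] at h3
    have h4 := (ENNReal.pow_le_pow_left_iff two_ne_zero).1 h3
    simp_rw [hW.comm _ q]
    exact h4
  -- The gap equation K f = λ W ⋆ f is tested with the far part g of f. On its support K ≥ c₀(1 +
  -- p²), the far-far interaction is at most BX, and the far-near one at most the near mass J times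
  -- (XC)^{1/2}.
  have hmain : ENNReal.ofReal c₀ * X ≤ ENNReal.ofReal lam *
      (ENNReal.ofReal B * X + J * ENNReal.ofReal (Real.sqrt (X.toReal * C))) := by
    calc ENNReal.ofReal c₀ * X
        ≤ ∫⁻ p, ENNReal.ofReal lam * (ENNReal.ofReal (g p) * ENNReal.ofReal (F p / lam)) := by
          rw [← lintegral_const_mul' _ _ ENNReal.ofReal_ne_top]
          refine lintegral_mono fun p => ?_
          rw [← ENNReal.ofReal_mul hc₀.le, ← ENNReal.ofReal_mul (hg0 p),
            ← ENNReal.ofReal_mul hlam0.le]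
          refine ENNReal.ofReal_le_ofReal ?_
          by_cases hp : p ∈ Nᶜ
          · have e1 : g p = f p := Set.indicator_of_mem hp _
            have e2 := (mul_one_add_sq_le hμ hη hp).trans (abs_le_kin h.temp_pos p)
            have e3 : F p = kin μ T p * f p := by
              simp only [f]; rw [mul_div_cancel₀ _ (kin_pos h.temp_pos p).ne']
            rw [e1, ← mul_assoc]
            calc c₀ * (1 + ‖p‖ ^ 2) * f p ^ 2 ≤ kin μ T p * f p ^ 2 := by gcongr
              _ = _ := by rw [e3]; field_simp
          · have e1 : g p = 0 := Set.indicator_of_notMem hp _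
            rw [e1]; simp
      _ = ENNReal.ofReal lam * ((∫⁻ p, ENNReal.ofReal (g p) *
            ∫⁻ q, ENNReal.ofReal (W (p - q)) * ENNReal.ofReal (g q)) +
          ∫⁻ p, ENNReal.ofReal (g p) *
            ∫⁻ q in N, ENNReal.ofReal (W (p - q)) * ENNReal.ofReal (f q)) := by
          rw [lintegral_const_mul' _ _ ENNReal.ofReal_ne_top, ← lintegral_add_left]
          · congr 2; ext p
            rw [hsplit, mul_add, add_comm]
          · refine hgm.ennreal_ofReal.mul ?_
            exact Measurable.lintegral_prod_right' (f := fun z : Space d × Space d =>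
              ENNReal.ofReal (W (z.1 - z.2)) * ENNReal.ofReal (g z.2))
              (hWm.mul (hgm.comp measurable_snd).ennreal_ofReal)
      _ ≤ _ := by
          gcongr
          · exact hB g hgm hg0 hge
          · simp_rw [← lintegral_const_mul' _ _ ENNReal.ofReal_ne_top]
            rw [lintegral_lintegral_swap]
            · calc ∫⁻ q in N, ∫⁻ p, ENNReal.ofReal (g p) *
                    (ENNReal.ofReal (W (p - q)) * ENNReal.ofReal (f q))
                  ≤ ∫⁻ q in N, ENNReal.ofReal (f q) * ENNReal.ofReal (Real.sqrt (X.toReal * C)) := by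
                    refine lintegral_mono fun q => ?_
                    have : ∀ p, ENNReal.ofReal (g p) *
                        (ENNReal.ofReal (W (p - q)) * ENNReal.ofReal (f q)) =
                        ENNReal.ofReal (f q) * (ENNReal.ofReal (g p) * ENNReal.ofReal (W (p - q))) :=
                      fun p => by ring
                    simp_rw [this]
                    rw [lintegral_const_mul' _ _ ENNReal.ofReal_ne_top]
                    exact mul_le_mul_right (hGq q) _
                _ = _ := lintegral_mul_const' _ _ ENNReal.ofReal_ne_top
            · refine Measurable.aemeasurable ?_
              exact (hgm.comp measurable_fst).ennreal_ofReal.mul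
                (hWm.mul (hfm.comp measurable_snd).ennreal_ofReal)
  set x := X.toReal
  have hx0 : 0 ≤ x := ENNReal.toReal_nonneg
  have hXx : X = ENNReal.ofReal x := (ENNReal.ofReal_toReal hXfin).symm
  have hF0 := h.pos p₀
  -- The near mass carries a factor 1/λ, which cancels the λ in front; hence the final constant does
  -- not depend on λ.
  have hreal : c₀ * x ≤ lam * (B * x + κ * F p₀ / lam * Real.sqrt (x * C)) := by
    have h1 := hmain.trans (mul_le_mul_right (add_le_add_right (mul_le_mul_left hnear _) _) _)
    rw [hXx, ← ENNReal.ofReal_mul hc₀.le, ← ENNReal.ofReal_mul hB0,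
      ← ENNReal.ofReal_mul (by positivity), ← ENNReal.ofReal_add (by positivity) (by positivity),
      ← ENNReal.ofReal_mul hlam0.le] at h1
    exact (ENNReal.ofReal_le_ofReal_iff (by positivity)).1 h1
  rw [hXx]
  refine ENNReal.ofReal_le_ofReal ?_
  have h2 : lam * (κ * F p₀ / lam * Real.sqrt (x * C)) = κ * F p₀ * (Real.sqrt x * Real.sqrt C) := by
    rw [Real.sqrt_mul hx0]; field_simp
  have h3 : lam * B ≤ c₀ / 2 := by
    rw [lt_div_iff₀ (by positivity)] at hlam
    nlinarith
  have h4 : c₀ / 2 * x ≤ κ * F p₀ * (Real.sqrt x * Real.sqrt C) := by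
    rw [mul_add, h2] at hreal
    nlinarith
  have h5 : Real.sqrt x ≤ 2 * κ / c₀ * Real.sqrt C * F p₀ := by
    rcases hx0.eq_or_lt with h0 | h0
    · rw [← h0, Real.sqrt_zero]; positivity
    · have hs : 0 < Real.sqrt x := Real.sqrt_pos.2 h0
      have h6 : c₀ / 2 * Real.sqrt x * Real.sqrt x ≤ κ * F p₀ * Real.sqrt C * Real.sqrt x := by
        rw [mul_assoc, Real.mul_self_sqrt hx0]; linarith
      have h7 := le_of_mul_le_mul_right h6 hs
      calc Real.sqrt x = 2 / c₀ * (c₀ / 2 * Real.sqrt x) := by field_simp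
        _ ≤ 2 / c₀ * (κ * F p₀ * Real.sqrt C) := by gcongr
        _ = _ := by ring
  calc x = Real.sqrt x ^ 2 := (Real.sq_sqrt hx0).symm
    _ ≤ _ := pow_le_pow_left₀ (Real.sqrt_nonneg _) h5 2

end

/-! ### A priori bounds on the gap function at weak coupling -/

section

variable {d : ℕ}

/-- Temperature, size and modulus of continuity of the gap function at weak coupling. -/
lemma exists_weak_coupling_bounds {μ : ℝ} (hμ : 0 < μ) {W : Space d → ℝ} (hW : IsAttractive W)
    {B : ℝ} (hB0 : 0 ≤ B) (hB : FormBounded W B) :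
    ∃ Λ : ℝ, 0 < Λ ∧ ∃ K : ℝ, 0 < K ∧ ∀ (lam T : ℝ) (F : Space d → ℝ), IsGap μ lam T W F →
      lam < Λ → ∀ p₀ : Space d, ‖p₀‖ = Real.sqrt μ →
      T ≤ K * lam ∧ (∀ p, F p ≤ K * F p₀) ∧
      ∀ p p' ω, (∀ q, |W (p - q) - W (p' - q)| ≤ ω) → |F p - F p'| ≤ K * (ω + lam) * F p₀ := by
  obtain ⟨η, hη, κ, hκ, hnear⟩ := exists_near_bound hμ hW
  obtain ⟨Λ, hΛ, κ', hκ', hfar⟩ := exists_far_bound hμ hW hB0 hB hη hκ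
  obtain ⟨C, hC0, hC⟩ := hW.dual
  obtain ⟨M, hM⟩ := hW.bdd
  have hM0 : 0 ≤ M := (hW.nonneg 0).trans (hM 0)
  set N := shell d μ η
  have hNm : MeasurableSet N := (isOpen_shell μ η).measurableSet
  set s := Real.sqrt C * κ'
  have hs : 0 ≤ s := by positivity
  set v := (volume N).toReal
  have hv : volume N = ENNReal.ofReal v := (ENNReal.ofReal_toReal measure_shell_lt_top.ne).symm
  have hv0 : 0 ≤ v := ENNReal.toReal_nonneg
  set Λ' := min Λ (min 1 (1 / (2 * s + 1)))
  set K₁ := M * κ + s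
  have hK₁ : 0 ≤ K₁ := by positivity
  refine ⟨Λ', by positivity, K₁ + M * K₁ * v + κ + 2 * s + 1, by positivity,
    fun lam T F h hlam p₀ hp₀ => ?_⟩
  have hl0 := h.lam_pos
  have hT0 := h.temp_pos
  have hl1 : lam < Λ := hlam.trans_le (min_le_left _ _)
  have hl2 : lam < 1 := hlam.trans_le ((min_le_right _ _).trans (min_le_left _ _))
  have hl3 : lam < 1 / (2 * s + 1) := hlam.trans_le ((min_le_right _ _).trans (min_le_right _ _))
  have hJ := hnear lam T F h p₀ hp₀
  have hX := hfar lam T F h hl1 p₀ hJ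
  have hF0 := h.pos p₀
  set f : Space d → ℝ := fun q => F q / kin μ T q
  have hfm : Measurable f := h.measurable_profile
  have hf0 : ∀ q, 0 < f q := h.profile_pos
  have hWm : ∀ p, Measurable fun q => ENNReal.ofReal (W (p - q)) := fun p =>
    (hW.cont.comp (by fun_prop : Continuous fun q : Space d => p - q)).measurable.ennreal_ofReal
  -- Far contributions to W ⋆ f are O(F(p₀)) without the factor 1/λ of the near mass, hence
  -- contribute only O(λ) F(p₀) to F.
  have hfarW : ∀ p, ∫⁻ q in Nᶜ, ENNReal.ofReal (W (p - q)) * ENNReal.ofReal (f q) ≤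
      ENNReal.ofReal (s * F p₀) := by
    intro p
    have h1 := lintegral_weighted_mul_sq_le
      (G := Nᶜ.indicator fun q => ENNReal.ofReal (f q))
      (H := fun q => ENNReal.ofReal (W (p - q)))
      (hfm.ennreal_ofReal.indicator hNm.compl).aemeasurable (hWm p).aemeasurable
    have h2 : ∫⁻ q, (Nᶜ.indicator fun q => ENNReal.ofReal (f q)) q * ENNReal.ofReal (W (p - q)) =
        ∫⁻ q in Nᶜ, ENNReal.ofReal (W (p - q)) * ENNReal.ofReal (f q) := by
      rw [← lintegral_indicator hNm.compl]
      congr 1; ext q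
      by_cases hq : q ∈ Nᶜ
      · rw [Set.indicator_of_mem hq, Set.indicator_of_mem hq, mul_comm]
      · rw [Set.indicator_of_notMem hq, Set.indicator_of_notMem hq, zero_mul]
    have h3 : ∫⁻ q, (Nᶜ.indicator fun q => ENNReal.ofReal (f q)) q ^ 2 *
        ENNReal.ofReal (1 + ‖q‖ ^ 2) =
        ∫⁻ q in Nᶜ, ENNReal.ofReal (f q) ^ 2 * ENNReal.ofReal (1 + ‖q‖ ^ 2) := by
      rw [← lintegral_indicator hNm.compl]
      congr 1; ext q
      by_cases hq : q ∈ Nᶜ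
      · rw [Set.indicator_of_mem hq, Set.indicator_of_mem hq]
      · rw [Set.indicator_of_notMem hq, Set.indicator_of_notMem hq]; simp
    rw [h2, h3] at h1
    have h4 := h1.trans (mul_le_mul' hX (hC p))
    rw [← ENNReal.ofReal_mul (by positivity), ← Real.sq_sqrt hC0, ← mul_pow,
      ENNReal.ofReal_pow (by positivity)] at h4
    refine ((ENNReal.pow_le_pow_left_iff two_ne_zero).1 h4).trans (le_of_eq ?_)
    congr 1; simp only [s]; ring
  -- Used with two bounds J of the near mass: the one of order F(p₀)/λ gives F ≤ K₁ F(p₀), and then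
  -- f ≤ F/(2T) on the shell gives the bound on T.
  have hFle : ∀ p J, 0 ≤ J → ∫⁻ q in N, ENNReal.ofReal (f q) ≤ ENNReal.ofReal J →
      F p ≤ lam * (M * J + s * F p₀) := by
    intro p J hJ0 hJ'
    have h1 := h.lintegral_eq hW p
    rw [← lintegral_add_compl _ hNm] at h1
    have h2 : ∫⁻ q in N, ENNReal.ofReal (W (p - q)) * ENNReal.ofReal (f q) ≤
        ENNReal.ofReal (M * J) := by
      rw [ENNReal.ofReal_mul hM0]
      refine le_trans ?_ (mul_le_mul_right hJ' _)
      rw [← lintegral_const_mul' _ _ ENNReal.ofReal_ne_top]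
      exact lintegral_mono fun q => mul_le_mul_left (ENNReal.ofReal_le_ofReal (hM _)) _
    have h3 := h1.symm.le.trans (add_le_add h2 (hfarW p))
    rw [← ENNReal.ofReal_add (by positivity) (by positivity),
      ENNReal.ofReal_le_ofReal_iff (by positivity), div_le_iff₀ hl0] at h3
    linarith
  have hF1 : ∀ p, F p ≤ K₁ * F p₀ := by
    intro p
    refine (hFle p _ (by positivity) hJ).trans ?_
    have e : lam * (M * (κ * F p₀ / lam) + s * F p₀) = M * κ * F p₀ + lam * (s * F p₀) := by
      field_simp
    rw [e]
    have : lam * (s * F p₀) ≤ 1 * (s * F p₀) := by gcongr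
    simp only [K₁]; linarith
  refine ⟨?_, fun p => (hF1 p).trans ?_, fun p p' ω hω => ?_⟩
  · have hJ2 : ∫⁻ q in N, ENNReal.ofReal (f q) ≤ ENNReal.ofReal (K₁ * F p₀ / (2 * T) * v) := by
      rw [ENNReal.ofReal_mul (by positivity), ← hv, ← setLIntegral_const]
      refine lintegral_mono fun q => ENNReal.ofReal_le_ofReal ?_
      exact div_le_div₀ (by positivity) (hF1 q) (by positivity) (two_mul_le_kin hT0 q)
    have h1 := hFle p₀ _ (by positivity) hJ2
    -- Half of F(p₀) survives after absorbing the far part; dividing by F(p₀) > 0 leaves T ≤ λ M K₁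
    -- v.
    have h2 : lam * s ≤ 1 / 2 := by
      rw [lt_div_iff₀ (by positivity)] at hl3
      nlinarith
    have h3 : F p₀ * (1 / 2) ≤ F p₀ * (lam * (M * K₁ * v) / (2 * T)) := by
      have e : lam * (M * (K₁ * F p₀ / (2 * T) * v) + s * F p₀) =
        F p₀ * (lam * (M * K₁ * v) / (2 * T)) + lam * s * F p₀ := by field_simp
      rw [e] at h1
      nlinarith
    have h4 := le_of_mul_le_mul_left h3 hF0
    rw [le_div_iff₀ (by positivity)] at h4
    have h5 : 0 ≤ (K₁ + κ + 2 * s + 1) * lam := by positivity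
    nlinarith
  · refine mul_le_mul_of_nonneg_right ?_ hF0.le
    have : 0 ≤ M * K₁ * v := by positivity
    linarith
  · have hω0 : 0 ≤ ω := (abs_nonneg _).trans (hω 0)
    have e1 : F p - F p' = lam * ∫ q, (W (p - q) - W (p' - q)) * f q := by
      have : ∀ q, (W (p - q) - W (p' - q)) * f q = W (p - q) * f q - W (p' - q) * f q := fun q => by
        ring
      simp_rw [this]
      rw [integral_sub (h.int p) (h.int p'), mul_sub, ← h.eq p, ← h.eq p']
    have h1 : ∫⁻ q, ENNReal.ofReal |W (p - q) - W (p' - q)| * ENNReal.ofReal (f q) ≤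
        ENNReal.ofReal (ω * (κ * F p₀ / lam) + (s * F p₀ + s * F p₀)) := by
      rw [← lintegral_add_compl _ hNm, ENNReal.ofReal_add (by positivity) (by positivity)]
      refine add_le_add ?_ ?_
      · rw [ENNReal.ofReal_mul hω0]
        refine le_trans ?_ (mul_le_mul_right hJ _)
        rw [← lintegral_const_mul' _ _ ENNReal.ofReal_ne_top]
        exact lintegral_mono fun q => mul_le_mul_left (ENNReal.ofReal_le_ofReal (hω q)) _
      · rw [ENNReal.ofReal_add (by positivity) (by positivity)]
        refine le_trans ?_ (add_le_add (hfarW p) (hfarW p'))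
        rw [← lintegral_add_left (by exact (hWm p).mul hfm.ennreal_ofReal)]
        refine lintegral_mono fun q => ?_
        rw [← add_mul, ← ENNReal.ofReal_add (hW.nonneg _) (hW.nonneg _)]
        refine mul_le_mul_left (ENNReal.ofReal_le_ofReal ?_) _
        have := hW.nonneg (p - q)
        have := hW.nonneg (p' - q)
        exact abs_sub_le_iff.2 ⟨by linarith, by linarith⟩
    have h2 : |∫ q, (W (p - q) - W (p' - q)) * f q| ≤
        ω * (κ * F p₀ / lam) + (s * F p₀ + s * F p₀) := by
      have h3 := enorm_integral_le_lintegral_enorm (μ := volume)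
        fun q => (W (p - q) - W (p' - q)) * f q
      rw [← ofReal_norm, Real.norm_eq_abs] at h3
      rw [← ENNReal.ofReal_le_ofReal_iff (by positivity)]
      refine h3.trans (le_trans (le_of_eq ?_) h1)
      congr 1; ext q
      rw [enorm_mul, ← ofReal_norm, ← ofReal_norm, Real.norm_eq_abs, Real.norm_of_nonneg (hf0 q).le]
    rw [e1, abs_mul, abs_of_pos hl0]
    calc lam * |∫ q, (W (p - q) - W (p' - q)) * f q|
        ≤ lam * (ω * (κ * F p₀ / lam) + (s * F p₀ + s * F p₀)) := by gcongr
      _ = (κ * ω + 2 * s * lam) * F p₀ := by field_simp; ring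
      _ ≤ _ := by
        refine mul_le_mul_of_nonneg_right ?_ hF0.le
        have h5 : 0 ≤ M * K₁ * v := by positivity
        have h6 : 0 ≤ (K₁ + M * K₁ * v + 2 * s + 1) * ω := by positivity
        have h7 : 0 ≤ (K₁ + M * K₁ * v + κ + 1) * lam := by positivity
        nlinarith

/-- At weak coupling the gap function is nearly constant close to the Fermi sphere. -/
lemma exists_gap_near_const {μ : ℝ} (hμ : 0 < μ) {W : Space d → ℝ} (hW : IsAttractive W)
    {B : ℝ} (hB0 : 0 ≤ B) (hB : FormBounded W B) {ε : ℝ} (hε : 0 < ε) :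
    ∃ Λ : ℝ, 0 < Λ ∧ ∃ δ : ℝ, 0 < δ ∧ ∀ (lam T : ℝ) (F : Space d → ℝ), IsGap μ lam T W F →
      lam < Λ → ∀ p₀ : Space d, ‖p₀‖ = Real.sqrt μ →
      ∀ p : Space d, |‖p‖ - Real.sqrt μ| < δ → |F p - F p₀| ≤ ε * F p₀ := by
  obtain ⟨Λ, hΛ, K, hK, h⟩ := exists_weak_coupling_bounds hμ hW hB0 hB
  obtain ⟨δ, hδ, hδW⟩ := Metric.uniformContinuous_iff.1 hW.unif (ε / (2 * K)) (by positivity)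
  have hs : 0 < Real.sqrt μ := Real.sqrt_pos.2 hμ
  refine ⟨min Λ (ε / (2 * K)), by positivity, min δ (Real.sqrt μ), by positivity,
    fun lam T F hF hlam p₀ hp₀ p hp => ?_⟩
  have hp1 := hp.trans_le (min_le_left _ _)
  have hp2 := hp.trans_le (min_le_right _ _)
  have hp0 : 0 < ‖p‖ := by linarith [(abs_lt.1 hp2).1]
  -- The comparison point is the radial projection of p to the Fermi sphere, where F takes the value
  -- F(p₀); then p - p' is small and the uniform continuity of W applies.
  set p' : Space d := (Real.sqrt μ / ‖p‖) • p
  have hp' : ‖p'‖ = Real.sqrt μ := by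
    rw [norm_smul, Real.norm_of_nonneg (by positivity), div_mul_cancel₀ _ hp0.ne']
  have hdist : ‖p - p'‖ < δ := by
    have e1 : p - p' = (1 - Real.sqrt μ / ‖p‖) • p := by rw [sub_smul, one_smul]
    have e2 : ‖p - p'‖ = |‖p‖ - Real.sqrt μ| := by
      rw [e1, norm_smul, Real.norm_eq_abs]
      conv_lhs => rw [← abs_of_pos hp0, ← abs_mul, abs_of_pos hp0]
      rw [sub_mul, one_mul, div_mul_cancel₀ _ hp0.ne']
    rwa [e2]
  rw [← hF.radial hW (hp'.trans hp₀.symm)]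
  obtain ⟨-, -, h3⟩ := h lam T F hF (hlam.trans_le (min_le_left _ _)) p' hp'
  refine (h3 p p' (ε / (2 * K)) fun q => ?_).trans ?_
  · rw [← Real.dist_eq]
    refine (hδW ?_).le
    rwa [dist_eq_norm, sub_sub_sub_cancel_right]
  · refine mul_le_mul_of_nonneg_right ?_ (hF.pos p').le
    have := hlam.trans_le (min_le_right _ _)
    calc K * (ε / (2 * K) + lam) ≤ K * (ε / (2 * K) + ε / (2 * K)) := by gcongr
      _ = ε := by field_simp; ring

end

/-! ### Matsubara expansions of g₀ and of g₁(z)/z -/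

section

open Filter Topology

/-- The fermionic Matsubara frequencies `(2k+1)π`. -/
def matsubara (k : ℕ) : ℝ := (2 * k + 1) * Real.pi

lemma matsubara_pos (k : ℕ) : 0 < matsubara k := by unfold matsubara; positivity

lemma succ_le_matsubara (k : ℕ) : (k : ℝ) + 1 ≤ matsubara k := by
  unfold matsubara
  nlinarith [Real.pi_gt_three, (Nat.cast_nonneg k : (0 : ℝ) ≤ k)]

lemma summable_one_div_succ_pow {n : ℕ} (hn : 1 < n) :
    Summable fun k : ℕ => 1 / ((k : ℝ) + 1) ^ n := by
  have := (summable_nat_add_iff 1).2 (Real.summable_one_div_nat_pow.2 hn)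
  simpa using this

lemma summable_inv_matsubara_pow {n : ℕ} (hn : 1 < n) :
    Summable fun k : ℕ => 1 / matsubara k ^ n :=
  (summable_one_div_succ_pow hn).of_nonneg_of_le
    (fun k => by have := matsubara_pos k; positivity)
    (fun k => by have := succ_le_matsubara k; gcongr)

lemma summable_coth_term (a z : ℝ) :
    Summable fun n : ℕ => a / (z ^ 2 + Real.pi ^ 2 * ((n : ℝ) + 1) ^ 2) := by
  refine ((summable_one_div_succ_pow (n := 2) (by norm_num)).mul_left |a|).of_norm_bounded
    fun n => ?_
  have h1 : ((n : ℝ) + 1) ^ 2 ≤ z ^ 2 + Real.pi ^ 2 * ((n : ℝ) + 1) ^ 2 := by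
    have : (1 : ℝ) ≤ Real.pi ^ 2 := by nlinarith [Real.pi_gt_three]
    nlinarith [sq_nonneg z, sq_nonneg ((n : ℝ) + 1)]
  rw [norm_div, Real.norm_eq_abs, Real.norm_of_nonneg (by positivity), ← mul_one_div]
  gcongr

/-- The Mittag-Leffler expansion of the cotangent at the imaginary point iz/π. -/
lemma coth_series {z : ℝ} (hz : z ≠ 0) :
    Real.cosh z / Real.sinh z - 1 / z =
      ∑' n : ℕ, 2 * z / (z ^ 2 + Real.pi ^ 2 * ((n : ℝ) + 1) ^ 2) := by
  have hpi : (Real.pi : ℂ) ≠ 0 := by exact_mod_cast Real.pi_ne_zero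
  have hzc : (z : ℂ) ≠ 0 := by exact_mod_cast hz
  have hs : Complex.sinh z ≠ 0 := by
    rw [← Complex.ofReal_sinh]; exact_mod_cast Real.sinh_ne_zero.2 hz
  have hx : Complex.I * z / Real.pi ∈ Complex.integerComplement := by
    rintro ⟨n, hn⟩
    have := congrArg Complex.im hn
    rw [show Complex.I * (z : ℂ) / Real.pi = ((z / Real.pi : ℝ) : ℂ) * Complex.I by
      push_cast; ring] at this
    simp at this
    exact div_ne_zero hz Real.pi_ne_zero this.symm
  have key := cot_series_rep' hx
  have hcot : (Real.pi : ℂ) * Complex.cot (Real.pi * (Complex.I * z / Real.pi)) =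
      -(Complex.I * Real.pi) * (Complex.cosh z / Complex.sinh z) := by
    rw [mul_div_cancel₀ _ hpi, Complex.cot_eq_cos_div_sin, mul_comm Complex.I, Complex.cos_mul_I,
      Complex.sin_mul_I]
    field_simp
    simp
  have hterm : ∀ n : ℕ, 1 / (Complex.I * z / Real.pi - ((n : ℂ) + 1)) +
      1 / (Complex.I * z / Real.pi + ((n : ℂ) + 1)) =
      -(Complex.I * Real.pi) * ((2 * z / (z ^ 2 + Real.pi ^ 2 * ((n : ℝ) + 1) ^ 2) : ℝ) : ℂ) := by
    intro n
    have hne : (z : ℂ) ^ 2 + Real.pi ^ 2 * ((n : ℂ) + 1) ^ 2 ≠ 0 := by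
      have : (0 : ℝ) < z ^ 2 + Real.pi ^ 2 * ((n : ℝ) + 1) ^ 2 := by positivity
      exact_mod_cast this.ne'
    have hfac : (z : ℂ) ^ 2 + Real.pi ^ 2 * ((n : ℂ) + 1) ^ 2 =
        -((Complex.I * z - Real.pi * ((n : ℂ) + 1)) * (Complex.I * z + Real.pi * ((n : ℂ) + 1))) := by
      ring_nf; rw [Complex.I_sq]; ring
    have h1 : Complex.I * z - Real.pi * ((n : ℂ) + 1) ≠ 0 := by
      intro h0; rw [hfac, h0] at hne; simp at hne
    have h2 : Complex.I * z + Real.pi * ((n : ℂ) + 1) ≠ 0 := by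
      intro h0; rw [hfac, h0] at hne; simp at hne
    have e1 : Complex.I * z / Real.pi - ((n : ℂ) + 1) =
      (Complex.I * z - Real.pi * ((n : ℂ) + 1)) / Real.pi := by field_simp
    have e2 : Complex.I * z / Real.pi + ((n : ℂ) + 1) =
      (Complex.I * z + Real.pi * ((n : ℂ) + 1)) / Real.pi := by field_simp
    push_cast
    rw [hfac, e1, e2]
    field_simp
    ring
  rw [hcot, tsum_congr hterm, tsum_mul_left] at key
  have hc : -(Complex.I * (Real.pi : ℂ)) ≠ 0 := by simp [hpi]
  have h3 : 1 / (Complex.I * z / Real.pi) = -(Complex.I * (Real.pi : ℂ)) * (1 / z) := by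
    field_simp
    simp
  rw [h3, ← mul_sub] at key
  have := mul_left_cancel₀ hc key
  rw [← Complex.ofReal_tsum] at this
  exact_mod_cast this

lemma tanh_half_eq {z : ℝ} (hz : z ≠ 0) :
    Real.tanh (z / 2) = 2 * (Real.cosh z / Real.sinh z) -
      Real.cosh (z / 2) / Real.sinh (z / 2) := by
  have hs : Real.sinh (z / 2) ≠ 0 := Real.sinh_ne_zero.2 (by simpa using hz)
  have hc := (Real.cosh_pos (z / 2)).ne'
  have e : z = 2 * (z / 2) := by ring
  rw [show Real.cosh z = Real.cosh (2 * (z / 2)) by rw [← e],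
    show Real.sinh z = Real.sinh (2 * (z / 2)) by rw [← e], Real.cosh_two_mul, Real.sinh_two_mul,
    Real.tanh_eq_sinh_div_cosh]
  field_simp
  ring

lemma summable_tanh_term (z : ℝ) : Summable fun k => 4 / (matsubara k ^ 2 + z ^ 2) :=
  ((summable_inv_matsubara_pow (n := 2) (by norm_num)).mul_left 4).of_nonneg_of_le
    (fun k => by positivity) (fun k => by
      have := matsubara_pos k
      rw [mul_one_div]; gcongr; nlinarith [sq_nonneg z])

-- Insert the hyperbolic cotangent series into tanh(z/2) = 2 coth z - coth(z/2): the poles at even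
-- multiples of π cancel and the odd ones, the Matsubara frequencies, remain.
set_option maxHeartbeats 800000 in
lemma g0_eq_tsum {z : ℝ} (hz : z ≠ 0) : g0 z = ∑' k, 4 / (matsubara k ^ 2 + z ^ 2) := by
  have h1 := coth_series hz
  have h2 := coth_series (z := z / 2) (by simpa using hz)
  have hsum := summable_coth_term (4 * z) z
  have heo := tsum_even_add_odd
    (f := fun n : ℕ => 4 * z / (z ^ 2 + Real.pi ^ 2 * ((n : ℝ) + 1) ^ 2))
    (hsum.comp_injective (i := fun n => 2 * n) fun a b h => by simpa using h)
    (hsum.comp_injective (i := fun n => 2 * n + 1) fun a b h => by simpa using h)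
  have e1 : ∑' n : ℕ, 4 * z / (z ^ 2 + Real.pi ^ 2 * ((n : ℝ) + 1) ^ 2) =
      2 * (Real.cosh z / Real.sinh z - 1 / z) := by
    rw [h1, ← tsum_mul_left]; congr 1; ext n; ring
  have e2 : ∑' n : ℕ, 4 * z / (z ^ 2 + Real.pi ^ 2 * (((2 * n + 1 : ℕ) : ℝ) + 1) ^ 2) =
      Real.cosh (z / 2) / Real.sinh (z / 2) - 1 / (z / 2) := by
    rw [h2]; congr 1; ext n
    have : (z / 2) ^ 2 + Real.pi ^ 2 * ((n : ℝ) + 1) ^ 2 ≠ 0 := by positivity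
    rw [div_eq_div_iff (by positivity) this]; push_cast; ring
  have e3 : ∑' n : ℕ, 4 * z / (z ^ 2 + Real.pi ^ 2 * (((2 * n : ℕ) : ℝ) + 1) ^ 2) =
      z * ∑' k, 4 / (matsubara k ^ 2 + z ^ 2) := by
    rw [← tsum_mul_left]; congr 1; ext n; unfold matsubara; push_cast; ring
  rw [e1, e2, e3] at heo
  rw [g0, tanh_half_eq hz, div_eq_iff hz]
  have : 1 / (z / 2) = 2 * (1 / z) := by field_simp
  linarith

/-- The continuous extension of `g₁(z) / z`. -/
def quarticWeight (z : ℝ) : ℝ := ∑' k, 8 / (matsubara k ^ 2 + z ^ 2) ^ 2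

lemma quarticWeight_term_le (k : ℕ) (z : ℝ) :
    8 / (matsubara k ^ 2 + z ^ 2) ^ 2 ≤ 8 * (1 / matsubara k ^ 4) := by
  have := matsubara_pos k
  rw [mul_one_div]
  gcongr
  nlinarith [sq_nonneg z, sq_nonneg (matsubara k), mul_nonneg (sq_nonneg z) (sq_nonneg (matsubara k)), sq_nonneg (z ^ 2)]

lemma summable_quarticWeight (z : ℝ) : Summable fun k => 8 / (matsubara k ^ 2 + z ^ 2) ^ 2 :=
  ((summable_inv_matsubara_pow (n := 4) (by norm_num)).mul_left 8).of_nonneg_of_le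
    (fun k => by positivity) (fun k => quarticWeight_term_le k z)

lemma hasDerivAt_g0 {z : ℝ} (hz : z ≠ 0) : HasDerivAt g0 (-g1 z) z := by
  have ht : HasDerivAt (fun x => Real.tanh (x / 2)) (1 / Real.cosh (z / 2) ^ 2 * (1 / 2)) z := by
    have hc := (Real.cosh_pos (z / 2)).ne'
    have h1 : HasDerivAt (fun x : ℝ => x / 2) (1 / 2) z := (hasDerivAt_id z).div_const 2
    have := (h1.sinh).div h1.cosh hc
    refine (this.congr_of_eventuallyEq ?_).congr_deriv ?_
    · exact Eventually.of_forall fun x => Real.tanh_eq_sinh_div_cosh _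
    · have := Real.cosh_sq (z / 2)
      field_simp
      linarith
  refine (ht.div (hasDerivAt_id z) hz).congr_deriv ?_
  have hc := (Real.cosh_pos (z / 2)).ne'
  unfold g1 g0
  simp only [id]
  field_simp
  ring

/-- Since g₁ = -g₀', this is termwise differentiation of the series for g₀, justified by 2|y|ω ≤ ω²
+ y². The right side is smooth through z = 0, where the left side has a removable singularity. -/
lemma g1_div_eq {z : ℝ} (hz : z ≠ 0) : g1 z / z = quarticWeight z := by
  have hd : ∀ (k : ℕ) (y : ℝ), HasDerivAt (fun y => 4 / (matsubara k ^ 2 + y ^ 2))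
      (-(8 * y) / (matsubara k ^ 2 + y ^ 2) ^ 2) y := by
    intro k y
    have hk := matsubara_pos k
    have h1 : HasDerivAt (fun y : ℝ => matsubara k ^ 2 + y ^ 2) (2 * y) y := by
      simpa using (hasDerivAt_pow 2 y).const_add (matsubara k ^ 2)
    refine ((hasDerivAt_const y (4 : ℝ)).div h1 (by positivity)).congr_deriv ?_
    ring
  have hb : ∀ (k : ℕ) (y : ℝ), ‖-(8 * y) / (matsubara k ^ 2 + y ^ 2) ^ 2‖ ≤
      4 * (1 / matsubara k ^ 3) := by
    intro k y
    have hk := matsubara_pos k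
    rw [Real.norm_eq_abs, abs_div, abs_neg, abs_mul, abs_of_nonneg (by norm_num : (0 : ℝ) ≤ 8),
      abs_of_nonneg (by positivity : 0 ≤ (matsubara k ^ 2 + y ^ 2) ^ 2), mul_one_div,
      div_le_div_iff₀ (by positivity) (by positivity), ← sq_abs y]
    have h1 : 2 * |y| * matsubara k ≤ matsubara k ^ 2 + |y| ^ 2 := by
      nlinarith [sq_nonneg (|y| - matsubara k)]
    have h2 : matsubara k ^ 2 ≤ matsubara k ^ 2 + |y| ^ 2 := by nlinarith [abs_nonneg y]
    have := mul_le_mul h1 h2 (by positivity) (by positivity)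
    nlinarith
  have := hasDerivAt_tsum ((summable_inv_matsubara_pow (n := 3) (by norm_num)).mul_left 4)
    hd hb (summable_tanh_term 0) z
  have heq : (fun y => ∑' k, 4 / (matsubara k ^ 2 + y ^ 2)) =ᶠ[𝓝 z] g0 :=
    (eventually_ne_nhds hz).mono fun y hy => (g0_eq_tsum hy).symm
  have h2 := (hasDerivAt_g0 hz).unique (this.congr_of_eventuallyEq heq.symm)
  have h3 : ∑' k, -(8 * z) / (matsubara k ^ 2 + z ^ 2) ^ 2 = -(z * quarticWeight z) := by
    rw [quarticWeight, ← tsum_mul_left, ← tsum_neg]; congr 1; ext k; ring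
  rw [div_eq_iff hz]
  linarith

lemma continuous_quarticWeight : Continuous quarticWeight := by
  refine continuous_tsum (u := fun k => 8 * (1 / matsubara k ^ 4)) (fun k => ?_)
    ((summable_inv_matsubara_pow (by norm_num)).mul_left 8) fun k z => ?_
  · have := matsubara_pos k
    exact continuous_const.div (by fun_prop) fun z => by positivity
  · rw [Real.norm_of_nonneg (by positivity)]
    exact quarticWeight_term_le k z

lemma quarticWeight_pos (z : ℝ) : 0 < quarticWeight z :=
  (summable_quarticWeight z).tsum_pos (fun k => by positivity) 0
    (by have := matsubara_pos 0; positivity)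

lemma quarticWeight_le (z : ℝ) :
    quarticWeight z ≤ (∑' k, 8 * (1 / matsubara k ^ 2)) / (1 + z ^ 2) := by
  have hs := (summable_inv_matsubara_pow (n := 2) (by norm_num)).mul_left 8
  rw [quarticWeight, ← tsum_div_const]
  refine (summable_quarticWeight z).tsum_le_tsum (fun k => ?_) (hs.div_const _)
  have hk := succ_le_matsubara k
  have h1 : 1 ≤ matsubara k := by linarith [(Nat.cast_nonneg k : (0 : ℝ) ≤ k)]
  have h2 : (1 : ℝ) ≤ matsubara k ^ 2 := by nlinarith
  rw [mul_one_div, div_div]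
  gcongr
  rw [sq (matsubara k ^ 2 + z ^ 2)]
  gcongr
  nlinarith [sq_nonneg z]

end

/-! ### The integrals 7ζ(3)/(2π²) and 4 -/

section

open Filter Topology

lemma tendsto_div_sq_add_sq {ω : ℝ} (hω : 0 < ω) {l : Filter ℝ}
    (hl : Tendsto (fun z : ℝ => |z|) l atTop) :
    Tendsto (fun z : ℝ => 4 * z / (ω ^ 2 * (ω ^ 2 + z ^ 2))) l (𝓝 0) := by
  have h1 : Tendsto (fun z : ℝ => 4 / ω ^ 2 * |z|⁻¹) l (𝓝 0) := by
    simpa using (tendsto_inv_atTop_zero.comp hl).const_mul (4 / ω ^ 2)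
  refine squeeze_zero_norm' ?_ h1
  filter_upwards [hl.eventually_gt_atTop 0] with z hz
  rw [Real.norm_eq_abs, abs_div, abs_mul, abs_of_pos (by norm_num : (0 : ℝ) < 4),
    abs_of_pos (by positivity : 0 < ω ^ 2 * (ω ^ 2 + z ^ 2)), ← sq_abs z, ← div_eq_mul_inv, div_div]
  rw [div_le_div_iff₀ (by positivity) (by positivity)]
  have : 0 < ω ^ 2 := by positivity
  nlinarith [mul_pos this this]

lemma hasDerivAt_quarticWeight_primitive {ω : ℝ} (hω : 0 < ω) (z : ℝ) :
    HasDerivAt (fun z => 4 / ω ^ 3 * Real.arctan (z / ω) + 4 * z / (ω ^ 2 * (ω ^ 2 + z ^ 2)))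
      (8 / (ω ^ 2 + z ^ 2) ^ 2) z := by
  have hne : ω ^ 2 + z ^ 2 ≠ 0 := by positivity
  have h1 := (((hasDerivAt_id z).div_const ω).arctan).const_mul (4 / ω ^ 3)
  have h2 : HasDerivAt (fun y : ℝ => ω ^ 2 * (ω ^ 2 + y ^ 2)) (ω ^ 2 * (2 * z)) z := by
    simpa using ((hasDerivAt_pow 2 z).const_add (ω ^ 2)).const_mul (ω ^ 2)
  have h3 := ((hasDerivAt_id z).const_mul 4).div h2 (by positivity)
  refine (h1.add h3).congr_deriv ?_
  have hne' : 1 + (z / ω) ^ 2 = (ω ^ 2 + z ^ 2) / ω ^ 2 := by field_simp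
  simp only [id]
  rw [hne']
  field_simp
  ring

lemma integrable_quarticWeight_term {ω : ℝ} (hω : 1 ≤ ω) :
    Integrable fun z : ℝ => 8 / (ω ^ 2 + z ^ 2) ^ 2 := by
  refine (integrable_inv_one_add_sq.const_mul 8).mono' ?_ (Eventually.of_forall fun z => ?_)
  · exact (by fun_prop : Measurable fun z : ℝ => 8 / (ω ^ 2 + z ^ 2) ^ 2).aestronglyMeasurable
  · rw [Real.norm_of_nonneg (by positivity), ← div_eq_mul_inv]
    have h1 : 1 + z ^ 2 ≤ ω ^ 2 + z ^ 2 := by nlinarith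
    gcongr
    nlinarith [sq_nonneg z]

lemma integral_quarticWeight_term {ω : ℝ} (hω : 1 ≤ ω) :
    ∫ z : ℝ, 8 / (ω ^ 2 + z ^ 2) ^ 2 = 4 * Real.pi / ω ^ 3 := by
  have h0 : 0 < ω := by linarith
  have hbot : Tendsto (fun z => 4 / ω ^ 3 * Real.arctan (z / ω) + 4 * z / (ω ^ 2 * (ω ^ 2 + z ^ 2)))
      atBot (𝓝 (4 / ω ^ 3 * -(Real.pi / 2) + 0)) :=
    ((tendsto_nhds_of_tendsto_nhdsWithin Real.tendsto_arctan_atBot).comp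
      (tendsto_id.atBot_div_const h0)).const_mul _ |>.add
      (tendsto_div_sq_add_sq h0 tendsto_abs_atBot_atTop)
  have htop : Tendsto (fun z => 4 / ω ^ 3 * Real.arctan (z / ω) + 4 * z / (ω ^ 2 * (ω ^ 2 + z ^ 2)))
      atTop (𝓝 (4 / ω ^ 3 * (Real.pi / 2) + 0)) :=
    ((tendsto_nhds_of_tendsto_nhdsWithin Real.tendsto_arctan_atTop).comp
      (tendsto_id.atTop_div_const h0)).const_mul _ |>.add
      (tendsto_div_sq_add_sq h0 tendsto_abs_atTop_atTop)
  rw [integral_of_hasDerivAt_of_tendsto (hasDerivAt_quarticWeight_primitive h0)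
    (integrable_quarticWeight_term hω) hbot htop]
  field_simp
  ring

lemma one_le_matsubara (k : ℕ) : 1 ≤ matsubara k := by
  linarith [succ_le_matsubara k, (Nat.cast_nonneg k : (0 : ℝ) ≤ k)]

lemma riemannZeta_three : riemannZeta 3 = ((∑' n : ℕ, 1 / ((n : ℝ) + 1) ^ 3 : ℝ) : ℂ) := by
  have := zeta_nat_eq_tsum_of_gt_one (k := 3) (by norm_num)
  push_cast at this
  rw [this, Complex.ofReal_tsum]
  have hs : Summable fun n : ℕ => 1 / (n : ℂ) ^ 3 := by
    have := Real.summable_one_div_nat_pow (p := 3) |>.2 (by norm_num)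
    have := Complex.ofRealCLM.summable this
    simpa using this
  rw [hs.tsum_eq_zero_add]
  simp

lemma riemannZeta_three_re_pos : 0 < (riemannZeta 3).re := by
  rw [riemannZeta_three, Complex.ofReal_re]
  exact (summable_one_div_succ_pow (by norm_num)).tsum_pos (fun n => by positivity) 0 (by norm_num)

/-- The odd terms of the series for ζ(3) make up 1 - 1/8 of its sum. -/
lemma tsum_inv_matsubara_cube :
    ∑' k, 1 / matsubara k ^ 3 = 7 / 8 * (riemannZeta 3).re / Real.pi ^ 3 := by
  have hs := summable_one_div_succ_pow (n := 3) (by norm_num)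
  have heo := tsum_even_add_odd (f := fun n : ℕ => 1 / ((n : ℝ) + 1) ^ 3)
    (hs.comp_injective (i := fun n => 2 * n) fun a b h => by simpa using h)
    (hs.comp_injective (i := fun n => 2 * n + 1) fun a b h => by simpa using h)
  have e1 : ∑' k : ℕ, 1 / (((2 * k : ℕ) : ℝ) + 1) ^ 3 =
      Real.pi ^ 3 * ∑' k, 1 / matsubara k ^ 3 := by
    rw [← tsum_mul_left]; congr 1; ext k; unfold matsubara; push_cast
    have := Real.pi_ne_zero
    field_simp
  have e2 : ∑' k : ℕ, 1 / (((2 * k + 1 : ℕ) : ℝ) + 1) ^ 3 =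
      1 / 8 * ∑' n : ℕ, 1 / ((n : ℝ) + 1) ^ 3 := by
    rw [← tsum_mul_left]; congr 1; ext k; push_cast
    rw [show 2 * (k : ℝ) + 1 + 1 = 2 * (k + 1) by ring]
    field_simp; norm_num
  rw [e1, e2] at heo
  rw [riemannZeta_three, Complex.ofReal_re, eq_div_iff (by positivity)]
  linarith

lemma integral_quarticWeight :
    ∫ z, quarticWeight z = 7 * (riemannZeta 3).re / (2 * Real.pi ^ 2) := by
  have h := hasSum_integral_of_summable_integral_norm (μ := volume)
    (F := fun k (z : ℝ) => 8 / (matsubara k ^ 2 + z ^ 2) ^ 2)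
    (fun k => integrable_quarticWeight_term (one_le_matsubara k)) (by
      refine ((summable_inv_matsubara_pow (n := 3) (by norm_num)).mul_left (4 * Real.pi)).congr
        fun k => ?_
      rw [mul_one_div, ← integral_quarticWeight_term (one_le_matsubara k)]
      refine integral_congr_ae (Eventually.of_forall fun z => ?_)
      exact (Real.norm_of_nonneg (by positivity)).symm)
  have := h.tsum_eq
  simp only [integral_quarticWeight_term (one_le_matsubara _)] at this
  unfold quarticWeight
  rw [← this]
  simp only [← mul_one_div (4 * Real.pi)]
  rw [tsum_mul_left, tsum_inv_matsubara_cube]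
  have := Real.pi_ne_zero
  field_simp
  ring

/-- The weight `1 / cosh²(z/2)`. -/
def quadraticWeight (z : ℝ) : ℝ := 1 / Real.cosh (z / 2) ^ 2

lemma quadraticWeight_pos (z : ℝ) : 0 < quadraticWeight z := by
  have := Real.cosh_pos (z / 2)
  unfold quadraticWeight; positivity

lemma continuous_quadraticWeight : Continuous quadraticWeight :=
  continuous_const.div (by fun_prop) fun z => by have := Real.cosh_pos (z / 2); positivity

lemma quadraticWeight_le (z : ℝ) : quadraticWeight z ≤ 4 / (1 + z ^ 2) := by
  have h1 := Real.cosh_pos (z / 2)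
  rw [quadraticWeight, div_le_div_iff₀ (by positivity) (by positivity), Real.cosh_sq]
  have : (z / 2) ^ 2 ≤ Real.sinh (z / 2) ^ 2 := by
    rw [← sq_abs (z / 2), ← sq_abs (Real.sinh _), Real.abs_sinh]
    exact pow_le_pow_left₀ (abs_nonneg _) (Real.self_le_sinh_iff.2 (abs_nonneg _)) 2
  linarith

lemma tendsto_tanh_atTop : Tendsto Real.tanh atTop (𝓝 1) := by
  have h : ∀ x : ℝ, Real.tanh x = 1 - 2 / (Real.exp (2 * x) + 1) := by
    intro x
    have h2 : Real.exp (2 * x) = Real.exp x * Real.exp x := by rw [← Real.exp_add]; ring_nf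
    rw [Real.tanh_eq, h2, Real.exp_neg]
    have := Real.exp_pos x
    field_simp
    ring
  have h3 : Tendsto (fun x : ℝ => 2 / (Real.exp (2 * x) + 1)) atTop (𝓝 0) := by
    refine Tendsto.const_div_atTop ?_ 2
    exact tendsto_atTop_add_const_right _ _
      (Real.tendsto_exp_atTop.comp (tendsto_id.const_mul_atTop two_pos))
  have := h3.const_sub 1
  rw [sub_zero] at this
  exact this.congr fun x => (h x).symm

lemma tendsto_tanh_atBot : Tendsto Real.tanh atBot (𝓝 (-1)) := by
  have := (tendsto_tanh_atTop.comp tendsto_neg_atBot_atTop).neg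
  exact this.congr fun x => by simp

/-- A primitive is 2 tanh(z/2), running from -2 to 2. -/
lemma integral_quadraticWeight : ∫ z, quadraticWeight z = 4 := by
  have hd : ∀ z, HasDerivAt (fun z => 2 * Real.tanh (z / 2)) (quadraticWeight z) z := by
    intro z
    have hc := (Real.cosh_pos (z / 2)).ne'
    have h1 : HasDerivAt (fun x : ℝ => x / 2) (1 / 2) z := (hasDerivAt_id z).div_const 2
    have := ((h1.sinh).div h1.cosh hc).const_mul 2
    refine (this.congr_of_eventuallyEq ?_).congr_deriv ?_
    · exact Eventually.of_forall fun x => by simp [Real.tanh_eq_sinh_div_cosh]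
    · have := Real.cosh_sq (z / 2)
      unfold quadraticWeight
      field_simp
      linarith
  have hi : Integrable quadraticWeight := by
    refine (integrable_inv_one_add_sq.const_mul 4).mono'
      continuous_quadraticWeight.aestronglyMeasurable (Eventually.of_forall fun z => ?_)
    rw [Real.norm_of_nonneg (quadraticWeight_pos z).le, ← div_eq_mul_inv]
    exact quadraticWeight_le z
  rw [integral_of_hasDerivAt_of_tendsto hd hi
    ((tendsto_tanh_atBot.comp (tendsto_id.atBot_div_const two_pos)).const_mul 2)
    ((tendsto_tanh_atTop.comp (tendsto_id.atTop_div_const two_pos)).const_mul 2)]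
  norm_num

end

/-! ### Concentration of rescaled weights on the Fermi sphere -/

section

open Filter Topology

variable {d : ℕ}

/-- The limit as `T → 0` of the mass per unit energy of the shell `|p² - μ| ≲ T`. -/
def shellMass (d : ℕ) (μ : ℝ) : ℝ :=
  d * volume.real (Metric.ball (0 : Space d) 1) * (Real.sqrt μ ^ (d - 1) / (2 * Real.sqrt μ))

lemma shellMass_pos (hd : 1 ≤ d) {μ : ℝ} (hμ : 0 < μ) : 0 < shellMass d μ := by
  have h1 : 0 < volume.real (Metric.ball (0 : Space d) 1) :=
    ENNReal.toReal_pos (Metric.measure_ball_pos _ _ one_pos).ne' measure_ball_lt_top.ne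
  have h2 : 0 < (d : ℝ) := by exact_mod_cast hd
  have h3 := Real.sqrt_pos.2 hμ
  unfold shellMass
  positivity

/-- With z = (p² - μ)/T, a bound C/(1 + z²) decays like |p|^{-4}, which is integrable because d ≤ 3.
-/
lemma integrable_weight (hd : d ≤ 3) {μ T : ℝ} (hT : 0 < T) {h : ℝ → ℝ} (hc : Continuous h)
    (h0 : ∀ z, 0 ≤ h z) {C : ℝ} (hC : ∀ z, h z ≤ C / (1 + z ^ 2)) :
    Integrable fun p : Space d => h ((‖p‖ ^ 2 - μ) / T) := by
  have hC0 : 0 ≤ C := by simpa using (h0 0).trans (hC 0)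
  have hint : Integrable fun p : Space d => (1 + ‖p‖) ^ (-4 : ℝ) :=
    integrable_one_add_norm (by
      rw [finrank_euclideanSpace_fin]
      have : (d : ℝ) ≤ 3 := by exact_mod_cast hd
      linarith)
  refine (hint.const_mul (C * (8 + 16 * μ ^ 2 + 16 * T ^ 2))).mono'
    (hc.comp (by fun_prop : Continuous fun p : Space d =>
      (‖p‖ ^ 2 - μ) / T)).aestronglyMeasurable (Eventually.of_forall fun p => ?_)
  rw [Real.norm_of_nonneg (h0 _)]
  refine (hC _).trans ?_
  have hx := norm_nonneg p
  set x := ‖p‖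
  rw [Real.rpow_neg (by positivity), ← div_eq_mul_inv,
    show (1 + x) ^ (4 : ℝ) = (1 + x) ^ 4 by exact_mod_cast Real.rpow_natCast (1 + x) 4,
    div_le_div_iff₀ (by positivity) (by positivity), mul_assoc]
  gcongr
  set z := (x ^ 2 - μ) / T with hz
  have hzT : x ^ 2 - μ = T * z := by rw [hz]; field_simp
  have h1 : (1 + x) ^ 2 ≤ 2 * (1 + x ^ 2) := by nlinarith [sq_nonneg (x - 1)]
  have h2 : (1 + x) ^ 4 ≤ 4 * (1 + x ^ 2) ^ 2 := by
    have := pow_le_pow_left₀ (sq_nonneg (1 + x)) h1 2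
    nlinarith
  have h3 : (1 + x ^ 2) ^ 2 ≤ 2 + 2 * (x ^ 2) ^ 2 := by nlinarith [sq_nonneg (x ^ 2 - 1)]
  have h4 : (x ^ 2) ^ 2 ≤ 2 * (T * z) ^ 2 + 2 * μ ^ 2 := by
    rw [← hzT]; nlinarith [sq_nonneg (x ^ 2 - 2 * μ)]
  have h5 : 0 ≤ μ ^ 2 * z ^ 2 := by positivity
  have h6 := sq_nonneg T
  have h7 := sq_nonneg z
  nlinarith

/-- Polar coordinates followed by r = √μ + Ts, whose Jacobian cancels the prefactor 1/T. -/
lemma integral_radial_rescaled (hd : 1 ≤ d) {μ T : ℝ} (hT : 0 < T) (h m : ℝ → ℝ) :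
    1 / T * ∫ p : Space d, h ((‖p‖ ^ 2 - μ) / T) * m ‖p‖ =
      d * volume.real (Metric.ball (0 : Space d) 1) *
        ∫ s : ℝ, (Set.Ioi (0 : ℝ)).indicator (fun r => r ^ (d - 1) * (h ((r ^ 2 - μ) / T) * m r))
          (Real.sqrt μ + T * s) := by
  have : Nonempty (Fin d) := ⟨⟨0, hd⟩⟩
  have h1 := integral_fun_norm_addHaar (volume : Measure (Space d))
    (fun r => h ((r ^ 2 - μ) / T) * m r)
  rw [h1, finrank_euclideanSpace_fin, ← integral_indicator measurableSet_Ioi,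
    Measure.integral_comp_mul_left (fun y => (Set.Ioi (0 : ℝ)).indicator
      (fun r => r ^ (d - 1) * (h ((r ^ 2 - μ) / T) * m r)) (Real.sqrt μ + y)) T,
    integral_add_left_eq_self (fun y => (Set.Ioi (0 : ℝ)).indicator
      (fun r => r ^ (d - 1) * (h ((r ^ 2 - μ) / T) * m r)) y) (Real.sqrt μ),
    abs_of_pos (inv_pos.2 hT)]
  simp only [smul_eq_mul, nsmul_eq_mul]
  ring

/-- A dominating function independent of T ≤ 1. With y = 2σ + Ts ≥ σ, the factor (σ + Ts)^n is at
most a constant times y² because n ≤ 2. Then y²/(1 + s²y²) is compared with 1/(1 + s²): for s² ≤ 1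
because y ≤ 2σ + 1, for s² ≥ 1 because y² ≤ s²y². -/
lemma rescaled_weight_le {k σ T s C : ℝ} {n : ℕ} (hn : n ≤ 2) (hσ : 0 < σ) (hT : 0 < T)
    (hT1 : T ≤ 1) (hs : 0 < σ + T * s) (hC : 0 ≤ C)
    (hk : k ≤ C / (1 + (s * (2 * σ + T * s)) ^ 2)) :
    (σ + T * s) ^ n * k ≤
      (1 + (1 / σ) ^ 2) * (C * (2 + (2 * σ + 1) ^ 2)) * (1 + s ^ 2)⁻¹ := by
  set y := 2 * σ + T * s with hy
  have hyσ : σ ≤ y := by rw [hy]; linarith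
  have hy0 : 0 < y := hσ.trans_le hyσ
  have h1 : (σ + T * s) ^ n ≤ (1 + (1 / σ) ^ 2) * y ^ 2 := by
    refine (pow_le_pow_left₀ hs.le (by rw [hy]; linarith : σ + T * s ≤ y) n).trans ?_
    have hu : 1 ≤ (1 / σ) ^ 2 * y ^ 2 := by
      rw [← mul_pow]
      refine one_le_pow₀ ?_
      rw [one_div, inv_mul_eq_div, le_div_iff₀ hσ]; linarith
    have : y ^ n ≤ 1 + y ^ 2 := by
      interval_cases n <;> nlinarith [sq_nonneg (y - 1)]
    nlinarith
  have h2 : y ^ 2 / (1 + (s * y) ^ 2) ≤ (2 + (2 * σ + 1) ^ 2) / (1 + s ^ 2) := by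
    rw [div_le_div_iff₀ (by positivity) (by positivity)]
    have hsy : 0 ≤ (s * y) ^ 2 := sq_nonneg _
    rcases le_total (s ^ 2) 1 with h | h
    · have hs1 : s ≤ 1 := by nlinarith
      have : y ≤ 2 * σ + 1 := by rw [hy]; nlinarith
      have : y ^ 2 ≤ (2 * σ + 1) ^ 2 := by gcongr
      nlinarith [sq_nonneg (2 * σ + 1), mul_nonneg (sq_nonneg (2 * σ + 1)) hsy]
    · have : y ^ 2 ≤ (s * y) ^ 2 := by rw [mul_pow]; nlinarith [sq_nonneg y]
      nlinarith [sq_nonneg (2 * σ + 1), mul_nonneg (sq_nonneg (2 * σ + 1)) hsy]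
  calc (σ + T * s) ^ n * k ≤ (σ + T * s) ^ n * (C / (1 + (s * y) ^ 2)) := by gcongr
    _ ≤ (1 + (1 / σ) ^ 2) * y ^ 2 * (C / (1 + (s * y) ^ 2)) := by gcongr
    _ = (1 + (1 / σ) ^ 2) * C * (y ^ 2 / (1 + (s * y) ^ 2)) := by ring
    _ ≤ (1 + (1 / σ) ^ 2) * C * ((2 + (2 * σ + 1) ^ 2) / (1 + s ^ 2)) := by gcongr
    _ = _ := by ring

/-- As `T → 0`, the weight `h((p² - μ)/T)/T` concentrates on the sphere `p² = μ`. -/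
lemma tendsto_integral_radial (hd : 1 ≤ d) (hd3 : d ≤ 3) {μ : ℝ} (hμ : 0 < μ) {h : ℝ → ℝ}
    (hc : Continuous h) (h0 : ∀ z, 0 ≤ h z) {C : ℝ} (hC : ∀ z, h z ≤ C / (1 + z ^ 2))
    {T : ℕ → ℝ} (hT0 : ∀ n, 0 < T n) (hT : Tendsto T atTop (𝓝 0)) {m : ℕ → ℝ → ℝ}
    (hmeas : ∀ n, Measurable (m n)) {M : ℝ} (hm0 : ∀ n r, 0 ≤ m n r) (hM : ∀ n r, m n r ≤ M)
    (hm : ∀ s, Tendsto (fun n => m n (Real.sqrt μ + T n * s)) atTop (𝓝 1)) :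
    Tendsto (fun n => 1 / T n * ∫ p : Space d, h ((‖p‖ ^ 2 - μ) / T n) * m n ‖p‖) atTop
      (𝓝 (shellMass d μ * ∫ z, h z)) := by
  have hC0 : 0 ≤ C := by simpa using (h0 0).trans (hC 0)
  have hσ := Real.sqrt_pos.2 hμ
  have hσ2 := Real.sq_sqrt hμ.le
  set σ := Real.sqrt μ with hσdef
  have hM0 : 0 ≤ M := (hm0 0 0).trans (hM 0 0)
  simp only [fun n => integral_radial_rescaled (μ := μ) hd (hT0 n) h (m n)]
  have hlim : shellMass d μ * ∫ z, h z = d * volume.real (Metric.ball (0 : Space d) 1) *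
      ∫ s, σ ^ (d - 1) * h (2 * σ * s) := by
    rw [integral_const_mul, Measure.integral_comp_mul_left h (2 * σ), shellMass,
      abs_of_pos (by positivity), smul_eq_mul, ← hσdef]
    ring
  rw [hlim]
  refine Tendsto.const_mul _ ?_
  -- The argument of h tends to 2√μ s; the resulting factor 1/(2√μ) is the one in `shellMass`.
  have hfact : ∀ (t s : ℝ), 0 < t → ((σ + t * s) ^ 2 - μ) / t = s * (2 * σ + t * s) := by
    intro t s ht
    rw [div_eq_iff ht.ne', ← hσ2]; ring
  refine tendsto_integral_filter_of_dominated_convergence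
    (fun s => (1 + (1 / σ) ^ 2) * (C * (2 + (2 * σ + 1) ^ 2)) * (1 + s ^ 2)⁻¹ * M) ?_ ?_
    ((integrable_inv_one_add_sq.const_mul _).mul_const _) ?_
  · refine Eventually.of_forall fun n => Measurable.aestronglyMeasurable ?_
    have h1 : Measurable fun r : ℝ => r ^ (d - 1) * (h ((r ^ 2 - μ) / T n) * m n r) := by
      have := hc.measurable
      have := hmeas n
      fun_prop
    exact (h1.indicator measurableSet_Ioi).comp (by fun_prop)
  · filter_upwards [hT.eventually_le_const one_pos] with n hn
    refine Eventually.of_forall fun s => ?_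
    by_cases hs : 0 < σ + T n * s
    · rw [Set.indicator_of_mem (Set.mem_Ioi.2 hs), hfact _ _ (hT0 n), ← mul_assoc,
        Real.norm_of_nonneg (by have := h0 (s * (2 * σ + T n * s)); have := hm0 n (σ + T n * s); positivity)]
      have := rescaled_weight_le (n := d - 1) (by omega) hσ (hT0 n) hn hs hC0 (hC _)
      exact mul_le_mul this (hM _ _) (hm0 _ _) (by positivity)
    · rw [Set.indicator_of_notMem (by simpa using hs), norm_zero]
      positivity
  · refine Eventually.of_forall fun s => ?_
    have hr : Tendsto (fun n => σ + T n * s) atTop (𝓝 σ) := by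
      simpa using (hT.mul_const s).const_add σ
    have hz : Tendsto (fun n => s * (2 * σ + T n * s)) atTop (𝓝 (2 * σ * s)) := by
      have := ((hT.mul_const s).const_add (2 * σ)).const_mul s
      rwa [zero_mul, add_zero, mul_comm s] at this
    have := (hr.pow (d - 1)).mul (((hc.tendsto _).comp hz).mul (hm s))
    rw [mul_one] at this
    refine this.congr' ?_
    filter_upwards [hr.eventually_const_lt hσ] with n hn
    rw [Set.indicator_of_mem (Set.mem_Ioi.2 hn), hfact _ _ (hT0 n)]
    rfl

end

/-! ### Universality of the ratio of the two integrals -/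

section

open Filter Topology

variable {d : ℕ}

lemma exists_weight_le : ∃ C : ℝ, (∀ z, quarticWeight z ≤ C / (1 + z ^ 2)) ∧
    ∀ z, quadraticWeight z ≤ C / (1 + z ^ 2) := by
  refine ⟨max (∑' k, 8 * (1 / matsubara k ^ 2)) 4, fun z => ?_, fun z => ?_⟩
  · exact (quarticWeight_le z).trans (by gcongr; exact le_max_left _ _)
  · exact (quadraticWeight_le z).trans (by gcongr; exact le_max_right _ _)

section IsGap

variable {μ lam T : ℝ} {W F : Space d → ℝ}

lemma IsGap.integral_weight_pos (hF : IsGap μ lam T W F) (hd : d ≤ 3) {h : ℝ → ℝ}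
    (hc : Continuous h) (h0 : ∀ z, 0 < h z) {C : ℝ} (hC : ∀ z, h z ≤ C / (1 + z ^ 2)) (j : ℕ) :
    0 < ∫ p, h ((‖p‖ ^ 2 - μ) / T) * F p ^ j := by
  obtain ⟨M, hM⟩ := hF.bdd
  have hcont : Continuous fun p : Space d => h ((‖p‖ ^ 2 - μ) / T) * F p ^ j :=
    (hc.comp (by fun_prop : Continuous fun p : Space d => (‖p‖ ^ 2 - μ) / T)).mul (hF.cont.pow j)
  have hpos : ∀ p, 0 < h ((‖p‖ ^ 2 - μ) / T) * F p ^ j := fun p =>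
    mul_pos (h0 _) (pow_pos (hF.pos p) j)
  have hint : Integrable fun p : Space d => h ((‖p‖ ^ 2 - μ) / T) * F p ^ j := by
    refine ((integrable_weight (μ := μ) hd hF.temp_pos hc (fun z => (h0 z).le) hC).mul_const
      (M ^ j)).mono' hcont.aestronglyMeasurable (Eventually.of_forall fun p => ?_)
    rw [Real.norm_of_nonneg (hpos p).le]
    have := (h0 ((‖p‖ ^ 2 - μ) / T)).le
    have := (hF.pos p).le
    gcongr
    exact hM p
  rw [integral_pos_iff_support_of_nonneg (fun p => (hpos p).le) hint,
    Function.support_eq_univ fun p => (hpos p).ne']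
  exact isOpen_univ.measure_pos volume Set.univ_nonempty

end IsGap

/-- Gap functions that become constant near the Fermi sphere drop out of rescaled integrals. -/
lemma tendsto_integral_weight_mul_gap (hd : 1 ≤ d) (hd3 : d ≤ 3) {μ : ℝ} (hμ : 0 < μ)
    {W : Space d → ℝ} (hW : IsAttractive W) {lam T : ℕ → ℝ} {F : ℕ → Space d → ℝ}
    (hF : ∀ n, IsGap μ (lam n) (T n) W (F n)) {p₀ : ℕ → Space d}
    (hp₀ : ∀ n, ‖p₀ n‖ = Real.sqrt μ) {K : ℝ} (hK : ∀ n p, F n p ≤ K * F n (p₀ n))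
    (hT : Tendsto T atTop (𝓝 0))
    (hnear : ∀ ε > 0, ∃ δ > 0, ∀ᶠ n in atTop, ∀ p, |‖p‖ - Real.sqrt μ| < δ →
      |F n p - F n (p₀ n)| ≤ ε * F n (p₀ n))
    {h : ℝ → ℝ} (hc : Continuous h) (h0 : ∀ z, 0 ≤ h z) {C : ℝ}
    (hC : ∀ z, h z ≤ C / (1 + z ^ 2)) (j : ℕ) :
    Tendsto (fun n => 1 / T n * ∫ p, h ((‖p‖ ^ 2 - μ) / T n) * (F n p / F n (p₀ n)) ^ j) atTop
      (𝓝 (shellMass d μ * ∫ z, h z)) := by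
  have hσ := Real.sqrt_pos.2 hμ
  set σ := Real.sqrt μ
  have hnorm : ∀ n r, 0 ≤ r → ‖(r / σ) • p₀ n‖ = r := fun n r hr => by
    rw [norm_smul, hp₀, Real.norm_of_nonneg (by positivity), div_mul_cancel₀ _ hσ.ne']
  have hpos : ∀ n p, 0 < F n p / F n (p₀ n) := fun n p => div_pos ((hF n).pos _) ((hF n).pos _)
  have hrad : ∀ n p, F n ((‖p‖ / σ) • p₀ n) = F n p := fun n p =>
    (hF n).radial hW (hnorm n _ (norm_nonneg p))
  have key := tendsto_integral_radial hd hd3 hμ hc h0 hC (fun n => (hF n).temp_pos) hT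
    -- The normalised gap function as a function of the radius, evaluated along the ray through p₀;
    -- radiality identifies it with F on all of space.
    (m := fun n r => (F n ((r / σ) • p₀ n) / F n (p₀ n)) ^ j) (M := K ^ j)
    (fun n => ?_) (fun n r => (pow_pos (hpos n _) j).le) (fun n r => ?_) (fun s => ?_)
  · simpa only [hrad] using key
  · have := (hF n).cont
    exact Continuous.measurable (by fun_prop)
  · refine pow_le_pow_left₀ (hpos n _).le ?_ j
    rw [div_le_iff₀ ((hF n).pos _)]
    exact hK n _
  · rw [← one_pow j]
    refine Tendsto.pow ?_ j
    rw [Metric.tendsto_nhds]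
    intro ε hε
    obtain ⟨δ, hδ, hn⟩ := hnear (ε / 2) (half_pos hε)
    have hTs : Tendsto (fun n => T n * s) atTop (𝓝 0) := by simpa using hT.mul_const s
    filter_upwards [hn, Metric.tendsto_nhds.1 hTs (min δ σ) (lt_min hδ hσ)] with n h1 h2
    rw [Real.dist_eq, sub_zero] at h2
    have h3 : 0 < σ + T n * s := by linarith [(abs_lt.1 (h2.trans_le (min_le_right _ _))).1]
    have h4 := h1 (((σ + T n * s) / σ) • p₀ n) (by
      rw [hnorm n _ h3.le, add_sub_cancel_left]; exact h2.trans_le (min_le_left _ _))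
    have hF0 := (hF n).pos (p₀ n)
    rw [Real.dist_eq, div_sub_one hF0.ne', abs_div, abs_of_pos hF0, div_lt_iff₀ hF0]
    nlinarith

lemma Cuniv_pos : 0 < Cuniv := by
  have := riemannZeta_three_re_pos
  unfold Cuniv
  positivity

/-- Universality of the ratio of the two Ginzburg--Landau integrals at weak coupling. -/
lemma exists_weight_ratio_near (hd : 1 ≤ d) (hd3 : d ≤ 3) {μ : ℝ} (hμ : 0 < μ)
    {W : Space d → ℝ} (hW : IsAttractive W) {B : ℝ} (hB0 : 0 ≤ B) (hB : FormBounded W B)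
    {ε : ℝ} (hε : 0 < ε) :
    ∃ Λ : ℝ, 0 < Λ ∧ ∀ (lam T : ℝ) (F : Space d → ℝ), IsGap μ lam T W F → lam < Λ →
      ∀ p₀ : Space d, ‖p₀‖ = Real.sqrt μ →
      |F p₀ * Real.sqrt ((∫ p, quadraticWeight ((‖p‖ ^ 2 - μ) / T) * F p ^ 2) /
        ∫ p, quarticWeight ((‖p‖ ^ 2 - μ) / T) * F p ^ 4) / Cuniv - 1| ≤ ε := by
  obtain ⟨Λ, hΛ, K, hK, hbd⟩ := exists_weak_coupling_bounds hμ hW hB0 hB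
  -- Uniformity in F and p₀ is obtained by contradiction: a sequence of counterexamples has
  -- couplings tending to 0, and therefore temperatures tending to 0.
  by_contra! hcon
  choose lam T F hF hlam p₀ hp₀ hlarge using fun n : ℕ =>
    hcon (min Λ (1 / ((n : ℝ) + 1))) (lt_min hΛ (by positivity))
  have hlamΛ : ∀ n, lam n < Λ := fun n => (hlam n).trans_le (min_le_left _ _)
  have hlam0 : Tendsto lam atTop (𝓝 0) :=
    squeeze_zero (fun n => (hF n).lam_pos.le) (fun n => (hlam n).le.trans (min_le_right _ _))
      tendsto_one_div_add_atTop_nhds_zero_nat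
  have hT : Tendsto T atTop (𝓝 0) :=
    squeeze_zero (fun n => (hF n).temp_pos.le)
      (fun n => (hbd _ _ _ (hF n) (hlamΛ n) _ (hp₀ n)).1) (by simpa using hlam0.const_mul K)
  have hnear : ∀ ε > 0, ∃ δ > 0, ∀ᶠ n in atTop, ∀ p, |‖p‖ - Real.sqrt μ| < δ →
      |F n p - F n (p₀ n)| ≤ ε * F n (p₀ n) := by
    intro ε hε
    obtain ⟨Λ', hΛ', δ, hδ, h⟩ := exists_gap_near_const hμ hW hB0 hB hε
    refine ⟨δ, hδ, ?_⟩
    filter_upwards [hlam0.eventually_lt_const hΛ'] with n hn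
    exact h _ _ _ (hF n) hn _ (hp₀ n)
  obtain ⟨C, hC4, hC2⟩ := exists_weight_le
  have hbdK : ∀ n p, F n p ≤ K * F n (p₀ n) := fun n =>
    (hbd _ _ _ (hF n) (hlamΛ n) _ (hp₀ n)).2.1
  have h2 := tendsto_integral_weight_mul_gap hd hd3 hμ hW hF hp₀ hbdK hT hnear
    continuous_quadraticWeight (fun z => (quadraticWeight_pos z).le) hC2 2
  have h4 := tendsto_integral_weight_mul_gap hd hd3 hμ hW hF hp₀ hbdK hT hnear
    continuous_quarticWeight (fun z => (quarticWeight_pos z).le) hC4 4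
  have hm := shellMass_pos hd hμ
  have hζ := riemannZeta_three_re_pos
  rw [integral_quadraticWeight] at h2
  rw [integral_quarticWeight] at h4
  have hlim := ((h2.div h4 (by positivity)).sqrt).div_const Cuniv
  -- The density of states cancels and 4 · 2π²/(7ζ(3)) is the square of `Cuniv`.
  have hone : Real.sqrt (shellMass d μ * 4 /
      (shellMass d μ * (7 * (riemannZeta 3).re / (2 * Real.pi ^ 2)))) / Cuniv = 1 := by
    rw [div_eq_one_iff_eq Cuniv_pos.ne', Cuniv]
    congr 1
    field_simp
    norm_num
  rw [hone] at hlim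
  obtain ⟨n, hn⟩ := ((Metric.tendsto_nhds.1 hlim ε hε)).exists
  refine absurd hn (not_lt.2 ?_)
  rw [Real.dist_eq]
  refine (hlarge n).le.trans_eq ?_
  congr 3
  have hF0 := (hF n).pos (p₀ n)
  have hT0 := (hF n).temp_pos
  have hI4 := (hF n).integral_weight_pos hd3 continuous_quarticWeight quarticWeight_pos hC4 4
  rw [← Real.sqrt_sq hF0.le, ← Real.sqrt_mul (by positivity)]
  congr 1
  simp only [Pi.div_apply, div_pow, ← mul_div_assoc, integral_div]
  field_simp

end

/-! ### Minimizers of the Ginzburg–Landau functional -/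

section

open Filter Topology

variable {d : ℕ} {V : Space d → ℝ} {μ lam C : ℝ} {a : L2 d}

/-- Needed because the formula g₁(z)/z evaluates to 0 at z = 0 by the division convention, unlike
its continuous extension. -/
lemma ae_norm_sq_ne (hμ : 0 < μ) : ∀ᵐ p : Space d, ‖p‖ ^ 2 ≠ μ := by
  have : volume (Metric.sphere (0 : Space d) (Real.sqrt μ)) = 0 :=
    Measure.addHaar_sphere_of_ne_zero _ _ (Real.sqrt_pos.2 hμ).ne'
  refine measure_mono_null (fun p hp => ?_) this
  simp only [Set.mem_compl_iff, Set.mem_ofPred_eq, not_not] at hp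
  rw [mem_sphere_zero_iff_norm, ← hp, Real.sqrt_sq (norm_nonneg p)]

/-- Half of `Δ₀`, as the positive continuous gap function of the ground state. -/
def groundGap (lam : ℝ) (V : Space d → ℝ) (a : L2 d) : Space d → ℝ :=
  gap lam (attr V) fun q => (hat a q).re

lemma IsGroundState.isGap (h : SobolevDual V C) (hC : 0 ≤ C) (hV : Integrable V)
    (hn : IsNegativeType V) (hlam : 0 < lam) (ha : IsGroundState μ lam V a) :
    IsGap μ lam (critTemp μ lam V) (attr V) (groundGap lam V a) :=
  (ha.isGapSol h hC hV hn hlam).isGap (isAttractive_attr h hC hV hn)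

lemma IsGroundState.abs_kin_mul_norm_hat (h : SobolevDual V C) (hC : 0 ≤ C) (hV : Integrable V)
    (hn : IsNegativeType V) (hlam : 0 < lam) (ha : IsGroundState μ lam V a) :
    ∀ᵐ p, |kin μ (critTemp μ lam V) p| * ‖hat a p‖ = groundGap lam V a p := by
  have hsol := ha.isGapSol h hC hV hn hlam
  filter_upwards [hsol.eq, hsol.pos, ha.hat_eq] with p h1 h2 h3
  rw [h3, Complex.norm_real, Real.norm_of_nonneg h2.le, abs_of_pos (kin_pos hsol.temp_pos p), h1,
    groundGap]

lemma IsGroundState.quarticCoeff_eq (hμ : 0 < μ) (h : SobolevDual V C) (hC : 0 ≤ C)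
    (hV : Integrable V) (hn : IsNegativeType V) (hlam : 0 < lam) (ha : IsGroundState μ lam V a) :
    quarticCoeff μ (critTemp μ lam V) a = 1 / critTemp μ lam V ^ 3 *
      ∫ p, quarticWeight ((‖p‖ ^ 2 - μ) / critTemp μ lam V) * groundGap lam V a p ^ 4 := by
  have hT := (ha.isGap h hC hV hn hlam).temp_pos
  unfold quarticCoeff
  congr 1
  refine integral_congr_ae ?_
  filter_upwards [ae_norm_sq_ne hμ, ha.abs_kin_mul_norm_hat h hC hV hn hlam] with p h1 h2
  rw [g1_div_eq (div_ne_zero (sub_ne_zero.2 h1) hT.ne'), ← h2, mul_pow, mul_assoc]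

lemma IsGroundState.quadraticCoeff_eq (h : SobolevDual V C) (hC : 0 ≤ C)
    (hV : Integrable V) (hn : IsNegativeType V) (hlam : 0 < lam) (ha : IsGroundState μ lam V a) :
    quadraticCoeff μ (critTemp μ lam V) a = 1 / (2 * critTemp μ lam V) *
      ∫ p, quadraticWeight ((‖p‖ ^ 2 - μ) / critTemp μ lam V) * groundGap lam V a p ^ 2 := by
  unfold quadraticCoeff
  congr 1
  refine integral_congr_ae ?_
  filter_upwards [ha.abs_kin_mul_norm_hat h hC hV hn hlam] with p h2
  rw [quadraticWeight, ← h2, mul_pow, mul_assoc, div_div, mul_comm 2]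

lemma IsGroundState.quarticCoeff_pos (hd3 : d ≤ 3) (hμ : 0 < μ)
    (h : SobolevDual V C) (hC : 0 ≤ C) (hV : Integrable V) (hn : IsNegativeType V) (hlam : 0 < lam)
    (ha : IsGroundState μ lam V a) : 0 < quarticCoeff μ (critTemp μ lam V) a := by
  obtain ⟨C', hC4, -⟩ := exists_weight_le
  have hF := ha.isGap h hC hV hn hlam
  have := hF.temp_pos
  rw [ha.quarticCoeff_eq hμ h hC hV hn hlam]
  exact mul_pos (by positivity)
    (hF.integral_weight_pos hd3 continuous_quarticWeight quarticWeight_pos hC4 4)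

lemma IsGroundState.quadraticCoeff_nonneg (h : SobolevDual V C) (hC : 0 ≤ C) (hV : Integrable V)
    (hn : IsNegativeType V) (hlam : 0 < lam) (ha : IsGroundState μ lam V a) :
    0 ≤ quadraticCoeff μ (critTemp μ lam V) a := by
  have := (ha.isGap h hC hV hn hlam).temp_pos
  unfold quadraticCoeff
  exact mul_nonneg (by positivity) (integral_nonneg fun p => by positivity)

/-- Complete the square in |ψ|²: the functional is A(|ψ|² - B/(2A))² - B²/(4A). -/
lemma isGLMinimizer_iff (hA : 0 < quarticCoeff μ (critTemp μ lam V) a)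
    (hB : 0 ≤ quadraticCoeff μ (critTemp μ lam V) a) (ψ : ℂ) :
    IsGLMinimizer μ lam V a ψ ↔ ‖ψ‖ = Real.sqrt (quadraticCoeff μ (critTemp μ lam V) a /
      (2 * quarticCoeff μ (critTemp μ lam V) a)) := by
  unfold IsGLMinimizer glFunctional
  set A := quarticCoeff μ (critTemp μ lam V) a
  set B := quadraticCoeff μ (critTemp μ lam V) a
  have hsq : ∀ x : ℝ, x ^ 4 * A - x ^ 2 * B = A * (x ^ 2 - B / (2 * A)) ^ 2 - B ^ 2 / (4 * A) := by
    intro x; field_simp; ring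
  simp only [hsq]
  have hBA : 0 ≤ B / (2 * A) := by positivity
  constructor
  · intro hmin
    have := hmin (Real.sqrt (B / (2 * A)) : ℝ)
    rw [Complex.norm_real, Real.norm_of_nonneg (Real.sqrt_nonneg _), Real.sq_sqrt hBA, sub_self] at this
    have h0 : (‖ψ‖ ^ 2 - B / (2 * A)) ^ 2 = 0 := by
      refine le_antisymm ?_ (sq_nonneg _)
      by_contra! hlt
      nlinarith [mul_pos hA hlt]
    rw [← sub_eq_zero.1 ((pow_eq_zero_iff two_ne_zero).1 h0), Real.sqrt_sq (norm_nonneg ψ)]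
  · intro hψ χ
    rw [hψ, Real.sq_sqrt hBA, sub_self]
    have := mul_nonneg hA.le (sq_nonneg (‖χ‖ ^ 2 - B / (2 * A)))
    linarith

lemma exists_phase {ψ ψ' : ℂ} (h : ‖ψ'‖ = ‖ψ‖) :
    ∃ θ : ℝ, ψ' = Complex.exp (Complex.I * θ) * ψ := by
  refine ⟨ψ'.arg - ψ.arg, ?_⟩
  conv_lhs => rw [← Complex.norm_mul_exp_arg_mul_I ψ', h]
  conv_rhs => enter [2]; rw [← Complex.norm_mul_exp_arg_mul_I ψ]
  rw [mul_left_comm, ← Complex.exp_add]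
  congr 2
  push_cast
  ring

/-- The norm of a minimizer in units of `T_c / Δ₀`. -/
lemma IsGroundState.norm_minimizer_div (hd3 : d ≤ 3) (hμ : 0 < μ)
    (h : SobolevDual V C) (hC : 0 ≤ C) (hV : Integrable V) (hn : IsNegativeType V) (hlam : 0 < lam)
    (ha : IsGroundState μ lam V a) {ψ : ℂ} (hψ : IsGLMinimizer μ lam V a ψ) (p : Space d) :
    ‖ψ‖ / (Cuniv * (critTemp μ lam V / (delta0 lam V a p).re)) = groundGap lam V a p * Real.sqrt
      ((∫ p, quadraticWeight ((‖p‖ ^ 2 - μ) / critTemp μ lam V) * groundGap lam V a p ^ 2) /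
        ∫ p, quarticWeight ((‖p‖ ^ 2 - μ) / critTemp μ lam V) * groundGap lam V a p ^ 4) /
      Cuniv := by
  have hA := ha.quarticCoeff_pos hd3 hμ h hC hV hn hlam
  have hF := ha.isGap h hC hV hn hlam
  have hT := hF.temp_pos
  rw [(isGLMinimizer_iff hA (ha.quadraticCoeff_nonneg h hC hV hn hlam) ψ).1 hψ,
    ha.quarticCoeff_eq hμ h hC hV hn hlam, ha.quadraticCoeff_eq h hC hV hn hlam,
    ha.delta0_eq hn, Complex.ofReal_re]
  change _ / (Cuniv * (_ / (2 * groundGap lam V a p))) = _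
  set T := critTemp μ lam V
  set I2 := ∫ p, quadraticWeight ((‖p‖ ^ 2 - μ) / T) * groundGap lam V a p ^ 2
  set I4 := ∫ p, quarticWeight ((‖p‖ ^ 2 - μ) / T) * groundGap lam V a p ^ 4
  have hFp := hF.pos p
  have hcu := Cuniv_pos
  -- The factor T/2 meets Δ₀ = 2F, so all factors of 2 and T cancel in the quotient.
  have : 1 / (2 * T) * I2 / (2 * (1 / T ^ 3 * I4)) = (T / 2) ^ 2 * (I2 / I4) := by
    field_simp
  rw [this, Real.sqrt_mul (by positivity), Real.sqrt_sq (by positivity)]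
  field_simp

end

end BCS

end

theorem proposition3p8 (d : ℕ) (hd : d = 1 ∨ d = 2 ∨ d = 3) (μ : ℝ) (hμ : 0 < μ)
    (V : BCS.Space d → ℝ) (hV : BCS.IsAdmissible V) (hVneg : BCS.IsNegativeType V) :
    (∀ lam : ℝ, 0 < lam → ∀ a : BCS.L2 d, BCS.IsGroundState μ lam V a →
      (∃ ψ : ℂ, BCS.IsGLMinimizer μ lam V a ψ) ∧
      (∀ ψ ψ' : ℂ, BCS.IsGLMinimizer μ lam V a ψ → BCS.IsGLMinimizer μ lam V a ψ' →
        ∃ θ : ℝ, ψ' = Complex.exp (Complex.I * θ) * ψ) ∧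
      (∀ p : BCS.Space d, ‖p‖ = Real.sqrt μ →
        0 < (BCS.delta0 lam V a p).re ∧ (BCS.delta0 lam V a p).im = 0)) ∧
    (∀ ε : ℝ, 0 < ε → ∃ lam₀ : ℝ, 0 < lam₀ ∧
      ∀ lam : ℝ, 0 < lam → lam < lam₀ →
      ∀ a : BCS.L2 d, BCS.IsGroundState μ lam V a →
      ∀ ψ : ℂ, BCS.IsGLMinimizer μ lam V a ψ →
      ∀ p : BCS.Space d, ‖p‖ = Real.sqrt μ →
        |‖ψ‖ / (BCS.Cuniv * (BCS.critTemp μ lam V / (BCS.delta0 lam V a p).re)) - 1| ≤ ε) := by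
  have hd1 : 1 ≤ d := by omega
  have hd3 : d ≤ 3 := by omega
  obtain ⟨C, hC, h⟩ := hV.exists_sobolev_dual_bound hd
  have hi := hV.integrable
  refine ⟨fun lam hlam a ha => ?_, fun ε hε => ?_⟩
  · have hmin := BCS.isGLMinimizer_iff (ha.quarticCoeff_pos hd3 hμ h hC hi hVneg hlam)
      (ha.quadraticCoeff_nonneg h hC hi hVneg hlam)
    refine ⟨⟨(Real.sqrt (BCS.quadraticCoeff μ (BCS.critTemp μ lam V) a /
      (2 * BCS.quarticCoeff μ (BCS.critTemp μ lam V) a)) : ℝ), ?_⟩, fun ψ ψ' hψ hψ' => ?_,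
      fun p _ => ?_⟩
    · rw [hmin, Complex.norm_real, Real.norm_of_nonneg (Real.sqrt_nonneg _)]
    · exact BCS.exists_phase (((hmin ψ').1 hψ').trans ((hmin ψ).1 hψ).symm)
    · rw [ha.delta0_eq hVneg, Complex.ofReal_re, Complex.ofReal_im]
      exact ⟨mul_pos two_pos ((ha.isGap h hC hi hVneg hlam).pos p), rfl⟩
  -- One ground state at any coupling gives a positive critical temperature. The infimum of the
  -- empty set is 0, so some T has K_T + λ₁V ≥ 0, and this yields the form bound used for all small
  -- couplings.
  · by_cases hex : ∃ lam : ℝ, 0 < lam ∧ ∃ a : BCS.L2 d, BCS.IsGroundState μ lam V a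
    · obtain ⟨lam₁, hlam₁, a₁, ha₁⟩ := hex
      have hT₁ := (ha₁.isGap h hC hi hVneg hlam₁).temp_pos
      obtain ⟨T, hT, hnn⟩ : {T : ℝ | 0 < T ∧ BCS.IsNonneg μ T lam₁ V}.Nonempty := by
        by_contra hne
        rw [BCS.critTemp, Set.not_nonempty_iff_eq_empty.1 hne, Real.sInf_empty] at hT₁
        exact hT₁.false
      obtain ⟨B, hB0, hB⟩ := hnn.formBounded h hC hi hVneg hT hlam₁
      obtain ⟨Λ, hΛ, hbd⟩ := BCS.exists_weight_ratio_near hd1 hd3 hμ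
        (BCS.isAttractive_attr h hC hi hVneg) hB0 hB hε
      refine ⟨Λ, hΛ, fun lam hlam hlt a ha ψ hψ p hp => ?_⟩
      rw [ha.norm_minimizer_div hd3 hμ h hC hi hVneg hlam hψ p]
      exact hbd _ _ _ (ha.isGap h hC hi hVneg hlam) hlt p hp
    · exact ⟨1, one_pos, fun lam hlam _ a ha => (hex ⟨lam, hlam, a, ha⟩).elim⟩
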